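/- Let $m\ge 1$. For $N=1,2,\dots$ let $$P_N(z_0,\dots,z_m)=\sum_{|J|=N}\frac{a^N_J}{\sqrt{j_0!\cdots j_m!}}\,z_0^{j_0}\cdots z_m^{j_m},\qquad J=(j_0,\dots,j_m),$$ where the $a^N_J$ ($N\ge 1$, $|J|=N$) are independent standard complex Gaussian random variables, i.e. each has density $\frac1\pi e^{-|a|^2}$ on $\mathbb C$ (mean $0$, $E|a^N_J|^2=1$). Let $Z_{P_N}$ denote the current of integration over the zero divisor of $P_N$ in $\mathbb{CP}^m$ (components counted with multiplicity), and let $\omega_{FS}=\frac{\sqrt{-1}}{2\pi}\partial\bar\partial\log|w|^2$, $|w|^2=\sum_{j=0}^m|w_j|^2$, be the Fubini–Study form on $\mathbb{CP}^m$. Then, almost surely, $\frac1N Z_{P_N}\to\omega_{FS}$ weakly in the sense of measures; that is, with probability one, $$\lim_{N\to\infty}\frac1N\,(Z_{P_N},\phi)=\int_{\mathbb{CP}^m}\omega_{FS}\wedge\phi$$ for all continuous $(m-1,m-1)$-forms $\phi$ on $\mathbb{CP}^m$. -/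

import Mathlib

open MeasureTheory ProbabilityTheory Filter Topology

noncomputable section

namespace SUPoly

/-- Homogeneous coordinates `w = (w_0, …, w_{n+1})` on `ℂℙ^m`, where `m = n + 1 ≥ 1`. -/
abbrev Coord (n : ℕ) : Type := Fin (n + 2) → ℂ

/-- The real frame `(v_0, i v_0, v_1, i v_1, …)` attached to complex vectors `v_0, v_1, …`.
The indices of real arguments of a `2p`-form are the elements of `Fin p × Fin 2`, ordered
lexicographically (the order of the pairs does not affect signs). -/
def realFrame {n p : ℕ} (v : Fin p → Coord n) : Fin p × Fin 2 → Coord n :=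
  fun q => if q.2 = 0 then v q.1 else Complex.I • v q.1

/-- Continuous complex-valued differential forms of type `(p, p)` on `ℂℙ^{n+1}`. A form on
projective space is given by its pullback to `ℂ^{n+2} ∖ {0}`; the pullbacks are exactly the forms
that vanish on vectors tangent to the fibres of `w ↦ [w]` and are invariant under the maps
`w ↦ c w`. A form of degree `2p` has type `(p, p)` iff it is unchanged when all of its arguments
are multiplied by the same unimodular number, since that acts on forms of type `(r, s)` as
`c^r * conj c^s`. Values at `w = 0` carry no information. -/
structure ContForm (n p : ℕ) where
  /-- the pullback to `ℂ^{n+2}` -/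
  toFun : Coord n → (Coord n [⋀^(Fin p × Fin 2)]→L[ℝ] ℂ)
  continuousOn : ContinuousOn toFun {0}ᶜ
  horizontal : ∀ w : Coord n, w ≠ 0 → ∀ v : Fin p × Fin 2 → Coord n,
    (∃ q, ∃ c : ℂ, v q = c • w) → toFun w v = 0
  invariant : ∀ w : Coord n, w ≠ 0 → ∀ c : ℂ, c ≠ 0 → ∀ v : Fin p × Fin 2 → Coord n,
    toFun (c • w) (fun q => c • v q) = toFun w v
  type_pp : ∀ w : Coord n, w ≠ 0 → ∀ c : ℂ, ‖c‖ = 1 → ∀ v : Fin p × Fin 2 → Coord n,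
    toFun w (fun q => c • v q) = toFun w v

/-! ### The Fubini-Study form -/

/-- The one-form `d^c f = i (∂̄ - ∂) f`, that is, `v ↦ - df (i v)`. -/
def dc {n : ℕ} (f : Coord n → ℂ) (w : Coord n) : Coord n [⋀^Fin 1]→L[ℝ] ℂ :=
  ContinuousAlternatingMap.ofSubsingleton ℝ (Coord n) ℂ (0 : Fin 1)
    (-((fderiv ℝ f w).comp (Complex.I • ContinuousLinearMap.id ℝ (Coord n))))

/-- The two-form `i ∂ ∂̄ f = (1/2) d d^c f`. -/
def iddbar {n : ℕ} (f : Coord n → ℂ) (w : Coord n) : Coord n [⋀^Fin 2]→L[ℝ] ℂ :=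
  (1 / 2 : ℝ) • extDeriv (dc f) w

/-- The function `log |w|^2`, with `|w|^2 = ∑ |w_j|^2`. -/
def logNormSq {n : ℕ} (w : Coord n) : ℂ :=
  ((Real.log (∑ j, ‖w j‖ ^ 2) : ℝ) : ℂ)

/-- The Fubini-Study form `ω_FS = (i / 2π) ∂ ∂̄ log |w|^2` (its pullback to `ℂ^{n+2} ∖ {0}`). -/
def omegaFS {n : ℕ} (w : Coord n) : Coord n [⋀^Fin 2]→L[ℝ] ℂ :=
  (1 / (2 * Real.pi) : ℝ) • iddbar logNormSq w

/-- The wedge product of a two-form and a `2p`-form at one point: the sum over shuffles. -/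
def wedge {n p : ℕ} (α : Coord n [⋀^Fin 2]→L[ℝ] ℂ) (β : Coord n [⋀^(Fin p × Fin 2)]→L[ℝ] ℂ) :
    Coord n [⋀^(Fin 2 ⊕ Fin p × Fin 2)]→ₗ[ℝ] ℂ :=
  (LinearMap.mul' ℝ ℂ).compAlternatingMap
    (α.toAlternatingMap.domCoprod β.toAlternatingMap)

/-- `∫_{ℂℙ^m} ω_FS ∧ φ`, `m = n + 1`, for a continuous `(m-1, m-1)`-form `φ`. The integral of a
top-degree form is computed in the affine chart `x ↦ [1 : x_0 : … : x_n]`, whose complement has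
measure zero, on the frame `(e_0, i e_0, e_1, i e_1, …, e_n, i e_n)`. -/
def fsPairing {n : ℕ} (φ : ContForm n n) : ℂ :=
  ∫ x : Fin (n + 1) → ℂ,
    wedge (omegaFS (Fin.cons 1 x : Coord n)) (φ.toFun (Fin.cons 1 x : Coord n))
      (Sum.elim
        (fun b : Fin 2 =>
          realFrame (fun _ : Fin 1 => (Pi.single (Fin.succ 0) 1 : Coord n)) (0, b))
        (realFrame (fun i : Fin n => (Pi.single i.succ.succ 1 : Coord n))))

/-! ### The current of integration over a zero divisor -/

/-- The point with `w_j = 1`, with `w_k = t` for `k = j.succAbove k'`, and with the remaining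
`n` coordinates given by `y`. -/
def chartPoint {n : ℕ} (j : Fin (n + 2)) (k' : Fin (n + 1)) (y : Fin n → ℂ) (t : ℂ) : Coord n :=
  j.insertNth (α := fun _ => ℂ) 1 (k'.insertNth (α := fun _ => ℂ) t y)

/-- The partial derivative `∂Q/∂w_i` at `w`. -/
def partialAt {n : ℕ} (Q : MvPolynomial (Fin (n + 2)) ℂ) (i : Fin (n + 2)) (w : Coord n) : ℂ :=
  MvPolynomial.eval w (MvPolynomial.pderiv i Q)

/-- The derivatives of the local graph parametrization of `{Q = 0}` in the chart `w_j = 1`, where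
`w_k`, `k = j.succAbove k'`, is a function of the remaining coordinates `y`: the `i`-th vector is
`∂w/∂y_i = e_i - (∂_i Q / ∂_k Q) e_k`. -/
def graphTangent {n : ℕ} (Q : MvPolynomial (Fin (n + 2)) ℂ) (j : Fin (n + 2)) (k' : Fin (n + 1))
    (w : Coord n) (i : Fin n) : Coord n :=
  Pi.single (j.succAbove (k'.succAbove i)) 1 -
    (partialAt Q (j.succAbove (k'.succAbove i)) w / partialAt Q (j.succAbove k') w) •
      (Pi.single (j.succAbove k') 1 : Coord n)

/-- A partition of unity on the regular part `{Q = 0, dQ ≠ 0}` of a hypersurface, subordinate to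
the cover by the open sets `{w_j ≠ 0, ∂_k Q ≠ 0}`, `k = j.succAbove k' ≠ j`; by Euler's identity
these sets cover the regular part. -/
def weight {n : ℕ} (Q : MvPolynomial (Fin (n + 2)) ℂ) (j : Fin (n + 2)) (k' : Fin (n + 1))
    (w : Coord n) : ℝ :=
  (‖w j‖ ^ 2 * ‖partialAt Q (j.succAbove k') w‖ ^ 2) /
    ∑ a : Fin (n + 2), ∑ b : Fin (n + 1), ‖w a‖ ^ 2 * ‖partialAt Q (a.succAbove b) w‖ ^ 2

/-- The integral `∫_{V_reg} φ` over the regular part of `V = {Q = 0} ⊆ ℂℙ^m`, `m = n + 1`, for an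
irreducible homogeneous `Q` and a continuous `(m-1, m-1)`-form `φ`: the integral is split by the
partition of unity `weight`, and each piece is computed in graph coordinates `y ∈ ℂ^{m-1}` by
pulling `φ` back along the local branches `t = t(y)` of `Q = 0`. For each `y` there are finitely
many branches, the simple roots `t` of `Q` on the line over `y`. -/
def hypersurfaceIntegral {n : ℕ} (Q : MvPolynomial (Fin (n + 2)) ℂ) (φ : ContForm n n) : ℂ :=
  ∑ j : Fin (n + 2), ∑ k' : Fin (n + 1),
    ∫ y : Fin n → ℂ,
      ∑ᶠ t ∈ {t : ℂ | MvPolynomial.eval (chartPoint j k' y t) Q = 0 ∧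
          partialAt Q (j.succAbove k') (chartPoint j k' y t) ≠ 0},
        (weight Q j k' (chartPoint j k' y t) : ℂ) *
          φ.toFun (chartPoint j k' y t)
            (realFrame (graphTangent Q j k' (chartPoint j k' y t)))

/-- The pairing `(Z_P, φ)` of the current of integration over the zero divisor of a nonzero
homogeneous polynomial `P` with `φ`: if `P = ∏ Q_i` with `Q_i` irreducible (repeated according to
multiplicity), the zero divisor is `∑ [Q_i = 0]`. -/
def zeroCurrent {n : ℕ} (P : MvPolynomial (Fin (n + 2)) ℂ) (φ : ContForm n n) : ℂ :=
  ((UniqueFactorizationMonoid.factors P).map (fun Q => hypersurfaceIntegral Q φ)).sum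

/-! ### Random polynomials -/

/-- The standard complex Gaussian law, with density `(1/π) exp(-|z|^2)`; it has mean `0` and
`E |z|^2 = 1`. -/
def stdComplexGaussian : Measure ℂ :=
  volume.withDensity (fun z => ENNReal.ofReal (Real.pi⁻¹ * Real.exp (-‖z‖ ^ 2)))

/-- The polynomial `∑_{|J| = N} a_J z^J / √(J!)`. -/
def suPoly {n : ℕ} (N : ℕ) (a : (Fin (n + 2) →₀ ℕ) → ℂ) : MvPolynomial (Fin (n + 2)) ℂ :=
  ∑ J ∈ Finset.finsuppAntidiag Finset.univ N,
    MvPolynomial.monomial J (a J / (Real.sqrt (∏ i, ((J i).factorial : ℝ)) : ℂ))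

end SUPoly

end

noncomputable section

namespace SUPoly

/-! ### Linear algebra of forms -/

/-! Potentials. By the multinomial theorem (`sum_norm_normMonomial_sq`) the value `P_N(w)` is a
centred complex Gaussian of variance `|w|^{2N} / N!`. Hence `logDev`, the difference between `(1/N)
log |P_N(w)|`, corrected by the constant `log N! / (2N)`, and the Fubini-Study potential `(1/2) log
|w|²`, is distributed like `(1/N) log |ξ|` with `ξ` standard Gaussian, so its second moment is a
constant times `N⁻²`. Since `∑ √N / N²` converges, almost surely `∑_N √N ∫_{B_R} logDev²` is finite
for every `R` (`ae_tsum_logDev_ne_top`). The rest is a deterministic passage from potentials to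
zeros.

Slicing. A `(1,1)`-form `α` is determined by its values `α(u, iu)`, and polarization
(`topDensity_eq_sum`) writes the density of `α ∧ φ` as a finite sum over directions `u = polDir r`
of `α(u, iu)` times a coefficient that depends on `φ` alone. For `ω_FS` the value is `fsDensity`;
for `(i/2) dQ ∧ dQ̄` it is `|dQ(u)|²`. After multiplication by the radial cutoff `eta`, everything
takes place in `ℂ^{n+2}`: the limit becomes `∑_r ∫ formCoeff · fsDensity` (`fsPairing_eq`), and the
pairing with the divisor becomes `∑_r nu P (polDir r) (formCoeff φ r)` (`zeroCurrent_eq`), where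
`nu` averages sums over the zeros on lines parallel to `u`. To obtain the second identity, slicing
integrals in different directions are compared through the tube averages `(π ε²)⁻¹ ∫_{|Q| < ε} G
|dQ(u)|²`, whose limit is `nu` (`tendsto_tubeAvg`). In coordinate directions, polar coordinates on
the cone turn `nu` into the chart integrals that define `hypersurfaceIntegral` (`nu_chart`).
Additivity of root sums under products accounts for several components and for multiplicities.

One variable. It remains to show `(1/N) nu P_N u f → ∫ f fsDensity(·, u)` for fixed `u`
(`tendsto_nu`), which is a statement on the roots of `p(t) = P_N(w + t u)`, of degree at most `N`.
By Jensen's formula the difference of the circle averages of `log |p|` of radii `2r` and `r` about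
`c` is the sum over the roots `a` of a bounded, compactly supported kernel at `c - a`
(`averageDiff_log_norm`). For `(1/2) log |w + t u|²` the same difference is `(3π/2) r² fsDensity +
O(r³)` (`averageDiff_halfLog`), and `(3π/2) r²` is also the mass of the kernel. Convergence of
circle averages for almost every centre thus gives convergence of the root distribution smoothed at
scale `r`, and `r` is finally taken small (`tendsto_rootSum`).

Slicing needs the zeros on almost every line to be simple; this holds almost surely by
`ae_simpleAlong`. All exceptional events involve only finitely many directions and integers `N`,
`R`, so one null set serves all `φ`. -/

/-- The wedge product of alternating maps, without continuity. -/
def awedge {n p : ℕ} (α : Coord n [⋀^Fin 2]→ₗ[ℝ] ℂ) (β : Coord n [⋀^(Fin p × Fin 2)]→ₗ[ℝ] ℂ) :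
    Coord n [⋀^(Fin 2 ⊕ Fin p × Fin 2)]→ₗ[ℝ] ℂ :=
  (LinearMap.mul' ℝ ℂ).compAlternatingMap (α.domCoprod β)

lemma mul'_summand {n p : ℕ} (α : Coord n [⋀^Fin 2]→ₗ[ℝ] ℂ)
    (β : Coord n [⋀^(Fin p × Fin 2)]→ₗ[ℝ] ℂ) (s : Equiv.Perm (Fin 2 ⊕ Fin p × Fin 2))
    (v : Fin 2 ⊕ Fin p × Fin 2 → Coord n) :
    LinearMap.mul' ℝ ℂ (AlternatingMap.domCoprod.summand α β (Quotient.mk'' s) v) =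
      ((Equiv.Perm.sign s : ℤ) : ℂ) *
        (α (fun i => v (s (Sum.inl i))) * β (fun i => v (s (Sum.inr i)))) := by
  rw [AlternatingMap.domCoprod.summand_mk'']
  rcases Int.units_eq_one_or (Equiv.Perm.sign s) with h | h <;> simp [h]

lemma awedge_apply {n p : ℕ} (α : Coord n [⋀^Fin 2]→ₗ[ℝ] ℂ)
    (β : Coord n [⋀^(Fin p × Fin 2)]→ₗ[ℝ] ℂ) (v : Fin 2 ⊕ Fin p × Fin 2 → Coord n) :
    awedge α β v = ∑ σ : Equiv.Perm.ModSumCongr (Fin 2) (Fin p × Fin 2),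
      LinearMap.mul' ℝ ℂ (AlternatingMap.domCoprod.summand α β σ v) := by
  simp [awedge, AlternatingMap.domCoprod_apply, map_sum]

/-- With one representative fixed in each shuffle class, the wedge is a finite sum of products of
values, so linearity, vanishing and continuity can be checked term by term. -/
lemma awedge_eq_sum_out {n p : ℕ} (α : Coord n [⋀^Fin 2]→ₗ[ℝ] ℂ)
    (β : Coord n [⋀^(Fin p × Fin 2)]→ₗ[ℝ] ℂ) (v : Fin 2 ⊕ Fin p × Fin 2 → Coord n) :
    awedge α β v = ∑ σ : Equiv.Perm.ModSumCongr (Fin 2) (Fin p × Fin 2),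
      ((Equiv.Perm.sign σ.out : ℤ) : ℂ) *
        (α (fun i => v (σ.out (Sum.inl i))) * β (fun i => v (σ.out (Sum.inr i)))) := by
  rw [awedge_apply]
  refine Finset.sum_congr rfl fun σ _ => ?_
  rw [← mul'_summand]
  congr 3
  exact (Quotient.out_eq' σ).symm

lemma awedge_sum_smul_left {n p : ℕ} {ι : Type*} (s : Finset ι) (c : ι → ℂ)
    (α₀ : Coord n [⋀^Fin 2]→ₗ[ℝ] ℂ) (α : ι → Coord n [⋀^Fin 2]→ₗ[ℝ] ℂ)
    (h : ∀ x, α₀ x = ∑ i ∈ s, c i * α i x)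
    (β : Coord n [⋀^(Fin p × Fin 2)]→ₗ[ℝ] ℂ) (v : Fin 2 ⊕ Fin p × Fin 2 → Coord n) :
    awedge α₀ β v = ∑ i ∈ s, c i * awedge (α i) β v := by
  simp only [awedge_eq_sum_out, h, Finset.sum_mul, Finset.mul_sum]
  rw [Finset.sum_comm]
  exact Finset.sum_congr rfl fun i _ => Finset.sum_congr rfl fun σ _ => by ring

lemma awedge_smul_right {n p : ℕ} (c : ℂ) (α : Coord n [⋀^Fin 2]→ₗ[ℝ] ℂ)
    (β₀ β : Coord n [⋀^(Fin p × Fin 2)]→ₗ[ℝ] ℂ) (h : ∀ x, β₀ x = c * β x)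
    (v : Fin 2 ⊕ Fin p × Fin 2 → Coord n) :
    awedge α β₀ v = c * awedge α β v := by
  simp only [awedge_eq_sum_out, h, Finset.mul_sum]
  exact Finset.sum_congr rfl fun σ _ => by ring

lemma awedge_eq_zero_of_mem {n p : ℕ} (α : Coord n [⋀^Fin 2]→ₗ[ℝ] ℂ)
    (β : Coord n [⋀^(Fin p × Fin 2)]→ₗ[ℝ] ℂ) (z : Coord n)
    (hα : ∀ x, (∃ q, x q = z) → α x = 0) (hβ : ∀ x, (∃ q, x q = z) → β x = 0)
    (v : Fin 2 ⊕ Fin p × Fin 2 → Coord n) (hv : ∃ q, v q = z) : awedge α β v = 0 := by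
  rw [awedge_eq_sum_out]
  refine Finset.sum_eq_zero fun σ _ => ?_
  obtain ⟨q, hq⟩ := hv
  obtain ⟨q', rfl⟩ := σ.out.surjective q
  rcases q' with b | b
  · rw [hα _ ⟨b, hq⟩]; simp
  · rw [hβ _ ⟨b, hq⟩]; simp

/-- If `α` kills the last vectors, only the trivial shuffle contributes. -/
lemma awedge_eq_mul {n p : ℕ} (α : Coord n [⋀^Fin 2]→ₗ[ℝ] ℂ)
    (β : Coord n [⋀^(Fin p × Fin 2)]→ₗ[ℝ] ℂ) (v : Fin 2 ⊕ Fin p × Fin 2 → Coord n)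
    (hα : ∀ x, (∃ q r, x q = v (Sum.inr r)) → α x = 0) :
    awedge α β v = α (fun i => v (Sum.inl i)) * β (fun i => v (Sum.inr i)) := by
  rw [awedge_apply]
  refine (Finset.sum_eq_single
    (Quotient.mk'' 1 : Equiv.Perm.ModSumCongr (Fin 2) (Fin p × Fin 2)) ?_ ?_).trans ?_
  · intro σ _ hσ
    induction σ using Quotient.inductionOn' with | _ s
    rw [mul'_summand]
    by_cases hs : ∃ b r, s (Sum.inl b) = Sum.inr r
    · obtain ⟨b, r, hbr⟩ := hs
      rw [hα _ ⟨b, r, by rw [hbr]⟩]; simp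
    -- If no `inl` index is sent to an `inr` index, then `s` preserves the two summands and lies in
    -- the trivial class.
    · exfalso
      apply hσ
      push Not at hs
      have hmap : Set.MapsTo s (Set.range Sum.inl) (Set.range Sum.inl) := by
        rintro _ ⟨b, rfl⟩
        rcases h : s (Sum.inl b) with c | c
        · exact ⟨c, rfl⟩
        · exact absurd h (hs b c)
      have := Equiv.Perm.mem_sumCongrHom_range_of_perm_mapsTo_inl hmap
      refine Quotient.sound' ?_
      rw [QuotientGroup.leftRel_apply]
      simpa using this
  · simp
  · rw [mul'_summand]; simp

/-- Adding to some arguments of an alternating map combinations of the other arguments and of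
vectors in its kernel does not change the value. -/
lemma AlternatingMap_map_add_of_mem_span {R M N ι : Type*} [CommRing R] [AddCommGroup M]
    [Module R M] [AddCommGroup N] [Module R N] [Fintype ι] [DecidableEq ι]
    (f : M [⋀^ι]→ₗ[R] N) (S : Set ι) (Z : Set M) (hZ : ∀ z ∈ Z, ∀ x, (∃ q, x q = z) → f x = 0)
    (v v' : ι → M) (hS : ∀ q ∈ S, v' q = v q)
    (hd : ∀ q ∉ S, v' q - v q ∈ Submodule.span R (v '' S ∪ Z)) : f v' = f v := by
  classical
  -- The arguments are exchanged one at a time. Those with index in `S` never change, so a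
  -- correction in the span of `v '' S` repeats an argument that is present.
  have key : ∀ T : Finset ι, f (fun q => if q ∈ T then v' q else v q) = f v := by
    intro T
    induction T using Finset.induction_on with
    | empty => simp
    | insert q T hq ih =>
      rw [← ih]
      have h1 : (fun r => if r ∈ insert q T then v' r else v r) =
          Function.update (fun r => if r ∈ T then v' r else v r) q (v q + (v' q - v q)) := by
        ext1 r
        by_cases hr : r = q
        · subst hr; simp
        · simp [hr]
      have h2 : (fun r => if r ∈ T then v' r else v r) =
          Function.update (fun r => if r ∈ T then v' r else v r) q (v q) := by
        ext1 r
        by_cases hr : r = q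
        · subst hr; simp [hq]
        · simp [hr]
      rw [h1, AlternatingMap.map_update_add, ← h2, add_eq_left]
      by_cases hqS : q ∈ S
      · rw [hS q hqS, sub_self, AlternatingMap.map_update_zero]
      · have := hd q hqS
        generalize v' q - v q = d at this
        induction this using Submodule.span_induction with
        | mem x hx =>
          rcases hx with ⟨r, hr, rfl⟩ | hx
          · have hrq : r ≠ q := fun h => hqS (h ▸ hr)
            refine f.map_eq_zero_of_eq _ (i := q) (j := r) ?_ hrq.symm
            by_cases hrT : r ∈ T <;> simp [hrq, hrT, hS r hr]
          · exact hZ x hx _ ⟨q, by simp⟩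
        | zero => exact AlternatingMap.map_update_zero _ _ _
        | add x y _ _ hx hy => rw [AlternatingMap.map_update_add, hx, hy, add_zero]
        | smul a x _ hx => rw [AlternatingMap.map_update_smul, hx, smul_zero]
  simpa using key Finset.univ

/-- The frame `(v₀, i v₀; v 0, i v 0, …)`. -/
def pairFrame {n : ℕ} (v₀ : Coord n) (v : Fin n → Coord n) : Fin 2 ⊕ Fin n × Fin 2 → Coord n :=
  Sum.elim (fun b : Fin 2 => realFrame (fun _ : Fin 1 => v₀) (0, b)) (realFrame v)

/-- The coordinate frame of the chart `w_j = 1`, beginning with the index `j.succAbove k`. -/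
def chartFrame {n : ℕ} (j : Fin (n + 2)) (k : Fin (n + 1)) : Fin 2 ⊕ Fin n × Fin 2 → Coord n :=
  pairFrame (Pi.single (j.succAbove k) 1) (fun i => Pi.single (j.succAbove (k.succAbove i)) 1)

lemma realFrame_mem_span {n p : ℕ} (v : Fin p → Coord n) (i : Fin p) (c : ℂ) :
    c • v i ∈ Submodule.span ℝ (Set.range (realFrame v)) := by
  have h : c • v i = c.re • realFrame v (i, 0) + c.im • realFrame v (i, 1) := by
    ext a
    simp only [realFrame, Pi.smul_apply, Pi.add_apply, smul_eq_mul, Complex.real_smul]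
    simp only [if_true, one_ne_zero, if_false, Pi.smul_apply, smul_eq_mul]
    linear_combination (-(v i a)) * Complex.re_add_im c
  rw [h]
  exact Submodule.add_mem _ (Submodule.smul_mem _ _ (Submodule.subset_span ⟨_, rfl⟩))
    (Submodule.smul_mem _ _ (Submodule.subset_span ⟨_, rfl⟩))

/-- Multiplication by `c` on the complex line of `v₀` has real determinant `|c|²`. -/
lemma map_pairFrame_smul {n : ℕ} (f : Coord n [⋀^(Fin 2 ⊕ Fin n × Fin 2)]→ₗ[ℝ] ℂ) (c : ℂ)
    (v₀ : Coord n) (v : Fin n → Coord n) :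
    f (pairFrame (c • v₀) v) = ‖c‖ ^ 2 * f (pairFrame v₀ v) := by
  set P := pairFrame v₀ v with hP
  have hne : (Sum.inl 0 : Fin 2 ⊕ Fin n × Fin 2) ≠ Sum.inl 1 := by simp
  have h1 : pairFrame (c • v₀) v = Function.update (Function.update P (Sum.inl 0)
      (c.re • P (Sum.inl 0) + c.im • P (Sum.inl 1))) (Sum.inl 1)
      (c.re • P (Sum.inl 1) + (-c.im) • P (Sum.inl 0)) := by
    ext q a
    rcases q with b | q
    · fin_cases b
      · simp only [pairFrame, realFrame, hP]
        simp [Function.update]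
        conv_lhs => rw [← Complex.re_add_im c]
        ring
      · simp only [pairFrame, realFrame, hP]
        simp [Function.update]
        conv_lhs => rw [← Complex.re_add_im c]
        linear_combination (c.im : ℂ) * v₀ a * Complex.I_sq
    · simp [pairFrame, hP, Function.update]
  have e1 : Function.update (Function.update P (Sum.inl 0) (P (Sum.inl 0))) (Sum.inl 1)
      (P (Sum.inl 1)) = P := by simp
  have e2 : f (Function.update (Function.update P (Sum.inl 0) (P (Sum.inl 0))) (Sum.inl 1)
      (P (Sum.inl 0))) = 0 :=
    f.map_eq_zero_of_eq _ (i := Sum.inl 0) (j := Sum.inl 1) (by simp [hne]) hne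
  have e3 : f (Function.update (Function.update P (Sum.inl 0) (P (Sum.inl 1))) (Sum.inl 1)
      (P (Sum.inl 1))) = 0 :=
    f.map_eq_zero_of_eq _ (i := Sum.inl 0) (j := Sum.inl 1) (by simp [hne]) hne
  have e4 : f (Function.update (Function.update P (Sum.inl 0) (P (Sum.inl 1))) (Sum.inl 1)
      (P (Sum.inl 0))) = - f P := by
    rw [← f.map_swap P hne]
    congr 1
    ext1 q
    by_cases h1 : q = Sum.inl 1
    · subst h1; simp
    · by_cases h0 : q = Sum.inl 0
      · subst h0; simp [hne]
      · simp [h0, h1, Equiv.swap_apply_of_ne_of_ne]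
  rw [h1, AlternatingMap.map_update_add, AlternatingMap.map_update_smul,
    AlternatingMap.map_update_smul, Function.update_comm hne, Function.update_comm hne,
    AlternatingMap.map_update_add, AlternatingMap.map_update_add,
    AlternatingMap.map_update_smul, AlternatingMap.map_update_smul,
    AlternatingMap.map_update_smul, AlternatingMap.map_update_smul,
    Function.update_comm hne.symm, Function.update_comm hne.symm,
    Function.update_comm hne.symm, Function.update_comm hne.symm, e1, e2, e3, e4,
    ← Complex.ofReal_pow, ← Complex.normSq_eq_norm_sq, Complex.normSq_apply]
  simp only [Complex.real_smul]
  push_cast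
  ring

/-- Permuting complex vectors permutes the pairs `(v, i v)` as blocks of two, so the sign appears
squared. Top-degree forms therefore do not see the order of complex coordinates. -/
lemma sign_prodCongr_refl_two {n : ℕ} (σ : Equiv.Perm (Fin n)) :
    Equiv.Perm.sign (Equiv.prodCongr σ (Equiv.refl (Fin 2))) = 1 := by
  have h : Equiv.prodCongr σ (Equiv.refl (Fin 2)) = Equiv.prodCongrLeft (fun _ : Fin 2 => σ) := by
    ext ⟨a, b⟩ <;> simp
  rw [h, Equiv.Perm.sign_prodCongrLeft]
  simp

/-- The reindexing of `Fin 2 ⊕ Fin n × Fin 2` by `Fin (n + 1) × Fin 2`. -/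
def pairEquiv (n : ℕ) : Fin 2 ⊕ Fin n × Fin 2 ≃ Fin (n + 1) × Fin 2 where
  toFun := Sum.elim (fun b => (0, b)) (fun q => (q.1.succ, q.2))
  invFun q := Fin.cases (motive := fun _ => Fin 2 ⊕ Fin n × Fin 2) (Sum.inl q.2)
    (fun i => Sum.inr (i, q.2)) q.1
  left_inv q := by rcases q with b | ⟨i, b⟩ <;> simp
  right_inv q := by
    obtain ⟨i, b⟩ := q
    refine Fin.cases ?_ (fun i => ?_) i <;> simp

lemma pairFrame_eq {n : ℕ} (v : Fin (n + 1) → Coord n) :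
    pairFrame (v 0) (fun i => v i.succ) = realFrame v ∘ pairEquiv n := by
  ext q
  rcases q with b | ⟨i, b⟩ <;> rfl

lemma map_pairFrame_perm {n : ℕ} (f : Coord n [⋀^(Fin 2 ⊕ Fin n × Fin 2)]→ₗ[ℝ] ℂ)
    (v : Fin (n + 1) → Coord n) (σ : Equiv.Perm (Fin (n + 1))) :
    f (pairFrame (v (σ 0)) (fun i => v (σ i.succ))) = f (pairFrame (v 0) (fun i => v i.succ)) := by
  rw [pairFrame_eq v, pairFrame_eq (fun i => v (σ i))]
  set g := f.domDomCongr (pairEquiv n)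
  have h1 : ∀ x, f (x ∘ pairEquiv n) = g x := fun x => rfl
  rw [h1, h1]
  have h2 : realFrame (fun i => v (σ i)) =
      realFrame v ∘ (Equiv.prodCongr σ (Equiv.refl (Fin 2))) := by
    ext ⟨i, b⟩; simp [realFrame]
  rw [h2, AlternatingMap.map_perm, sign_prodCongr_refl_two, one_smul]

lemma map_chartFrame_eq {n : ℕ} (f : Coord n [⋀^(Fin 2 ⊕ Fin n × Fin 2)]→ₗ[ℝ] ℂ)
    (j : Fin (n + 2)) (k : Fin (n + 1)) : f (chartFrame j k) = f (chartFrame j 0) := by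
  have hinj : Function.Injective (Fin.cons k k.succAbove : Fin (n + 1) → Fin (n + 1)) := by
    rw [Fin.cons_injective_iff]
    exact ⟨fun ⟨i, hi⟩ => Fin.succAbove_ne k i hi, Fin.succAbove_right_injective⟩
  let σ : Equiv.Perm (Fin (n + 1)) := Equiv.ofBijective _ (Finite.injective_iff_bijective.mp hinj)
  have := map_pairFrame_perm f (fun i => (Pi.single (j.succAbove i) 1 : Coord n)) σ
  simpa [σ, chartFrame] using this

/-- Both sides enumerate the indices other than `i` and `j` in increasing order, and a strictly
monotone enumeration is determined by its range. -/
lemma pair_succAbove_comm {n : ℕ} (i j : Fin (n + 2)) (hij : i ≠ j) :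
    ∃ k l : Fin (n + 1), j.succAbove k = i ∧ i.succAbove l = j ∧
      ∀ m : Fin n, j.succAbove (k.succAbove m) = i.succAbove (l.succAbove m) := by
  obtain ⟨k, hk⟩ := Fin.exists_succAbove_eq hij
  obtain ⟨l, hl⟩ := Fin.exists_succAbove_eq hij.symm
  refine ⟨k, l, hk, hl, fun m => ?_⟩
  have h1 : StrictMono (fun m => j.succAbove (k.succAbove m)) :=
    (Fin.strictMono_succAbove j).comp (Fin.strictMono_succAbove k)
  have h2 : StrictMono (fun m => i.succAbove (l.succAbove m)) :=
    (Fin.strictMono_succAbove i).comp (Fin.strictMono_succAbove l)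
  have hr : ∀ (i j : Fin (n + 2)) (k : Fin (n + 1)), j.succAbove k = i →
      Set.range (fun m => j.succAbove (k.succAbove m)) = {a | a ≠ i ∧ a ≠ j} := by
    rintro i j k rfl
    ext a
    constructor
    · rintro ⟨m, rfl⟩
      exact ⟨fun h => Fin.succAbove_ne k m (Fin.succAbove_right_injective h),
        Fin.succAbove_ne _ _⟩
    · rintro ⟨h1, h2⟩
      obtain ⟨b, rfl⟩ := Fin.exists_succAbove_eq h2
      obtain ⟨c, rfl⟩ := Fin.exists_succAbove_eq (x := b) (y := k) (fun h => h1 (by rw [h]))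
      exact ⟨c, rfl⟩
  have : (fun m => j.succAbove (k.succAbove m)) = (fun m => i.succAbove (l.succAbove m)) := by
    refine (StrictMono.range_inj h1 h2).mp ?_
    rw [hr i j k hk, hr j i l hl]
    ext a; simp [and_comm]
  exact congrFun this m

/-- Two charts see a horizontal top-degree form up to the factor `|w_i|² / |w_j|²`. -/
lemma map_chartFrame_comm {n : ℕ} (f : Coord n [⋀^(Fin 2 ⊕ Fin n × Fin 2)]→ₗ[ℝ] ℂ)
    (w : Coord n) (hf : ∀ c : ℂ, ∀ x, (∃ q, x q = c • w) → f x = 0) (i j : Fin (n + 2)) :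
    ‖w i‖ ^ 2 * f (chartFrame j 0) = ‖w j‖ ^ 2 * f (chartFrame i 0) := by
  rcases eq_or_ne i j with rfl | hij
  · rfl
  obtain ⟨k, l, hk, hl, hm⟩ := pair_succAbove_comm i j hij
  rw [← map_chartFrame_eq f j k, ← map_chartFrame_eq f i l, chartFrame, chartFrame]
  simp only [hk, hl, ← hm]
  set v : Fin n → Coord n := fun m => Pi.single (j.succAbove (k.succAbove m)) 1 with hv
  rw [← map_pairFrame_smul, ← map_pairFrame_smul]
  -- Modulo the remaining coordinate vectors and `w`, which `f` kills, `w_j e_j` equals `-w_i e_i`.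
  -- The sign is harmless because only `|w_i|²` enters.
  have h0 : f (pairFrame (w i • Pi.single i 1) v) = f (pairFrame ((-w i) • Pi.single i 1) v) := by
    rw [map_pairFrame_smul, map_pairFrame_smul, norm_neg]
  rw [h0, eq_comm]
  have hw : w = w i • Pi.single i 1 + w j • Pi.single j 1 + ∑ m, w (j.succAbove (k.succAbove m)) •
      v m := by
    have h1 : w = ∑ a, w a • (Pi.single a 1 : Coord n) := by
      ext a; simp [Finset.sum_apply, Pi.single_apply]
    rw [Fin.sum_univ_succAbove _ j, Fin.sum_univ_succAbove _ k, hk] at h1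
    rw [← add_assoc, add_comm (w j • (Pi.single j 1 : Coord n))] at h1
    exact h1
  have hd : w j • Pi.single j 1 - (-w i) • Pi.single i 1 =
      w - ∑ m, w (j.succAbove (k.succAbove m)) • v m := by
    nth_rewrite 3 [hw]
    rw [neg_smul]
    abel
  refine AlternatingMap_map_add_of_mem_span f (Set.range Sum.inr) {z | ∃ c : ℂ, z = c • w}
    (fun z ⟨c, hc⟩ x ⟨q, hq⟩ => hf c x ⟨q, hq.trans hc⟩) _ _ ?_ ?_
  · rintro _ ⟨q, rfl⟩
    simp [pairFrame]
  · intro q hq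
    rcases q with b | q
    swap
    · exact absurd ⟨q, rfl⟩ hq
    have hmem : ∀ c : ℂ, c • (w j • Pi.single j 1 - (-w i) • Pi.single i 1 : Coord n) ∈
        Submodule.span ℝ (pairFrame ((-w i) • Pi.single i 1) v '' Set.range Sum.inr ∪
          {z | ∃ c : ℂ, z = c • w}) := by
      intro c
      rw [hd, smul_sub, Finset.smul_sum]
      refine Submodule.sub_mem _ (Submodule.subset_span (Or.inr ⟨c, rfl⟩))
        (Submodule.sum_mem _ fun m _ => ?_)
      rw [smul_smul]
      refine Submodule.span_mono ?_ (realFrame_mem_span v m _)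
      rintro _ ⟨q, rfl⟩
      exact Or.inl ⟨Sum.inr q, ⟨q, rfl⟩, rfl⟩
    fin_cases b
    · simpa [pairFrame, realFrame] using hmem 1
    · have := hmem Complex.I
      rw [smul_sub] at this
      exact this

/-! ### The common density of a horizontal top-degree form in all charts -/

/-- `|w|² = ∑ |w_j|²`. -/
def nsq {n : ℕ} (w : Coord n) : ℝ := ∑ j, ‖w j‖ ^ 2

lemma nsq_pos {n : ℕ} {w : Coord n} (hw : w ≠ 0) : 0 < nsq w := by
  obtain ⟨i, hi⟩ := Function.ne_iff.mp hw
  exact Finset.sum_pos' (fun _ _ => by positivity) ⟨i, Finset.mem_univ _, by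
    have : w i ≠ 0 := hi
    positivity⟩

lemma continuous_nsq {n : ℕ} : Continuous (nsq (n := n)) := by unfold nsq; fun_prop

lemma nsq_smul {n : ℕ} (c : ℂ) (w : Coord n) : nsq (c • w) = ‖c‖ ^ 2 * nsq w := by
  simp [nsq, Finset.mul_sum, mul_pow]

/-- The density of `α ∧ β` relative to the cone over a chart. -/
def topDensity {n : ℕ} (α : Coord n [⋀^Fin 2]→ₗ[ℝ] ℂ) (β : Coord n [⋀^(Fin n × Fin 2)]→ₗ[ℝ] ℂ)
    (w : Coord n) : ℂ :=
  (∑ j, awedge α β (chartFrame j 0)) / (nsq w : ℂ)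

/-- By `map_chartFrame_comm` the quotient of the value in the chart `j` by `|w_j|²` is independent
of `j`. Summing over `j` and dividing by `|w|²` gives this quotient without dividing by a coordinate
that may vanish. -/
lemma awedge_chartFrame {n : ℕ} (α : Coord n [⋀^Fin 2]→ₗ[ℝ] ℂ)
    (β : Coord n [⋀^(Fin n × Fin 2)]→ₗ[ℝ] ℂ) (w : Coord n) (hw : w ≠ 0)
    (hα : ∀ c : ℂ, ∀ x, (∃ q, x q = c • w) → α x = 0)
    (hβ : ∀ c : ℂ, ∀ x, (∃ q, x q = c • w) → β x = 0) (j : Fin (n + 2)) (k : Fin (n + 1)) :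
    awedge α β (chartFrame j k) = ‖w j‖ ^ 2 * topDensity α β w := by
  have h0 : (nsq w : ℂ) ≠ 0 := by exact_mod_cast (nsq_pos hw).ne'
  rw [map_chartFrame_eq, topDensity, mul_div_assoc', eq_div_iff h0, Finset.mul_sum]
  simp_rw [map_chartFrame_comm (awedge α β) w
    (fun c x hx => awedge_eq_zero_of_mem α β (c • w) (hα c) (hβ c) x hx) j]
  rw [← Finset.sum_mul, mul_comm, nsq]
  push_cast
  rfl

/-- The wedge product of two real linear forms. -/
def wedgeForm {n : ℕ} (f g : Coord n →ₗ[ℝ] ℝ) : Coord n [⋀^Fin 2]→ₗ[ℝ] ℂ :=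
  Complex.ofRealCLM.toLinearMap.compAlternatingMap
    ((Matrix.detRowAlternating (R := ℝ) (n := Fin 2)).compLinearMap (LinearMap.pi ![f, g]))

lemma wedgeForm_apply {n : ℕ} (f g : Coord n →ₗ[ℝ] ℝ) (x : Fin 2 → Coord n) :
    wedgeForm f g x = ((f (x 0) * g (x 1) - f (x 1) * g (x 0) : ℝ) : ℂ) := by
  have h : wedgeForm f g x =
      ((Matrix.det (Matrix.of fun i b : Fin 2 => (![f, g] b) (x i)) : ℝ) : ℂ) := rfl
  rw [h, Matrix.det_fin_two]
  simp only [Matrix.of_apply, Matrix.cons_val_zero, Matrix.cons_val_one]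
  congr 1
  ring

/-- The form `(i/2) ξ ∧ ξ̄` of a complex linear form `ξ`. -/
def rankOneForm {n : ℕ} (ξ : Coord n →ₗ[ℂ] ℂ) : Coord n [⋀^Fin 2]→ₗ[ℝ] ℂ :=
  wedgeForm (Complex.reLm ∘ₗ ξ.restrictScalars ℝ) (Complex.imLm ∘ₗ ξ.restrictScalars ℝ)

lemma rankOneForm_apply {n : ℕ} (ξ : Coord n →ₗ[ℂ] ℂ) (x : Fin 2 → Coord n) :
    rankOneForm ξ x = (((ξ (x 0)).re * (ξ (x 1)).im - (ξ (x 1)).re * (ξ (x 0)).im : ℝ) : ℂ) :=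
  wedgeForm_apply _ _ x

lemma rankOneForm_eq_zero {n : ℕ} (ξ : Coord n →ₗ[ℂ] ℂ) (x : Fin 2 → Coord n)
    (hx : ∃ q, ξ (x q) = 0) : rankOneForm ξ x = 0 := by
  rw [rankOneForm_apply]
  obtain ⟨q, hq⟩ := hx
  fin_cases q
  · simp only [Fin.zero_eta] at hq; simp [hq]
  · simp only [Fin.mk_one] at hq; simp [hq]

/-- The pullback of `β` to the graph of a hyperplane is computed by the wedge product with
the corresponding rank one form. -/
lemma awedge_rankOneForm_chartFrame {n : ℕ} (ξ : Coord n →ₗ[ℂ] ℂ)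
    (β : Coord n [⋀^(Fin n × Fin 2)]→ₗ[ℝ] ℂ) (j : Fin (n + 2)) (k : Fin (n + 1))
    (hk : ξ (Pi.single (j.succAbove k) 1) ≠ 0) :
    awedge (rankOneForm ξ) β (chartFrame j k) =
      ‖ξ (Pi.single (j.succAbove k) 1)‖ ^ 2 * β (realFrame fun i =>
        (Pi.single (j.succAbove (k.succAbove i)) 1 : Coord n) -
          (ξ (Pi.single (j.succAbove (k.succAbove i)) 1) / ξ (Pi.single (j.succAbove k) 1)) •
            (Pi.single (j.succAbove k) 1 : Coord n)) := by
  set e : Coord n := Pi.single (j.succAbove k) 1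
  set v : Fin n → Coord n := fun i => Pi.single (j.succAbove (k.succAbove i)) 1
  set v' : Fin n → Coord n := fun i => v i - (ξ (v i) / ξ e) • e
  have hv' : ∀ i, ξ (v' i) = 0 := fun i => by simp [v', hk]
  -- Subtracting multiples of `e` moves the other frame vectors into the kernel of `ξ` without
  -- changing the top-degree value. After that only the trivial shuffle contributes.
  have h1 : awedge (rankOneForm ξ) β (chartFrame j k) =
      awedge (rankOneForm ξ) β (pairFrame e v') := by
    refine (AlternatingMap_map_add_of_mem_span _ (Set.range Sum.inl) ∅ (by simp) _ _ ?_ ?_).symm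
    · rintro _ ⟨b, rfl⟩
      rfl
    · rintro (b | ⟨i, b⟩) hq
      · exact absurd ⟨b, rfl⟩ hq
      have hmem : ∀ c : ℂ, c • e ∈ Submodule.span ℝ
          (chartFrame j k '' Set.range Sum.inl ∪ ∅) := by
        intro c
        refine Submodule.span_mono ?_ (realFrame_mem_span (fun _ : Fin 1 => e) 0 c)
        rintro _ ⟨⟨i, b⟩, rfl⟩
        fin_cases i
        exact Or.inl ⟨Sum.inl b, ⟨b, rfl⟩, rfl⟩
      fin_cases b
      · have := hmem (-(ξ (v i) / ξ e))
        convert this using 1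
        change v' i - v i = _
        simp [v']
      · have := hmem (Complex.I * -(ξ (v i) / ξ e))
        convert this using 1
        change Complex.I • v' i - Complex.I • v i = _
        rw [mul_smul]
        simp [v', smul_sub]
  rw [h1, awedge_eq_mul]
  · have h2 : rankOneForm ξ (fun i => pairFrame e v' (Sum.inl i)) = ‖ξ e‖ ^ 2 := by
      rw [rankOneForm_apply]
      change (((ξ e).re * (ξ (Complex.I • e)).im - (ξ (Complex.I • e)).re * (ξ e).im : ℝ) : ℂ) = _
      rw [← Complex.ofReal_pow, ← Complex.normSq_eq_norm_sq, Complex.normSq_apply]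
      simp
    rw [h2]
    rfl
  · rintro x ⟨q, ⟨i, b⟩, hx⟩
    refine rankOneForm_eq_zero ξ x ⟨q, ?_⟩
    rw [hx]
    fin_cases b
    · exact hv' i
    · change ξ (Complex.I • v' i) = 0
      rw [map_smul, hv', smul_zero]

/-! ### Expansion in rank-one directions -/

/-- The real basis `e_a, i e_a` of `ℂ^{n+2}`. -/
def realBasis (n : ℕ) : Fin (n + 2) × Fin 2 → Coord n :=
  realFrame (fun a => (Pi.single a 1 : Coord n))

/-- The real coordinates of a vector. -/
def realCoord {n : ℕ} (p : Fin (n + 2) × Fin 2) : Coord n →ₗ[ℝ] ℝ :=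
  (if p.2 = 0 then Complex.reLm else Complex.imLm) ∘ₗ (LinearMap.proj p.1 : Coord n →ₗ[ℝ] ℂ)

lemma sum_realCoord_smul {n : ℕ} (x : Coord n) : ∑ p, realCoord p x • realBasis n p = x := by
  rw [Fintype.sum_prod_type]
  ext a
  simp only [Fin.sum_univ_two, Finset.sum_apply, Pi.add_apply, Pi.smul_apply, realCoord, realBasis,
    realFrame]
  rw [Finset.sum_eq_single a]
  · simp
  · intro b _ hb
    simp [hb.symm]
  · simp

lemma alternating_two_expand {n : ℕ} (α : Coord n [⋀^Fin 2]→ₗ[ℝ] ℂ) (x : Fin 2 → Coord n) :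
    α x = ∑ p, ∑ q, (realCoord p (x 0) * realCoord q (x 1) : ℂ) *
      α ![realBasis n p, realBasis n q] := by
  have h1 : α x = α (fun i => ∑ p, realCoord p (x i) • realBasis n p) := by
    simp_rw [sum_realCoord_smul]
  have h2 := MultilinearMap.map_sum α.toMultilinearMap
    (fun (i : Fin 2) (p : Fin (n + 2) × Fin 2) => realCoord p (x i) • realBasis n p)
  rw [h1]
  refine h2.trans ?_
  rw [← Fintype.sum_prod_type', ← (finTwoArrowEquiv (Fin (n + 2) × Fin 2)).sum_comp]
  refine Finset.sum_congr rfl fun r _ => ?_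
  rw [MultilinearMap.map_smul_univ α.toMultilinearMap (fun i => realCoord (r i) (x i))
    (fun i => realBasis n (r i))]
  simp only [Fin.prod_univ_two, finTwoArrowEquiv_apply, Complex.real_smul]
  push_cast
  congr 1
  congr 1
  ext i : 1
  fin_cases i <;> rfl

lemma alternating_two_eq_sum_wedgeForm {n : ℕ} (α : Coord n [⋀^Fin 2]→ₗ[ℝ] ℂ)
    (x : Fin 2 → Coord n) :
    α x = ∑ r : (Fin (n + 2) × Fin 2) × (Fin (n + 2) × Fin 2),
      (1 / 2 * α ![realBasis n r.1, realBasis n r.2]) *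
        wedgeForm (realCoord r.1) (realCoord r.2) x := by
  have h1 : α x = 1 / 2 * (α x - α ![x 1, x 0]) := by
    have : α ![x 1, x 0] = - α x := by
      rw [← α.map_swap x (zero_ne_one)]
      congr 1
      ext i : 1
      fin_cases i <;> simp
    rw [this]; ring
  rw [h1, alternating_two_expand α x, alternating_two_expand α ![x 1, x 0],
    ← Finset.sum_sub_distrib, Finset.mul_sum]
  refine Eq.trans ?_ (Fintype.sum_prod_type _).symm
  refine Finset.sum_congr rfl fun p _ => ?_
  rw [← Finset.sum_sub_distrib, Finset.mul_sum]
  refine Finset.sum_congr rfl fun q _ => ?_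
  rw [wedgeForm_apply]
  simp only [Matrix.cons_val_zero, Matrix.cons_val_one]
  push_cast
  ring

/-- Indices of the polarization formula. -/
abbrev PolIdx (n : ℕ) : Type := ((Fin (n + 2) × Fin 2) × (Fin (n + 2) × Fin 2)) × Fin 3

/-- The directions of the polarization formula. -/
def polDir {n : ℕ} (r : PolIdx n) : Coord n :=
  ![realBasis n r.1.1, realBasis n r.1.2,
    realBasis n r.1.1 + Complex.I • realBasis n r.1.2] r.2

/-- The coefficient functions of the polarization formula. -/
def polCoeff {n : ℕ} (β : Coord n [⋀^(Fin n × Fin 2)]→ₗ[ℝ] ℂ) (w : Coord n) (r : PolIdx n) : ℂ :=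
  ![1 / 4, 1 / 4, -1 / 4] r.2 * topDensity (wedgeForm (realCoord r.1.1) (realCoord r.1.2)) β w

/-- A form of type `(1, 1)` enters the density only through its values on complex lines. -/
lemma topDensity_eq_sum {n : ℕ} (α : Coord n [⋀^Fin 2]→ₗ[ℝ] ℂ) (h : Coord n → ℂ)
    (hα : ∀ x y, α ![x, y] = (h x + h y - h (x + Complex.I • y)) / 2)
    (β : Coord n [⋀^(Fin n × Fin 2)]→ₗ[ℝ] ℂ) (w : Coord n) :
    topDensity α β w = ∑ r : PolIdx n, h (polDir r) * polCoeff β w r := by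
  have h1 : ∀ v, awedge α β v = _ := fun v => awedge_sum_smul_left Finset.univ
    (fun r : (Fin (n + 2) × Fin 2) × (Fin (n + 2) × Fin 2) =>
      1 / 2 * α ![realBasis n r.1, realBasis n r.2]) α
    (fun r => wedgeForm (realCoord r.1) (realCoord r.2))
    (fun x => alternating_two_eq_sum_wedgeForm α x) β v
  rw [topDensity]
  simp_rw [h1]
  rw [Finset.sum_comm, Finset.sum_div]
  refine Eq.trans ?_ (Fintype.sum_prod_type _).symm
  refine Finset.sum_congr rfl fun r _ => ?_
  -- The coefficients `±1/4` of `polCoeff` are the `1/2` of the expansion in `wedgeForm` times the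
  -- `1/2` of the polarization identity `hα`.
  rw [← Finset.mul_sum, Fin.sum_univ_three, hα]
  simp only [polDir, polCoeff, topDensity, Matrix.cons_val_zero, Matrix.cons_val_one,
    Matrix.cons_val]
  ring

/-! ### Forms on projective space -/

/-- Write `c = |c| · (c / |c|)`. The unimodular factor acts trivially on the arguments by `type_pp`,
the modulus comes out of each of the `2p` real slots, and `invariant` compares the two base points.
-/
lemma ContForm.toFun_smul {n p : ℕ} (φ : ContForm n p) {w : Coord n} (hw : w ≠ 0) {c : ℂ}
    (hc : c ≠ 0) (v : Fin p × Fin 2 → Coord n) :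
    φ.toFun (c • w) v = ((‖c‖ ^ (2 * p))⁻¹ : ℝ) * φ.toFun w v := by
  have hc' : (‖c‖ : ℂ) ≠ 0 := by simpa using hc
  have hcw : c • w ≠ 0 := smul_ne_zero hc hw
  have h1 := φ.invariant w hw c hc v
  have h2 : (fun q => c • v q) = fun q => ‖c‖ • ((c / ‖c‖) • v q) := by
    ext q a
    simp only [Pi.smul_apply, smul_eq_mul, Complex.real_smul]
    field_simp
  have h3 : φ.toFun (c • w) (fun q => ‖c‖ • ((c / ‖c‖) • v q)) =
      (∏ _q : Fin p × Fin 2, ‖c‖) • φ.toFun (c • w) (fun q => (c / ‖c‖) • v q) :=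
    (φ.toFun (c • w)).toMultilinearMap.map_smul_univ _ _
  rw [h2, h3, φ.type_pp _ hcw _ (by simp [hc])] at h1
  rw [← h1]
  simp only [Finset.prod_const, Finset.card_univ, Fintype.card_prod, Fintype.card_fin,
    Complex.real_smul]
  push_cast
  rw [mul_comm p 2, inv_mul_cancel_left₀ (pow_ne_zero _ hc')]

/-- The alternating map underlying a form at a point. -/
def ContForm.at {n p : ℕ} (φ : ContForm n p) (w : Coord n) :
    Coord n [⋀^(Fin p × Fin 2)]→ₗ[ℝ] ℂ := (φ.toFun w).toAlternatingMap

/-- The exponent is `2n` from the form and `2` from the denominator `nsq`. It cancels the Jacobian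
`|c|^{2(n+1)}` of polar coordinates on the cone. -/
lemma topDensity_smul {n : ℕ} (φ : ContForm n n) (α : Coord n [⋀^Fin 2]→ₗ[ℝ] ℂ) {w : Coord n}
    (hw : w ≠ 0) {c : ℂ} (hc : c ≠ 0) :
    topDensity α (φ.at (c • w)) (c • w) =
      ((‖c‖ ^ (2 * n + 2))⁻¹ : ℝ) * topDensity α (φ.at w) w := by
  have h : ∀ v, awedge α (φ.at (c • w)) v = ((‖c‖ ^ (2 * n))⁻¹ : ℝ) * awedge α (φ.at w) v :=
    awedge_smul_right _ α _ _ (fun x => φ.toFun_smul hw hc x)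
  simp only [topDensity, h, ← Finset.mul_sum, nsq_smul]
  push_cast
  rw [pow_add, mul_inv, mul_div_mul_comm]
  field_simp

lemma continuousOn_topDensity {n : ℕ} (φ : ContForm n n) (α : Coord n [⋀^Fin 2]→ₗ[ℝ] ℂ) :
    ContinuousOn (fun w => topDensity α (φ.at w) w) {0}ᶜ := by
  unfold topDensity
  refine ContinuousOn.div ?_ ?_ fun w hw => by exact_mod_cast (nsq_pos hw).ne'
  · simp_rw [awedge_eq_sum_out]
    refine continuousOn_finsetSum _ fun j _ => continuousOn_finsetSum _ fun σ _ => ?_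
    refine continuousOn_const.mul (continuousOn_const.mul ?_)
    have h : ∀ x, Continuous (fun β : Coord n [⋀^(Fin n × Fin 2)]→L[ℝ] ℂ => β x) := fun x =>
      continuous_eval_const x
    exact (h _).comp_continuousOn φ.continuousOn
  · exact (Complex.continuous_ofReal.comp continuous_nsq).continuousOn

lemma polCoeff_smul {n : ℕ} (φ : ContForm n n) (r : PolIdx n) {w : Coord n}
    (hw : w ≠ 0) {c : ℂ} (hc : c ≠ 0) :
    polCoeff (φ.at (c • w)) (c • w) r =
      ((‖c‖ ^ (2 * n + 2))⁻¹ : ℝ) * polCoeff (φ.at w) w r := by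
  rw [polCoeff, topDensity_smul φ _ hw hc, polCoeff]
  ring

lemma continuousOn_polCoeff {n : ℕ} (φ : ContForm n n) (r : PolIdx n) :
    ContinuousOn (fun w => polCoeff (φ.at w) w r) {0}ᶜ :=
  continuousOn_const.mul (continuousOn_topDensity φ _)

/-- Here `|ξ u|²` is the value of the form on `(u, i u)`. This is the hypothesis that
`topDensity_eq_sum` asks of a `(1,1)`-form. -/
lemma rankOneForm_polarization {n : ℕ} (ξ : Coord n →ₗ[ℂ] ℂ) (x y : Coord n) :
    rankOneForm ξ ![x, y] = ((‖ξ x‖ ^ 2 : ℝ) + (‖ξ y‖ ^ 2 : ℝ) -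
      (‖ξ (x + Complex.I • y)‖ ^ 2 : ℝ)) / 2 := by
  rw [rankOneForm_apply]
  simp only [← Complex.normSq_eq_norm_sq, Complex.normSq_apply, Matrix.cons_val_zero,
    Matrix.cons_val_one, map_add, map_smul, smul_eq_mul, Complex.add_re, Complex.add_im,
    Complex.mul_re, Complex.mul_im, Complex.I_re, Complex.I_im]
  push_cast
  ring

/-! ### The Fubini-Study form -/

/-- The Hermitian product `∑ x̄_j y_j`. -/
def herm {n : ℕ} (x y : Coord n) : ℂ := ∑ j, (starRingEnd ℂ) (x j) * y j

lemma herm_self {n : ℕ} (x : Coord n) : herm x x = (nsq x : ℂ) := by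
  simp [herm, nsq, ← Complex.normSq_eq_conj_mul_self, Complex.normSq_eq_norm_sq]

lemma herm_conj {n : ℕ} (x y : Coord n) : (starRingEnd ℂ) (herm x y) = herm y x := by
  simp [herm, mul_comm]

lemma herm_add_right {n : ℕ} (x y z : Coord n) : herm x (y + z) = herm x y + herm x z := by
  simp [herm, mul_add, Finset.sum_add_distrib]

lemma herm_add_left {n : ℕ} (x y z : Coord n) : herm (x + y) z = herm x z + herm y z := by
  simp [herm, add_mul, Finset.sum_add_distrib]

lemma herm_smul_right {n : ℕ} (c : ℂ) (x y : Coord n) : herm x (c • y) = c * herm x y := by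
  simp [herm, Finset.mul_sum, mul_left_comm]

lemma herm_smul_left {n : ℕ} (c : ℂ) (x y : Coord n) :
    herm (c • x) y = (starRingEnd ℂ) c * herm x y := by
  simp [herm, Finset.mul_sum, mul_assoc]

/-- `w ↦ ⟨w, v⟩` as a real linear map. -/
def hermLeftCLM {n : ℕ} (v : Coord n) : Coord n →L[ℝ] ℂ :=
  ∑ j, (v j) • (Complex.conjCLE.toContinuousLinearMap.comp
    (ContinuousLinearMap.proj (R := ℝ) (φ := fun _ : Fin (n + 2) => ℂ) j))

lemma hermLeftCLM_apply {n : ℕ} (v w : Coord n) : hermLeftCLM v w = herm w v := by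
  simp [hermLeftCLM, herm, mul_comm]

/-- `v ↦ ⟨w, v⟩` as a real linear map. -/
def hermRightCLM {n : ℕ} (w : Coord n) : Coord n →L[ℝ] ℂ :=
  ∑ j, ((starRingEnd ℂ) (w j)) •
    (ContinuousLinearMap.proj (R := ℝ) (φ := fun _ : Fin (n + 2) => ℂ) j)

lemma hermRightCLM_apply {n : ℕ} (v w : Coord n) : hermRightCLM w v = herm w v := by
  simp [hermRightCLM, herm]

lemma hasFDerivAt_nsq {n : ℕ} (w : Coord n) :
    HasFDerivAt nsq (2 • (Complex.reCLM.comp (hermRightCLM w))) w := by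
  have h : ∀ j, HasFDerivAt (fun w : Coord n => ‖w j‖ ^ 2) ((2 • innerSL ℝ (w j)).comp
      (ContinuousLinearMap.proj (R := ℝ) (φ := fun _ : Fin (n + 2) => ℂ) j)) w := fun j =>
    HasFDerivAt.comp (g := fun z : ℂ => ‖z‖ ^ 2) w (hasStrictFDerivAt_norm_sq (w j)).hasFDerivAt
      (ContinuousLinearMap.proj (R := ℝ) (φ := fun _ : Fin (n + 2) => ℂ) j).hasFDerivAt
  have := HasFDerivAt.fun_sum (u := Finset.univ) (fun j _ => h j)
  convert! this using 1
  ext v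
  simp [hermRightCLM_apply, herm, Finset.mul_sum, Complex.inner]
  refine Finset.sum_congr rfl fun j _ => by ring

lemma hasFDerivAt_logNormSq {n : ℕ} {w : Coord n} (hw : w ≠ 0) :
    HasFDerivAt logNormSq (Complex.ofRealCLM.comp ((nsq w)⁻¹ •
      (2 • (Complex.reCLM.comp (hermRightCLM w))))) w :=
  Complex.ofRealCLM.hasFDerivAt.comp w ((hasFDerivAt_nsq w).log (nsq_pos hw).ne')

lemma dc_logNormSq {n : ℕ} {w : Coord n} (hw : w ≠ 0) (v : Fin 1 → Coord n) :
    dc logNormSq w v = ((2 * (herm w (v 0)).im / nsq w : ℝ) : ℂ) := by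
  have : dc logNormSq w v = - fderiv ℝ logNormSq w (Complex.I • v 0) := by
    simp [dc]
  rw [this, (hasFDerivAt_logNormSq hw).fderiv]
  simp [hermRightCLM_apply, herm_smul_right]
  ring

lemma contDiffAt_logNormSq {n : ℕ} {w : Coord n} (hw : w ≠ 0) :
    ContDiffAt ℝ 2 logNormSq w := by
  have h1 : ContDiffAt ℝ 2 (nsq (n := n)) w := by
    unfold nsq
    refine ContDiffAt.sum fun j _ => ?_
    exact (contDiff_norm_sq ℝ).contDiffAt.comp w (contDiff_apply ℝ ℂ j).contDiffAt
  exact Complex.ofRealCLM.contDiff.contDiffAt.comp w (h1.log (nsq_pos hw).ne')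

lemma differentiableAt_dc {n : ℕ} {f : Coord n → ℂ} {w : Coord n} (hf : ContDiffAt ℝ 2 f w) :
    DifferentiableAt ℝ (dc f) w := by
  have h1 : DifferentiableAt ℝ (fderiv ℝ f) w :=
    (hf.fderiv_right (m := 1) (by norm_num)).differentiableAt (by norm_num)
  let L : (Coord n →L[ℝ] ℂ) →ₗ[ℝ] (Coord n [⋀^Fin 1]→L[ℝ] ℂ) :=
    { toFun := fun A => ContinuousAlternatingMap.ofSubsingleton ℝ (Coord n) ℂ (0 : Fin 1)
        (-(A.comp (Complex.I • ContinuousLinearMap.id ℝ (Coord n))))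
      map_add' := fun A B => by ext v; simp; ring
      map_smul' := fun c A => by ext v; simp }
  exact (LinearMap.toContinuousLinearMap L).differentiableAt.comp w h1

/-- The Fubini-Study form in coordinates. -/
lemma omegaFS_apply {n : ℕ} {w : Coord n} (hw : w ≠ 0) (v : Fin 2 → Coord n) :
    omegaFS w v = ((Real.pi⁻¹ * ((herm (v 0) (v 1)).im / nsq w -
      (herm (v 0) w * herm w (v 1)).im / nsq w ^ 2) : ℝ) : ℂ) := by
  have hN := nsq_pos hw
  have hder : ∀ x y : Coord n, fderiv ℝ (fun w' => dc logNormSq w' ![y]) w x =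
      ((2 * (herm x y).im / nsq w - 2 * (herm w y).im * (2 * (herm w x).re) / nsq w ^ 2 : ℝ) : ℂ)
      := by
    intro x y
    have ha : HasFDerivAt (fun w' : Coord n => 2 * (herm w' y).im)
        ((2 : ℝ) • (Complex.imCLM.comp (hermLeftCLM y))) w := by
      have := ((2 : ℝ) • (Complex.imCLM.comp (hermLeftCLM y))).hasFDerivAt (x := w)
      refine this.congr_of_eventuallyEq (Eventually.of_forall fun w' => ?_)
      simp [hermLeftCLM_apply]
    have hb : HasFDerivAt (fun w' : Coord n => (nsq w')⁻¹)
        ((-(nsq w ^ 2)⁻¹) • (2 • (Complex.reCLM.comp (hermRightCLM w)))) w :=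
      (hasDerivAt_inv hN.ne').comp_hasFDerivAt w (hasFDerivAt_nsq w)
    have h1 := ha.mul hb
    have h2 := Complex.ofRealCLM.hasFDerivAt.comp w h1
    have h3 : (fun w' => dc logNormSq w' ![y]) =ᶠ[𝓝 w]
        (fun w' => Complex.ofRealCLM ((2 * (herm w' y).im) * (nsq w')⁻¹)) := by
      filter_upwards [isOpen_ne.mem_nhds hw] with w' hw'
      rw [dc_logNormSq hw']
      simp [div_eq_mul_inv]
    rw [(h2.congr_of_eventuallyEq h3).fderiv]
    simp [hermLeftCLM_apply, hermRightCLM_apply]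
    have : (nsq w : ℂ) ≠ 0 := by exact_mod_cast hN.ne'
    field_simp
    ring
  have hd := differentiableAt_dc (contDiffAt_logNormSq hw)
  have h4 : extDeriv (dc logNormSq) w v =
      fderiv ℝ (fun w' => dc logNormSq w' ![v 1]) w (v 0) -
      fderiv ℝ (fun w' => dc logNormSq w' ![v 0]) w (v 1) := by
    rw [extDeriv_apply hd, Fin.sum_univ_two]
    have e0 : (0 : Fin 2).removeNth v = ![v 1] := by ext i : 1; fin_cases i; rfl
    have e1 : (1 : Fin 2).removeNth v = ![v 0] := by ext i : 1; fin_cases i; rfl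
    simp only [e0, e1]
    simp [sub_eq_add_neg]
  have h5 : omegaFS w v = (1 / (2 * Real.pi) : ℝ) • ((1 / 2 : ℝ) •
      extDeriv (dc logNormSq) w v) := rfl
  rw [h5, h4, hder, hder]
  have hx : herm (v 1) (v 0) = (starRingEnd ℂ) (herm (v 0) (v 1)) := (herm_conj _ _).symm
  have hy : herm (v 0) w = (starRingEnd ℂ) (herm w (v 0)) := (herm_conj _ _).symm
  rw [hx, hy]
  simp only [Complex.real_smul, Complex.mul_im, Complex.conj_re, Complex.conj_im]
  norm_cast
  have := Real.pi_ne_zero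
  field_simp
  ring

/-- The value of the Fubini-Study form on the complex line spanned by `u`. -/
def fsDensity {n : ℕ} (w u : Coord n) : ℝ :=
  Real.pi⁻¹ * ((nsq w * nsq u - ‖herm w u‖ ^ 2) / nsq w ^ 2)

lemma nsq_add {n : ℕ} (x y : Coord n) : nsq (x + y) = nsq x + 2 * (herm x y).re + nsq y := by
  have h : (nsq (x + y) : ℂ) = nsq x + (herm x y + (starRingEnd ℂ) (herm x y)) + nsq y := by
    rw [← herm_self, ← herm_self, ← herm_self, herm_conj, herm_add_left, herm_add_right,
      herm_add_right]
    ring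
  rw [Complex.add_conj] at h
  exact_mod_cast h

/-- The Fubini-Study form satisfies the same identity as the rank-one forms, with `fsDensity` for
`|ξ u|²`. The same coefficients `polCoeff` therefore serve the zero divisors and the limit. -/
lemma omegaFS_polarization {n : ℕ} {w : Coord n} (hw : w ≠ 0) (x y : Coord n) :
    omegaFS w ![x, y] = ((fsDensity w x : ℂ) + fsDensity w y -
      fsDensity w (x + Complex.I • y)) / 2 := by
  have hN := nsq_pos hw
  rw [omegaFS_apply hw]
  simp only [fsDensity, Matrix.cons_val_zero, Matrix.cons_val_one, nsq_add, nsq_smul,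
    ← Complex.normSq_eq_norm_sq, Complex.normSq_apply, herm_add_right, herm_smul_right,
    ← herm_conj w x, Complex.add_re, Complex.add_im,
    Complex.mul_re, Complex.mul_im, Complex.I_re, Complex.I_im, Complex.conj_re, Complex.conj_im]
  norm_cast
  field_simp
  ring

lemma omegaFS_eq_zero {n : ℕ} {w : Coord n} (hw : w ≠ 0) (c : ℂ) (v : Fin 2 → Coord n)
    (hv : ∃ q, v q = c • w) : omegaFS w v = 0 := by
  have hN := nsq_pos hw
  rw [omegaFS_apply hw]
  obtain ⟨q, hq⟩ := hv
  fin_cases q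
  · simp only [Fin.zero_eta] at hq
    rw [hq, herm_smul_left, herm_smul_left, herm_self,
      mul_right_comm, Complex.im_mul_ofReal]
    norm_cast
    field_simp
    simp
  · simp only [Fin.mk_one] at hq
    rw [hq, herm_smul_right, herm_smul_right, herm_self, ← mul_assoc, Complex.im_mul_ofReal,
      mul_comm c]
    norm_cast
    field_simp
    simp

/-! ### Area formula and tube averages for polynomials of one variable -/

open Polynomial in
lemma det_smulRight_restrictScalars (a : ℂ) :
    ((((1 : ℂ →L[ℂ] ℂ).smulRight a)).restrictScalars ℝ).det = ‖a‖ ^ 2 := by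
  have h : ((((1 : ℂ →L[ℂ] ℂ).smulRight a)).restrictScalars ℝ).det =
      LinearMap.det (((((1 : ℂ →L[ℂ] ℂ).smulRight a)) : ℂ →ₗ[ℂ] ℂ).restrictScalars ℝ) := rfl
  rw [h, LinearMap.det_restrictScalars, Algebra.norm_complex_apply, ← Complex.normSq_eq_norm_sq]
  congr 1
  simp [LinearMap.det_ring]

open Polynomial in
lemma hasFDerivAt_polynomial (q : ℂ[X]) (t : ℂ) :
    HasFDerivAt (fun t => q.eval t)
      ((((1 : ℂ →L[ℂ] ℂ).smulRight (q.derivative.eval t))).restrictScalars ℝ) t := by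
  have := (q.hasDerivAt t).hasFDerivAt.restrictScalars ℝ
  convert! this using 1

open Polynomial in
lemma exists_open_injOn (q : ℂ[X]) (t : ℂ) (ht : q.derivative.eval t ≠ 0) :
    ∃ V ∈ 𝓝 t, IsOpen V ∧ Set.InjOn (fun t => q.eval t) V := by
  have h := (q.hasStrictDerivAt t).hasStrictFDerivAt_equiv ht
  refine ⟨(h.toOpenPartialHomeomorph _).source, ?_, (h.toOpenPartialHomeomorph _).open_source, ?_⟩
  · exact (h.toOpenPartialHomeomorph _).open_source.mem_nhds h.mem_toOpenPartialHomeomorph_source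
  · have := (h.toOpenPartialHomeomorph _).injOn
    simpa using this

open Polynomial in
lemma lintegral_image_polynomial (q : ℂ[X]) {A : Set ℂ} (hA : MeasurableSet A)
    (hinj : Set.InjOn (fun t => q.eval t) A) (g : ℂ → ENNReal) :
    ∫⁻ s in (fun t => q.eval t) '' A, g s =
      ∫⁻ t in A, ENNReal.ofReal (‖q.derivative.eval t‖ ^ 2) * g (q.eval t) := by
  rw [lintegral_image_eq_lintegral_abs_det_fderiv_mul volume hA
    (fun t _ => (hasFDerivAt_polynomial q t).hasFDerivWithinAt) hinj]
  simp_rw [det_smulRight_restrictScalars, abs_pow, abs_norm]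

open Polynomial in
lemma measurableSet_image_polynomial (q : ℂ[X]) {A : Set ℂ} (hA : MeasurableSet A)
    (hinj : Set.InjOn (fun t => q.eval t) A) : MeasurableSet ((fun t => q.eval t) '' A) :=
  hA.image_of_continuousOn_injOn q.continuous.continuousOn hinj

open Polynomial in
/-- A polynomial of degree `d` covers the plane at most `d` times. -/
lemma lintegral_polynomial_le (q : ℂ[X]) {g : ℂ → ENNReal} (hg : Measurable g) :
    ∫⁻ t, ENNReal.ofReal (‖q.derivative.eval t‖ ^ 2) * g (q.eval t) ≤
      q.natDegree * ∫⁻ s, g s := by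
  classical
  by_cases hq : q.derivative = 0
  · simp [hq]
  set S : Set ℂ := {t | q.derivative.eval t ≠ 0} with hS
  have hSo : IsOpen S := isOpen_ne_fun q.derivative.continuous continuous_const
  choose! V hV using fun t (ht : t ∈ S) => exists_open_injOn q t ht
  obtain ⟨T, hTS, hTc, hT⟩ := TopologicalSpace.countable_cover_nhdsWithin
    (f := V) (s := S) (fun t ht => mem_nhdsWithin_of_mem_nhds (hV t ht).1)
  rcases T.eq_empty_or_nonempty with rfl | hTn
  · have hS0 : S = ∅ := by simpa using hT
    have : ∀ t, q.derivative.eval t = 0 := fun t => by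
      by_contra h
      have : t ∈ S := h
      rw [hS0] at this
      exact this
    simp [this]
  obtain ⟨x, rfl⟩ := hTc.exists_eq_range hTn
  -- Countably many disjoint measurable pieces of `{q' ≠ 0}`, on each of which `q` is injective, so
  -- the area formula applies piece by piece.
  set A : ℕ → Set ℂ := fun k => disjointed (fun k => V (x k)) k ∩ S with hAdef
  have hxS : ∀ k, x k ∈ S := fun k => hTS ⟨k, rfl⟩
  have hAm : ∀ k, MeasurableSet (A k) := fun k =>
    (MeasurableSet.disjointed (fun k => (hV _ (hxS k)).2.1.measurableSet) k).inter hSo.measurableSet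
  have hAinj : ∀ k, Set.InjOn (fun t => q.eval t) (A k) := fun k =>
    (hV _ (hxS k)).2.2.mono (Set.inter_subset_left.trans (disjointed_subset _ k))
  have hAd : Pairwise (Function.onFun Disjoint A) := fun i j hij =>
    (disjoint_disjointed _ hij).mono Set.inter_subset_left Set.inter_subset_left
  have hAU : ⋃ k, A k = S := by
    rw [hAdef, ← Set.iUnion_inter, iUnion_disjointed]
    refine Set.inter_eq_right.mpr ?_
    simpa using hT
  have h1 : ∫⁻ t, ENNReal.ofReal (‖q.derivative.eval t‖ ^ 2) * g (q.eval t) =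
      ∫⁻ t in S, ENNReal.ofReal (‖q.derivative.eval t‖ ^ 2) * g (q.eval t) := by
    rw [← lintegral_indicator hSo.measurableSet]
    refine lintegral_congr fun t => ?_
    by_cases ht : t ∈ S
    · simp [ht]
    · have : q.derivative.eval t = 0 := by simpa [hS] using ht
      simp [ht, this]
  rw [h1, ← hAU, lintegral_iUnion hAm hAd]
  have h0 : ∀ k, ∫⁻ t in A k, ENNReal.ofReal (‖q.derivative.eval t‖ ^ 2) * g (q.eval t) =
      ∫⁻ s, ((fun t => q.eval t) '' A k).indicator g s := fun k => by
    rw [lintegral_indicator (measurableSet_image_polynomial q (hAm k) (hAinj k)),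
      lintegral_image_polynomial q (hAm k) (hAinj k) g]
  simp_rw [h0]
  rw [← lintegral_tsum (fun k =>
    (hg.indicator (measurableSet_image_polynomial q (hAm k) (hAinj k))).aemeasurable),
    ← lintegral_const_mul _ hg]
  refine lintegral_mono fun s => ?_
  refine ENNReal.summable.tsum_le_of_sum_le fun F => ?_
  have h2 : ∑ k ∈ F, ((fun t => q.eval t) '' A k).indicator g s =
      ((F.filter fun k => s ∈ (fun t => q.eval t) '' A k).card : ENNReal) * g s := by
    rw [← nsmul_eq_mul, ← Finset.sum_const, Finset.sum_filter]
    exact Finset.sum_congr rfl fun k _ => by rw [Set.indicator_apply]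
  rw [h2]
  gcongr
  -- The number of pieces whose image contains `s` is at most the number of roots of `q - s`:
  -- disjoint pieces provide distinct preimages. This polynomial is nonzero because `q` is not
  -- constant.
  have hne : q - C s ≠ 0 := by
    intro h
    rw [sub_eq_zero] at h
    exact hq (by rw [h]; simp)
  have hpre : ∀ k, s ∈ (fun t => q.eval t) '' A k → ∃ t, t ∈ A k ∧ q.eval t = s :=
    fun k hk => hk
  choose! τ hτ using hpre
  calc (F.filter fun k => s ∈ (fun t => q.eval t) '' A k).card
      ≤ (q - C s).roots.toFinset.card := by
        refine Finset.card_le_card_of_injOn τ ?_ ?_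
        · intro k hk
          have := hτ k (Finset.mem_filter.mp hk).2
          simp [hne, this.2]
        · intro k hk l hl hkl
          by_contra hne'
          have h3 := (hτ k (Finset.mem_filter.mp hk).2).1
          have h4 := (hτ l (Finset.mem_filter.mp hl).2).1
          rw [← hkl] at h4
          exact Set.disjoint_left.mp (hAd hne') h3 h4
    _ ≤ (q - C s).roots.card := Multiset.toFinset_card_le _
    _ ≤ (q - C s).natDegree := card_roots' _
    _ = q.natDegree := natDegree_sub_C

open Polynomial in
/-- The average of `h |q'|²` over the tube `|q| < ε`. -/
def tube (q : ℂ[X]) (h : ℂ → ℂ) (ε : ℝ) : ℂ :=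
  (Real.pi * ε ^ 2 : ℝ)⁻¹ *
    ∫ t in {t | ‖q.eval t‖ < ε}, h t * (‖q.derivative.eval t‖ ^ 2 : ℝ)

open Polynomial in
lemma isOpen_tube (q : ℂ[X]) (ε : ℝ) : IsOpen {t : ℂ | ‖q.eval t‖ < ε} :=
  isOpen_lt q.continuous.norm continuous_const

open Polynomial in
-- Apply `lintegral_polynomial_le` to the indicator of the disc of radius `ε`, of area `π ε²`. The
-- bound does not depend on `ε`, so it can dominate the tube averages on all lines.
lemma norm_tube_le (q : ℂ[X]) (h : ℂ → ℂ) {ε C : ℝ} (hε : 0 < ε) (hC : ∀ t, ‖h t‖ ≤ C) :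
    ‖tube q h ε‖ ≤ q.natDegree * C := by
  have hC0 : 0 ≤ C := (norm_nonneg _).trans (hC 0)
  have h1 := lintegral_polynomial_le q (g := (Metric.ball (0 : ℂ) ε).indicator 1)
    (measurable_one.indicator measurableSet_ball)
  rw [lintegral_indicator_one measurableSet_ball, Complex.volume_ball] at h1
  have h2 : ∫⁻ t in {t | ‖q.eval t‖ < ε}, ‖h t * (‖q.derivative.eval t‖ ^ 2 : ℝ)‖ₑ ≤
      ENNReal.ofReal (C * (q.natDegree * (Real.pi * ε ^ 2))) := by
    calc ∫⁻ t in {t | ‖q.eval t‖ < ε}, ‖h t * (‖q.derivative.eval t‖ ^ 2 : ℝ)‖ₑ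
        ≤ ∫⁻ t in {t | ‖q.eval t‖ < ε}, ENNReal.ofReal C *
            ENNReal.ofReal (‖q.derivative.eval t‖ ^ 2) := by
          refine lintegral_mono fun t => ?_
          rw [enorm_mul]
          gcongr
          · rw [← ofReal_norm]
            exact ENNReal.ofReal_le_ofReal (hC t)
          · rw [← ofReal_norm, Complex.norm_real, Real.norm_of_nonneg (by positivity)]
      _ = ENNReal.ofReal C * ∫⁻ t, ENNReal.ofReal (‖q.derivative.eval t‖ ^ 2) *
            (Metric.ball (0 : ℂ) ε).indicator 1 (q.eval t) := by
          rw [lintegral_const_mul']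
          swap
          · simp
          congr 1
          rw [← lintegral_indicator (isOpen_tube q ε).measurableSet]
          refine lintegral_congr fun t => ?_
          by_cases ht : ‖q.eval t‖ < ε <;> simp [ht]
      _ ≤ ENNReal.ofReal C * (q.natDegree * (ENNReal.ofReal ε ^ 2 * NNReal.pi)) := by gcongr
      _ = _ := by
          rw [ENNReal.ofReal_mul hC0, ENNReal.ofReal_mul (by positivity), mul_comm Real.pi,
            ENNReal.ofReal_mul (by positivity), ENNReal.ofReal_pow hε.le, ENNReal.ofReal_natCast]
          congr 3
          rw [ENNReal.ofReal, ← NNReal.coe_real_pi, Real.toNNReal_coe]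
  have h3 : ‖∫ t in {t | ‖q.eval t‖ < ε}, h t * (‖q.derivative.eval t‖ ^ 2 : ℝ)‖ ≤
      C * (q.natDegree * (Real.pi * ε ^ 2)) := by
    refine (norm_integral_le_lintegral_norm _).trans ?_
    refine ENNReal.toReal_le_of_le_ofReal (by positivity) ?_
    simpa only [ofReal_norm] using h2
  rw [tube, norm_mul, Complex.norm_real, norm_inv, Real.norm_of_nonneg (by positivity)]
  have := Real.pi_pos
  rw [inv_mul_le_iff₀ (by positivity)]
  linarith

open Polynomial in
-- Near a simple root `q` is a change of variables with Jacobian `|q'|²` onto a neighbourhood of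
-- `0`. The local tube is mapped onto the full disc of radius `ε`, and the normalized integral is an
-- average of `h` over points close to `a`. The admissible `ε` depend on `ρ`.
lemma tube_local (q : ℂ[X]) {h : ℂ → ℂ} (hh : Continuous h) (a : ℂ) (ha : q.eval a = 0)
    (ha' : q.derivative.eval a ≠ 0) {δ : ℝ} (hδ : 0 < δ) :
    ∀ᶠ ρ in 𝓝[>] (0 : ℝ), ∀ᶠ ε in 𝓝[>] (0 : ℝ),
      ‖(Real.pi * ε ^ 2 : ℝ)⁻¹ * (∫ t in Metric.ball a ρ ∩ {t | ‖q.eval t‖ < ε},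
        h t * (‖q.derivative.eval t‖ ^ 2 : ℝ)) - h a‖ ≤ δ := by
  obtain ⟨V, hVa, hVo, hVi⟩ := exists_open_injOn q a ha'
  have hh' : {t | ‖h t - h a‖ < δ} ∈ 𝓝 a := by
    have : Continuous fun t => ‖h t - h a‖ := by fun_prop
    exact (isOpen_lt this continuous_const).mem_nhds (by simpa using hδ)
  obtain ⟨ρ₀, hρ₀, hball⟩ := Metric.mem_nhds_iff.mp (inter_mem hVa hh')
  filter_upwards [Ioo_mem_nhdsGT hρ₀] with ρ hρ
  have hsub : Metric.ball a ρ ⊆ V ∩ {t | ‖h t - h a‖ < δ} :=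
    (Metric.ball_subset_ball hρ.2.le).trans hball
  have hinj : Set.InjOn (fun t => q.eval t) (Metric.ball a ρ) :=
    hVi.mono (hsub.trans Set.inter_subset_left)
  have himg : (fun t => q.eval t) '' Metric.ball a ρ ∈ 𝓝 (0 : ℂ) := by
    have := (q.hasStrictDerivAt a).map_nhds_eq ha'
    rw [← ha, ← this]
    exact image_mem_map (Metric.ball_mem_nhds a hρ.1)
  obtain ⟨ε₀, hε₀, hball'⟩ := Metric.mem_nhds_iff.mp himg
  filter_upwards [Ioo_mem_nhdsGT hε₀] with ε hε
  set A := Metric.ball a ρ ∩ {t | ‖q.eval t‖ < ε} with hA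
  have hAm : MeasurableSet A := measurableSet_ball.inter (isOpen_tube q ε).measurableSet
  have hAimg : (fun t => q.eval t) '' A = Metric.ball 0 ε := by
    ext s
    constructor
    · rintro ⟨t, ht, rfl⟩
      simpa using ht.2
    · intro hs
      obtain ⟨t, ht, rfl⟩ := hball' (Metric.ball_subset_ball hε.2.le hs)
      exact ⟨t, ⟨ht, by simpa using hs⟩, rfl⟩
  have hlin : ∫⁻ t in A, ENNReal.ofReal (‖q.derivative.eval t‖ ^ 2) =
      ENNReal.ofReal (Real.pi * ε ^ 2) := by
    have := lintegral_image_polynomial q hAm (hinj.mono Set.inter_subset_left) 1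
    rw [hAimg] at this
    simp only [Pi.one_apply, mul_one, lintegral_const, one_mul, Measure.restrict_apply_univ,
      Complex.volume_ball] at this
    rw [← this, mul_comm Real.pi, ENNReal.ofReal_mul (by positivity), ENNReal.ofReal_pow hε.1.le]
    congr 1
    rw [ENNReal.ofReal, ← NNReal.coe_real_pi, Real.toNNReal_coe]
  have hcont : Continuous fun t : ℂ => ‖q.derivative.eval t‖ ^ 2 :=
    (q.derivative.continuous.norm).pow 2
  have hint : IntegrableOn (fun t : ℂ => ‖q.derivative.eval t‖ ^ 2) A := by
    refine (hcont.continuousOn.integrableOn_compact (isCompact_closedBall a ρ)).mono_set ?_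
    exact Set.inter_subset_left.trans Metric.ball_subset_closedBall
  have hval : ∫ t in A, ‖q.derivative.eval t‖ ^ 2 = Real.pi * ε ^ 2 := by
    rw [integral_eq_lintegral_of_nonneg_ae (Eventually.of_forall fun t => by positivity)
      hcont.aestronglyMeasurable, hlin, ENNReal.toReal_ofReal (by positivity)]
  have hpos : 0 < Real.pi * ε ^ 2 := by have := hε.1; positivity
  have hint1 : IntegrableOn (fun t : ℂ => h t * (‖q.derivative.eval t‖ ^ 2 : ℝ)) A := by
    have : Continuous fun t : ℂ => h t * (‖q.derivative.eval t‖ ^ 2 : ℝ) := by fun_prop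
    refine (this.continuousOn.integrableOn_compact (isCompact_closedBall a ρ)).mono_set ?_
    exact Set.inter_subset_left.trans Metric.ball_subset_closedBall
  have hsubst : (Real.pi * ε ^ 2 : ℝ)⁻¹ * (∫ t in A, h t * (‖q.derivative.eval t‖ ^ 2 : ℝ)) - h a =
      (Real.pi * ε ^ 2 : ℝ)⁻¹ * ∫ t in A, (h t - h a) * (‖q.derivative.eval t‖ ^ 2 : ℝ) := by
    have h1 : ∫ t in A, (h t - h a) * (‖q.derivative.eval t‖ ^ 2 : ℝ) =
        (∫ t in A, h t * (‖q.derivative.eval t‖ ^ 2 : ℝ)) - h a * (Real.pi * ε ^ 2 : ℝ) := by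
      rw [← hval, ← integral_complex_ofReal, ← integral_const_mul, ← integral_sub hint1]
      · simp_rw [sub_mul]
      · exact (hint.ofReal (𝕜 := ℂ)).const_mul (h a)
    have h2 : ((Real.pi * ε ^ 2 : ℝ) : ℂ) ≠ 0 := by exact_mod_cast hpos.ne'
    rw [h1, Complex.ofReal_inv, mul_sub, mul_left_comm, inv_mul_cancel₀ h2, mul_one]
  rw [hsubst, norm_mul, Complex.norm_real, norm_inv, Real.norm_of_nonneg hpos.le,
    inv_mul_le_iff₀ hpos, mul_comm, ← hval, ← integral_const_mul]
  refine norm_integral_le_of_norm_le (hint.const_mul δ) ?_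
  filter_upwards [ae_restrict_mem hAm] with t ht
  rw [norm_mul, Complex.norm_real, Real.norm_of_nonneg (by positivity)]
  gcongr
  exact (hsub ht.1).2.le

open Polynomial in
/-- The sum of a function over the roots of a polynomial, with multiplicity. -/
def rootSum (q : ℂ[X]) (f : ℂ → ℂ) : ℂ := (q.roots.map f).sum

open Polynomial in
lemma norm_rootSum_le (q : ℂ[X]) (f : ℂ → ℂ) {C : ℝ} (hC0 : 0 ≤ C)
    (hC : ∀ t, q.eval t = 0 → ‖f t‖ ≤ C) :
    ‖rootSum q f‖ ≤ q.natDegree * C := by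
  have h1 : ‖rootSum q f‖ ≤ (q.roots.map fun t => ‖f t‖).sum := by
    have := Multiset.le_sum_of_subadditive (fun z : ℂ => ‖z‖) norm_zero.le norm_add_le (q.roots.map f)
    simpa [rootSum, Multiset.map_map, Function.comp_def] using this
  have h2 : (q.roots.map fun t => ‖f t‖).sum ≤ (q.roots.map fun _ => C).sum :=
    Multiset.sum_map_le_sum_map _ _ fun t ht => hC t (isRoot_of_mem_roots ht)
  rw [Multiset.map_const', Multiset.sum_replicate, nsmul_eq_mul] at h2
  have h3 : (q.roots.card : ℝ) ≤ q.natDegree := by exact_mod_cast card_roots' q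
  nlinarith

open Polynomial in
lemma roots_nodup_of_simple {q : ℂ[X]} (hq : q ≠ 0)
    (hs : ∀ t, q.eval t = 0 → q.derivative.eval t ≠ 0) : q.roots.Nodup := by
  classical
  rw [Multiset.nodup_iff_count_le_one]
  intro t
  rw [count_roots]
  by_contra! h
  have h2 := (one_lt_rootMultiplicity_iff_isRoot hq).mp h
  exact hs t h2.1 h2.2

open Polynomial in
lemma rootSum_eq_sum_toFinset {q : ℂ[X]} (hq : q ≠ 0)
    (hs : ∀ t, q.eval t = 0 → q.derivative.eval t ≠ 0) (f : ℂ → ℂ) :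
    rootSum q f = ∑ t ∈ q.roots.toFinset, f t := by
  rw [rootSum, Finset.sum, Multiset.toFinset_val, (roots_nodup_of_simple hq hs).dedup]

open Polynomial in
/-- Tube averages converge to the sum over the roots, if these are simple. -/
lemma tendsto_tube {q : ℂ[X]} (hq : q ≠ 0)
    (hs : ∀ t, q.eval t = 0 → q.derivative.eval t ≠ 0) {h : ℂ → ℂ} (hh : Continuous h)
    (hc : HasCompactSupport h) :
    Tendsto (tube q h) (𝓝[>] 0) (𝓝 (rootSum q h)) := by
  classical
  rw [rootSum_eq_sum_toFinset hq hs, Metric.tendsto_nhds]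
  intro δ hδ
  set R := q.roots.toFinset with hR
  have hmem : ∀ a, a ∈ R ↔ q.eval a = 0 := fun a => by simp [hR, hq]
  -- An equal share of the error for each root; the extra `1` covers the case without roots.
  set δ' := δ / (2 * (R.card + 1)) with hδ'
  have hδ'0 : 0 < δ' := by positivity
  have hloc : ∀ᶠ ρ in 𝓝[>] (0 : ℝ), ∀ a ∈ R, ∀ᶠ ε in 𝓝[>] (0 : ℝ),
      ‖(Real.pi * ε ^ 2 : ℝ)⁻¹ * (∫ t in Metric.ball a ρ ∩ {t | ‖q.eval t‖ < ε},
        h t * (‖q.derivative.eval t‖ ^ 2 : ℝ)) - h a‖ ≤ δ' := by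
    rw [eventually_all_finset]
    exact fun a ha => tube_local q hh a ((hmem a).mp ha) (hs a ((hmem a).mp ha)) hδ'0
  have hdis : ∀ᶠ ρ in 𝓝[>] (0 : ℝ), ∀ a ∈ R, ∀ b ∈ R, a ≠ b → ρ + ρ ≤ dist a b := by
    rw [eventually_all_finset]
    intro a _
    rw [eventually_all_finset]
    intro b _
    by_cases hab : a = b
    · simp [hab]
    have : 0 < dist a b / 2 := by have := dist_pos.mpr hab; positivity
    filter_upwards [Ioo_mem_nhdsGT this] with ρ hρ _
    linarith [hρ.2]
  obtain ⟨ρ, hρloc, hρdis, hρ0⟩ := (hloc.and (hdis.and self_mem_nhdsWithin)).exists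
  have hρ0' : 0 < ρ := hρ0
  set B : Set ℂ := ⋃ a ∈ R, Metric.ball a ρ with hB
  have hBo : IsOpen B := isOpen_biUnion fun _ _ => Metric.isOpen_ball
  have hK : IsCompact (tsupport h \ B) := hc.isCompact.diff hBo
  -- On the part of the support of `h` outside the balls, `|q|` is bounded below by compactness. For
  -- `ε < ε₁` the tube meets the support only inside the balls.
  obtain ⟨ε₁, hε₁, hq₁⟩ : ∃ ε₁ > 0, ∀ t ∈ tsupport h \ B, ε₁ ≤ ‖q.eval t‖ := by
    rcases (tsupport h \ B).eq_empty_or_nonempty with he | hne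
    · exact ⟨1, one_pos, by simp [he]⟩
    obtain ⟨t₀, ht₀, hmin⟩ := hK.exists_isMinOn hne q.continuous.norm.continuousOn
    refine ⟨‖q.eval t₀‖, norm_pos_iff.mpr fun h0 => ht₀.2 ?_, fun t ht => hmin ht⟩
    exact Set.mem_biUnion ((hmem t₀).mpr h0) (Metric.mem_ball_self hρ0')
  rw [← eventually_all_finset] at hρloc
  filter_upwards [hρloc, Ioo_mem_nhdsGT hε₁] with ε hε hε'
  have hint : ∀ a ∈ R, IntegrableOn (fun t : ℂ => h t * (‖q.derivative.eval t‖ ^ 2 : ℝ))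
      (Metric.ball a ρ ∩ {t | ‖q.eval t‖ < ε}) := by
    intro a _
    have : Continuous fun t : ℂ => h t * (‖q.derivative.eval t‖ ^ 2 : ℝ) := by fun_prop
    refine (this.continuousOn.integrableOn_compact (isCompact_closedBall a ρ)).mono_set ?_
    exact Set.inter_subset_left.trans Metric.ball_subset_closedBall
  have hms : ∀ a, MeasurableSet (Metric.ball a ρ ∩ {t | ‖q.eval t‖ < ε}) := fun a =>
    measurableSet_ball.inter (isOpen_tube q ε).measurableSet
  have hsum : ∫ t in {t | ‖q.eval t‖ < ε}, h t * (‖q.derivative.eval t‖ ^ 2 : ℝ) =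
      ∑ a ∈ R, ∫ t in Metric.ball a ρ ∩ {t | ‖q.eval t‖ < ε},
        h t * (‖q.derivative.eval t‖ ^ 2 : ℝ) := by
    rw [← integral_biUnion_finset R (fun a _ => hms a) _ hint]
    · rw [← integral_indicator (isOpen_tube q ε).measurableSet,
        ← integral_indicator (Finset.measurableSet_biUnion R fun a _ => hms a)]
      congr 1
      ext t
      by_cases ht : ‖q.eval t‖ < ε
      swap
      · simp [ht]
      by_cases htB : t ∈ B
      · have : t ∈ ⋃ a ∈ R, Metric.ball a ρ ∩ {t | ‖q.eval t‖ < ε} := by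
          simp only [hB, Set.mem_iUnion] at htB ⊢
          obtain ⟨a, ha, hta⟩ := htB
          exact ⟨a, ha, hta, ht⟩
        rw [Set.indicator_of_mem this, Set.indicator_of_mem (by exact ht)]
      · have hht : h t = 0 := by
          by_contra hne
          have := hq₁ t ⟨subset_tsupport h hne, htB⟩
          linarith [hε'.2]
        simp [Set.indicator_apply, hht]
    · intro a ha b hb hab
      refine (Metric.ball_disjoint_ball (hρdis a ha b hb hab)).mono ?_ ?_ <;>
        exact Set.inter_subset_left
  rw [dist_eq_norm, tube, hsum, Finset.mul_sum, ← Finset.sum_sub_distrib]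
  calc ‖∑ a ∈ R, _‖ ≤ ∑ a ∈ R, δ' := norm_sum_le_of_le _ hε
    _ = R.card * δ' := by simp
    _ < δ := by
      rw [hδ', mul_div_assoc', div_lt_iff₀ (by positivity)]
      nlinarith

/-! ### Restriction to lines -/

/-- The restriction `t ↦ Q (w + t u)` of a polynomial to a line. -/
def line {n : ℕ} (Q : MvPolynomial (Fin (n + 2)) ℂ) (w u : Coord n) : Polynomial ℂ :=
  MvPolynomial.aeval (fun i => Polynomial.C (w i) + Polynomial.X * Polynomial.C (u i)) Q

lemma eval_line {n : ℕ} (Q : MvPolynomial (Fin (n + 2)) ℂ) (w u : Coord n) (t : ℂ) :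
    (line Q w u).eval t = MvPolynomial.eval (w + t • u) Q := by
  induction Q using MvPolynomial.induction_on with
  | C a => simp [line]
  | add p q hp hq => simp_all [line]
  | mul_X p i hp =>
    simp only [line, map_mul, Polynomial.eval_mul] at hp ⊢
    rw [hp]
    simp [mul_comm t]

lemma line_mul {n : ℕ} (P Q : MvPolynomial (Fin (n + 2)) ℂ) (w u : Coord n) :
    line (P * Q) w u = line P w u * line Q w u := by simp [line]

/-- The differential of a polynomial. -/
def grad {n : ℕ} (Q : MvPolynomial (Fin (n + 2)) ℂ) (w : Coord n) : Coord n →ₗ[ℂ] ℂ :=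
  ∑ i, partialAt Q i w • LinearMap.proj i

lemma grad_apply {n : ℕ} (Q : MvPolynomial (Fin (n + 2)) ℂ) (w u : Coord n) :
    grad Q w u = ∑ i, partialAt Q i w * u i := by simp [grad]

lemma grad_single {n : ℕ} (Q : MvPolynomial (Fin (n + 2)) ℂ) (w : Coord n) (i : Fin (n + 2)) :
    grad Q w (Pi.single i 1) = partialAt Q i w := by
  simp [grad_apply, Pi.single_apply]

lemma eval_derivative_line {n : ℕ} (Q : MvPolynomial (Fin (n + 2)) ℂ) (w u : Coord n) (t : ℂ) :
    (line Q w u).derivative.eval t = grad Q (w + t • u) u := by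
  rw [grad_apply]
  induction Q using MvPolynomial.induction_on with
  | C a => simp [line, partialAt]
  | add p q hp hq =>
    have : line (p + q) w u = line p w u + line q w u := by simp [line]
    rw [this, Polynomial.derivative_add, Polynomial.eval_add, hp, hq, ← Finset.sum_add_distrib]
    exact Finset.sum_congr rfl fun i _ => by simp [partialAt, add_mul]
  | mul_X p i hp =>
    rw [line_mul, Polynomial.derivative_mul, Polynomial.eval_add, Polynomial.eval_mul, hp,
      Polynomial.eval_mul, eval_line, eval_line, Finset.sum_mul]
    have h1 : (Polynomial.derivative (line (MvPolynomial.X i) w u)).eval t = u i := by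
      simp [line]
    have h2 : ∀ j, partialAt (p * MvPolynomial.X i) j (w + t • u) * u j =
        partialAt p j (w + t • u) * u j * (w + t • u) i +
          MvPolynomial.eval (w + t • u) p * (Pi.single i (u i) : Coord n) j := by
      intro j
      rcases eq_or_ne j i with rfl | hji
      · simp only [partialAt, Derivation.leibniz, MvPolynomial.pderiv_X_self]
        simp
        ring
      · simp only [partialAt, Derivation.leibniz, MvPolynomial.pderiv_X_of_ne hji.symm]
        simp [hji]
        ring
    rw [h1, Finset.sum_congr rfl fun j _ => h2 j, Finset.sum_add_distrib, ← Finset.mul_sum]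
    simp

lemma natDegree_line_le {n : ℕ} (Q : MvPolynomial (Fin (n + 2)) ℂ) (w u : Coord n) :
    (line Q w u).natDegree ≤ Q.totalDegree := by
  rw [line, MvPolynomial.aeval_def, MvPolynomial.eval₂_eq']
  refine Polynomial.natDegree_sum_le_of_forall_le _ _ fun m hm => ?_
  refine (Polynomial.natDegree_C_mul_le _ _).trans ?_
  refine (Polynomial.natDegree_prod_le _ _).trans ?_
  have h1 : ∀ i, ((Polynomial.C (w i) + Polynomial.X * Polynomial.C (u i)) ^ m i).natDegree ≤
      m i := by
    intro i
    refine Polynomial.natDegree_pow_le.trans ?_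
    have : (Polynomial.C (w i) + Polynomial.X * Polynomial.C (u i)).natDegree ≤ 1 := by
      compute_degree
    nlinarith
  refine (Finset.sum_le_sum fun i _ => h1 i).trans ?_
  have := MvPolynomial.le_totalDegree hm
  rwa [Finsupp.sum_fintype _ _ (fun _ => rfl)] at this

/-- Almost every line in the direction `u` meets `{Q = 0}` transversally. -/
def SimpleAlong {n : ℕ} (Q : MvPolynomial (Fin (n + 2)) ℂ) (u : Coord n) : Prop :=
  ∀ᵐ w : Coord n, line Q w u ≠ 0 ∧
    ∀ t, (line Q w u).eval t = 0 → (line Q w u).derivative.eval t ≠ 0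

lemma measurePreserving_shear {n : ℕ} (u : Coord n) :
    MeasurePreserving (fun p : ℂ × Coord n => (p.1, p.2 + p.1 • u)) := by
  refine MeasurePreserving.skew_product (g := fun (t : ℂ) (w : Coord n) => w + t • u)
    (MeasurePreserving.id volume) ?_ ?_
  · fun_prop
  · exact Eventually.of_forall fun t => (measurePreserving_add_right volume (t • u)).map_eq

lemma integrable_shear {n : ℕ} {k : ℂ → ℂ} (hk : Integrable k) {F : Coord n → ℂ}
    (hF : Integrable F) (u : Coord n) :
    Integrable (fun p : ℂ × Coord n => k p.1 * F (p.2 + p.1 • u)) :=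
  (measurePreserving_shear u).integrable_comp_of_integrable (hk.mul_prod hF)

/-- Lebesgue measure is invariant under translation by `t u`, so weighting the lines by `k`
disintegrates it along `u` without a choice of complement. The direction `u = 0` is allowed, and it
occurs among the `polDir r`. -/
lemma integral_shear {n : ℕ} {k : ℂ → ℂ} (hk : Integrable k) {F : Coord n → ℂ}
    (hF : Integrable F) (u : Coord n) :
    ∫ w, ∫ t, k t * F (w + t • u) = (∫ t, k t) * ∫ w, F w := by
  rw [← integral_integral_swap (integrable_shear hk hF u)]
  simp_rw [integral_const_mul, integral_add_right_eq_self (μ := (volume : Measure (Coord n)))]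
  rw [integral_mul_const]

/-! ### Homogeneous polynomials -/

/-- The substitution `X_i ↦ T X_i`. -/
def dilate {n : ℕ} :
    MvPolynomial (Fin (n + 2)) ℂ →ₐ[ℂ] Polynomial (MvPolynomial (Fin (n + 2)) ℂ) :=
  MvPolynomial.aeval fun i => Polynomial.X * Polynomial.C (MvPolynomial.X i)

lemma dilate_monomial {n : ℕ} (m : Fin (n + 2) →₀ ℕ) (a : ℂ) :
    dilate (MvPolynomial.monomial m a) =
      Polynomial.monomial m.degree (MvPolynomial.monomial m a) := by
  rw [dilate, MvPolynomial.aeval_monomial, Finsupp.prod_fintype _ _ (fun _ => pow_zero _)]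
  simp_rw [mul_pow]
  rw [Finset.prod_mul_distrib, Finset.prod_pow_eq_pow_sum, ← Finsupp.degree_eq_sum,
    ← Polynomial.C_mul_X_pow_eq_monomial, MvPolynomial.monomial_eq,
    Finsupp.prod_fintype _ _ (fun _ => pow_zero _)]
  simp only [map_mul, map_prod, map_pow]
  rw [show algebraMap ℂ (Polynomial (MvPolynomial (Fin (n + 2)) ℂ)) a =
    Polynomial.C (MvPolynomial.C a) from rfl]
  ring

lemma coeff_dilate {n : ℕ} (Q : MvPolynomial (Fin (n + 2)) ℂ) (k : ℕ) :
    (dilate Q).coeff k = MvPolynomial.homogeneousComponent k Q := by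
  induction Q using MvPolynomial.induction_on' with
  | monomial m a =>
    rw [dilate_monomial, Polynomial.coeff_monomial]
    split_ifs with h
    · exact (MvPolynomial.homogeneousComponent_of_mem
        (MvPolynomial.isHomogeneous_monomial a h)).symm ▸ by simp
    · rw [MvPolynomial.homogeneousComponent_of_mem (MvPolynomial.isHomogeneous_monomial a rfl),
        if_neg (Ne.symm h)]
  | add p q hp hq => simp [hp, hq]

lemma dilate_of_isHomogeneous {n N : ℕ} {P : MvPolynomial (Fin (n + 2)) ℂ}
    (hP : P.IsHomogeneous N) : dilate P = Polynomial.monomial N P := by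
  ext1 k
  rw [coeff_dilate, Polynomial.coeff_monomial, MvPolynomial.homogeneousComponent_of_mem hP]
  simp [eq_comm]

/-- Divisors of homogeneous polynomials are homogeneous. -/
lemma isHomogeneous_of_dvd {n N : ℕ} {P Q : MvPolynomial (Fin (n + 2)) ℂ}
    (hP : P.IsHomogeneous N) (hP0 : P ≠ 0) (hQ : Q ∣ P) : ∃ d, Q.IsHomogeneous d := by
  obtain ⟨R, rfl⟩ := hQ
  have h1 : dilate Q * dilate R = Polynomial.monomial N (Q * R) := by
    rw [← map_mul, dilate_of_isHomogeneous hP]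
  have h0 : dilate Q * dilate R ≠ 0 := by
    rw [h1]; simpa using hP0
  have hQ0 := left_ne_zero_of_mul h0
  have hR0 := right_ne_zero_of_mul h0
  -- Highest and lowest degree in the dilation variable are both additive over a domain. They agree
  -- for the product, hence for each factor.
  have hd := Polynomial.natDegree_mul hQ0 hR0
  have ht := Polynomial.natTrailingDegree_mul hQ0 hR0
  rw [h1, Polynomial.natDegree_monomial_eq _ hP0] at hd
  rw [h1, Polynomial.natTrailingDegree_monomial hP0] at ht
  have hQt := Polynomial.natTrailingDegree_le_natDegree (dilate Q)
  have hRt := Polynomial.natTrailingDegree_le_natDegree (dilate R)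
  have heq : (dilate Q).natTrailingDegree = (dilate Q).natDegree := by omega
  have hz : ∀ k, k ≠ (dilate Q).natDegree → MvPolynomial.homogeneousComponent k Q = 0 := by
    intro k hk
    rw [← coeff_dilate]
    rcases lt_or_gt_of_ne hk with h | h
    · exact Polynomial.coeff_eq_zero_of_lt_natTrailingDegree (heq ▸ h)
    · exact Polynomial.coeff_eq_zero_of_natDegree_lt h
  generalize (dilate Q).natDegree = d at hz
  refine ⟨d, ?_⟩
  rw [← MvPolynomial.sum_homogeneousComponent Q]
  refine MvPolynomial.IsHomogeneous.sum _ _ _ fun k _ => ?_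
  by_cases hk : k = d
  · rw [hk]; exact MvPolynomial.homogeneousComponent_isHomogeneous _ _
  · rw [hz k hk]; exact MvPolynomial.isHomogeneous_zero _ _ _

lemma eval_smul_of_isHomogeneous {n d : ℕ} {Q : MvPolynomial (Fin (n + 2)) ℂ}
    (hQ : Q.IsHomogeneous d) (c : ℂ) (w : Coord n) :
    MvPolynomial.eval (c • w) Q = c ^ d * MvPolynomial.eval w Q := by
  rw [MvPolynomial.eval_eq', MvPolynomial.eval_eq', Finset.mul_sum]
  refine Finset.sum_congr rfl fun m hm => ?_
  have hd : m.degree = d := by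
    by_contra h
    exact MvPolynomial.mem_support_iff.mp hm (hQ.coeff_eq_zero h)
  simp only [Pi.smul_apply, smul_eq_mul, mul_pow]
  rw [Finset.prod_mul_distrib, Finset.prod_pow_eq_pow_sum, ← Finsupp.degree_eq_sum, hd]
  ring

lemma partialAt_smul {n d : ℕ} {Q : MvPolynomial (Fin (n + 2)) ℂ}
    (hQ : Q.IsHomogeneous d) (i : Fin (n + 2)) (c : ℂ) (w : Coord n) :
    partialAt Q i (c • w) = c ^ (d - 1) * partialAt Q i w :=
  eval_smul_of_isHomogeneous hQ.pderiv c w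

lemma grad_self {n d : ℕ} {Q : MvPolynomial (Fin (n + 2)) ℂ}
    (hQ : Q.IsHomogeneous d) (w : Coord n) :
    grad Q w w = d * MvPolynomial.eval w Q := by
  have := congrArg (MvPolynomial.eval w) hQ.sum_X_mul_pderiv
  simp only [map_sum, map_mul, MvPolynomial.eval_X, nsmul_eq_mul, map_natCast] at this
  rw [grad_apply, ← this]
  exact Finset.sum_congr rfl fun i _ => mul_comm _ _

/-! ### Integration over hypersurfaces by slicing -/

/-- A smooth bump function of integral one. -/
def kappa : ℂ → ℝ := (default : ContDiffBump (0 : ℂ)).normed volume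

lemma continuous_kappa : Continuous kappa := ContDiffBump.continuous_normed _

lemma hasCompactSupport_kappa : HasCompactSupport kappa := ContDiffBump.hasCompactSupport_normed _

lemma integral_kappa : ∫ t, kappa t = 1 := ContDiffBump.integral_normed _

lemma integrable_kappa : Integrable (fun t => (kappa t : ℂ)) :=
  (continuous_kappa.integrable_of_hasCompactSupport hasCompactSupport_kappa).ofReal

lemma exists_norm_kappa_le : ∃ C, 0 < C ∧ ∀ t, ‖(kappa t : ℂ)‖ ≤ C := by
  obtain ⟨C, hC⟩ := hasCompactSupport_kappa.exists_bound_of_continuous continuous_kappa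
  refine ⟨max C 1, by positivity, fun t => ?_⟩
  rw [Complex.norm_real]
  exact (hC t).trans (le_max_left _ _)

/-- The integrand of `nu`. -/
def nuInt {n : ℕ} (Q : MvPolynomial (Fin (n + 2)) ℂ) (u : Coord n) (G : Coord n → ℂ)
    (w : Coord n) : ℂ :=
  rootSum (line Q w u) (fun t => kappa t * G (w + t • u))

/-- The integral of `G` over `{Q = 0}` with respect to the Lebesgue measure of the quotient by
the direction `u`. -/
def nu {n : ℕ} (Q : MvPolynomial (Fin (n + 2)) ℂ) (u : Coord n) (G : Coord n → ℂ) : ℂ :=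
  ∫ w, nuInt Q u G w

/-- The `w` for which the line `w + ℂ u` can meet `K` at a parameter in the support of `kappa`. -/
def shadow {n : ℕ} (u : Coord n) (K : Set (Coord n)) : Set (Coord n) :=
  (fun p : Coord n × ℂ => p.1 - p.2 • u) '' (K ×ˢ tsupport kappa)

lemma isCompact_shadow {n : ℕ} (u : Coord n) {K : Set (Coord n)} (hK : IsCompact K) :
    IsCompact (shadow u K) :=
  (hK.prod hasCompactSupport_kappa.isCompact).image (by fun_prop)

lemma kappa_mul_eq_zero {n : ℕ} {u : Coord n} {K : Set (Coord n)} {G : Coord n → ℂ}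
    (hG : ∀ w ∉ K, G w = 0) {w : Coord n} (hw : w ∉ shadow u K) (t : ℂ) :
    (kappa t : ℂ) * G (w + t • u) = 0 := by
  by_contra h
  refine hw ⟨(w + t • u, t), ⟨?_, ?_⟩, by simp⟩
  · by_contra h1
    exact h (by simp [hG _ h1])
  · refine subset_tsupport _ fun h1 => h ?_
    simp [h1]

/-- There are at most `Q.totalDegree` roots, and none contributes when the line misses `K` at
parameters in the support of `kappa`. The bound on `G` is asked only on `{Q = 0}`, since roots lie
there; this matters for quotients by `weightDen`. -/
lemma norm_nuInt_le {n : ℕ} (Q : MvPolynomial (Fin (n + 2)) ℂ) {u : Coord n} {K : Set (Coord n)}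
    {G : Coord n → ℂ} {C C' : ℝ} (hC0 : 0 ≤ C)
    (hC : ∀ w, MvPolynomial.eval w Q = 0 → ‖G w‖ ≤ K.indicator (fun _ => C) w)
    (hC' : ∀ t, ‖(kappa t : ℂ)‖ ≤ C') (w : Coord n) :
    ‖nuInt Q u G w‖ ≤ (shadow u K).indicator (fun _ => Q.totalDegree * (C' * C)) w := by
  have hC'0 : 0 ≤ C' := (norm_nonneg _).trans (hC' 0)
  by_cases hw : w ∈ shadow u K
  · rw [Set.indicator_of_mem hw]
    have h1 : ∀ t : ℂ, (line Q w u).eval t = 0 → ‖(kappa t : ℂ) * G (w + t • u)‖ ≤ C' * C := by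
      intro t ht
      rw [norm_mul]
      refine mul_le_mul (hC' t) ((hC _ (eval_line Q w u t ▸ ht)).trans ?_) (norm_nonneg _) hC'0
      exact Set.indicator_le_self' (fun _ _ => hC0) _
    refine (norm_rootSum_le _ _ (by positivity) h1).trans ?_
    have : ((line Q w u).natDegree : ℝ) ≤ Q.totalDegree := by exact_mod_cast natDegree_line_le Q w u
    gcongr
  · rw [Set.indicator_of_notMem hw, nuInt]
    have h1 : ∀ t : ℂ, (line Q w u).eval t = 0 → ‖(kappa t : ℂ) * G (w + t • u)‖ ≤ 0 := by
      intro t ht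
      by_cases hk : w + t • u ∈ K
      · by_cases hkt : t ∈ tsupport kappa
        · exact absurd ⟨(w + t • u, t), ⟨hk, hkt⟩, by simp⟩ hw
        · simp [image_eq_zero_of_notMem_tsupport hkt]
      · have := hC _ (eval_line Q w u t ▸ ht)
        rw [Set.indicator_of_notMem hk] at this
        rw [norm_le_zero_iff.mp this]
        simp
    simpa using norm_rootSum_le _ _ le_rfl h1

lemma integrable_indicator_shadow {n : ℕ} (u : Coord n) {K : Set (Coord n)} (hK : IsCompact K)
    (c : ℝ) : Integrable ((shadow u K).indicator fun _ => c) :=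
  (integrable_indicator_iff (isCompact_shadow u hK).measurableSet).mpr
    (integrableOn_const (isCompact_shadow u hK).measure_ne_top)

/-- The average of `g` over the tube `|Q| < ε`. -/
def tubeAvg {n : ℕ} (Q : MvPolynomial (Fin (n + 2)) ℂ) (g : Coord n → ℂ) (ε : ℝ) : ℂ :=
  (Real.pi * ε ^ 2 : ℝ)⁻¹ * ∫ w in {w | ‖MvPolynomial.eval w Q‖ < ε}, g w

lemma measurableSet_tube {n : ℕ} (Q : MvPolynomial (Fin (n + 2)) ℂ) (ε : ℝ) :
    MeasurableSet {w : Coord n | ‖MvPolynomial.eval w Q‖ < ε} :=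
  (isOpen_lt (MvPolynomial.continuous_eval Q).norm continuous_const).measurableSet

lemma continuous_grad {n : ℕ} (Q : MvPolynomial (Fin (n + 2)) ℂ) (u : Coord n) :
    Continuous fun w => grad Q w u := by
  simp_rw [grad_apply]
  refine continuous_finsetSum _ fun i _ => Continuous.mul ?_ continuous_const
  exact MvPolynomial.continuous_eval _

lemma integrable_tube_slice {n : ℕ} (Q : MvPolynomial (Fin (n + 2)) ℂ) (u : Coord n)
    {G : Coord n → ℂ} (hG : Continuous G) (hGc : HasCompactSupport G) (ε : ℝ) :
    Integrable ({w : Coord n | ‖MvPolynomial.eval w Q‖ < ε}.indicator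
      fun w => G w * (‖grad Q w u‖ ^ 2 : ℝ)) := by
  refine Integrable.indicator ?_ (measurableSet_tube Q ε)
  have h1 := continuous_grad Q u
  exact Continuous.integrable_of_hasCompactSupport (by fun_prop) hGc.mul_right

lemma tube_line_eq {n : ℕ} (Q : MvPolynomial (Fin (n + 2)) ℂ) (u : Coord n)
    (G : Coord n → ℂ) (ε : ℝ) (w : Coord n) :
    tube (line Q w u) (fun t => kappa t * G (w + t • u)) ε = (Real.pi * ε ^ 2 : ℝ)⁻¹ *
      ∫ t, kappa t * {w : Coord n | ‖MvPolynomial.eval w Q‖ < ε}.indicator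
        (fun w => G w * (‖grad Q w u‖ ^ 2 : ℝ)) (w + t • u) := by
  rw [tube, ← integral_indicator (isOpen_tube _ ε).measurableSet]
  congr 2
  ext t
  simp only [Set.indicator_apply, Set.mem_ofPred_eq, eval_line, eval_derivative_line]
  split_ifs
  · ring
  · simp

/-- Fubini along `u`: on a line, `|dQ(u)|²` is the Jacobian `|q'|²` of the restricted polynomial, so
the tube average in `ℂ^{n+2}` is an integral of one-variable tube averages. -/
lemma tubeAvg_eq_integral {n : ℕ} (Q : MvPolynomial (Fin (n + 2)) ℂ) (u : Coord n)
    {G : Coord n → ℂ} (hG : Continuous G) (hGc : HasCompactSupport G) (ε : ℝ) :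
    tubeAvg Q (fun w => G w * (‖grad Q w u‖ ^ 2 : ℝ)) ε =
      ∫ w, tube (line Q w u) (fun t => kappa t * G (w + t • u)) ε := by
  simp_rw [tube_line_eq]
  rw [integral_const_mul, integral_shear integrable_kappa (integrable_tube_slice Q u hG hGc ε),
    integral_complex_ofReal, integral_kappa, tubeAvg,
    integral_indicator (measurableSet_tube Q ε)]
  simp

lemma aestronglyMeasurable_tube {n : ℕ} (Q : MvPolynomial (Fin (n + 2)) ℂ) (u : Coord n)
    {G : Coord n → ℂ} (hG : Continuous G) (hGc : HasCompactSupport G) (ε : ℝ) :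
    AEStronglyMeasurable
      (fun w => tube (line Q w u) (fun t => kappa t * G (w + t • u)) ε) volume := by
  simp_rw [tube_line_eq]
  have := (integrable_shear integrable_kappa (integrable_tube_slice Q u hG hGc ε) u).swap
  exact this.integral_prod_left.aestronglyMeasurable.const_mul _

lemma tendsto_tube_line {n : ℕ} {Q : MvPolynomial (Fin (n + 2)) ℂ} {u : Coord n}
    (hs : SimpleAlong Q u) {G : Coord n → ℂ} (hG : Continuous G) :
    ∀ᵐ w, Tendsto (fun ε => tube (line Q w u) (fun t => kappa t * G (w + t • u)) ε) (𝓝[>] 0)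
      (𝓝 (nuInt Q u G w)) := by
  filter_upwards [hs] with w hw
  refine tendsto_tube hw.1 hw.2 ?_ ?_
  · have := continuous_kappa
    fun_prop
  · exact (hasCompactSupport_kappa.comp_left (g := fun x : ℝ => (x : ℂ)) (by simp)).mul_right

/-- Measurability of a sum over roots is not visible from its definition; it is inherited from the
tube averages, which converge to it almost everywhere. -/
lemma aestronglyMeasurable_nuInt {n : ℕ} {Q : MvPolynomial (Fin (n + 2)) ℂ} {u : Coord n}
    (hs : SimpleAlong Q u) {G : Coord n → ℂ} (hG : Continuous G) (hGc : HasCompactSupport G) :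
    AEStronglyMeasurable (nuInt Q u G) volume :=
  aestronglyMeasurable_of_tendsto_ae (𝓝[>] (0 : ℝ))
    (fun ε => aestronglyMeasurable_tube Q u hG hGc ε) (tendsto_tube_line hs hG)

lemma integrable_nuInt {n : ℕ} {Q : MvPolynomial (Fin (n + 2)) ℂ} {u : Coord n}
    (hs : SimpleAlong Q u) {G : Coord n → ℂ} (hG : Continuous G) (hGc : HasCompactSupport G) :
    Integrable (nuInt Q u G) := by
  obtain ⟨C, hC⟩ := hGc.exists_bound_of_continuous hG
  obtain ⟨C', -, hC'⟩ := exists_norm_kappa_le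
  exact (integrable_indicator_shadow u hGc.isCompact _).mono'
    (aestronglyMeasurable_nuInt hs hG hGc) (Eventually.of_forall
      (norm_nuInt_le Q ((norm_nonneg _).trans (hC 0)) (fun w _ => by
        by_cases hw : w ∈ tsupport G
        · rw [Set.indicator_of_mem hw]; exact hC w
        · rw [Set.indicator_of_notMem hw, image_eq_zero_of_notMem_tsupport hw, norm_zero]) hC'))

/-- Tube averages of `G |dQ(u)|²` converge to the slicing integral in the direction `u`. -/
lemma tendsto_tubeAvg {n : ℕ} {Q : MvPolynomial (Fin (n + 2)) ℂ} {u : Coord n}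
    (hs : SimpleAlong Q u) {G : Coord n → ℂ} (hG : Continuous G) (hGc : HasCompactSupport G) :
    Tendsto (tubeAvg Q (fun w => G w * (‖grad Q w u‖ ^ 2 : ℝ))) (𝓝[>] 0) (𝓝 (nu Q u G)) := by
  obtain ⟨C, hC⟩ := hGc.exists_bound_of_continuous hG
  obtain ⟨C', hC'0, hC'⟩ := exists_norm_kappa_le
  have hG0 : ∀ w ∉ tsupport G, G w = 0 := fun w hw => image_eq_zero_of_notMem_tsupport hw
  have h1 : tubeAvg Q (fun w => G w * (‖grad Q w u‖ ^ 2 : ℝ)) =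
      fun ε => ∫ w, tube (line Q w u) (fun t => kappa t * G (w + t • u)) ε :=
    funext fun ε => tubeAvg_eq_integral Q u hG hGc ε
  rw [h1]
  refine tendsto_integral_filter_of_dominated_convergence
    ((shadow u (tsupport G)).indicator fun _ => Q.totalDegree * (C' * C))
    (Eventually.of_forall fun ε => aestronglyMeasurable_tube Q u hG hGc ε) ?_
    (integrable_indicator_shadow u hGc.isCompact _) (tendsto_tube_line hs hG)
  filter_upwards [self_mem_nhdsWithin] with ε hε
  refine Eventually.of_forall fun w => ?_
  by_cases hw : w ∈ shadow u (tsupport G)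
  · rw [Set.indicator_of_mem hw]
    have h1 : ∀ t : ℂ, ‖(kappa t : ℂ) * G (w + t • u)‖ ≤ C' * C := fun t => by
      rw [norm_mul]
      exact mul_le_mul (hC' t) (hC _) (norm_nonneg _) hC'0.le
    refine (norm_tube_le _ _ hε h1).trans ?_
    have : ((line Q w u).natDegree : ℝ) ≤ Q.totalDegree := by exact_mod_cast natDegree_line_le Q w u
    have h2 : 0 ≤ C' * C := (norm_nonneg _).trans (h1 0)
    gcongr
  · rw [Set.indicator_of_notMem hw]
    simp [tube, kappa_mul_eq_zero hG0 hw]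

/-- Dominated convergence for slicing integrals. -/
lemma tendsto_nu_of_dominated {n : ℕ} {Q : MvPolynomial (Fin (n + 2)) ℂ} {u : Coord n}
    {G : ℝ → Coord n → ℂ} {G₀ : Coord n → ℂ} {K : Set (Coord n)} (hK : IsCompact K)
    (hm : ∀ δ > 0, AEStronglyMeasurable (nuInt Q u (G δ)) volume)
    {C : ℝ} (hC0 : 0 ≤ C) (hb : ∀ δ > 0, ∀ w, MvPolynomial.eval w Q = 0 →
      ‖G δ w‖ ≤ K.indicator (fun _ => C) w)
    (hl : ∀ᵐ w, ∀ t, (line Q w u).eval t = 0 →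
      Tendsto (fun δ => G δ (w + t • u)) (𝓝[>] 0) (𝓝 (G₀ (w + t • u)))) :
    Tendsto (fun δ => nu Q u (G δ)) (𝓝[>] 0) (𝓝 (nu Q u G₀)) ∧
      Integrable (nuInt Q u G₀) := by
  obtain ⟨C', hC'0, hC'⟩ := exists_norm_kappa_le
  have hlim : ∀ᵐ w, Tendsto (fun δ => nuInt Q u (G δ) w) (𝓝[>] 0) (𝓝 (nuInt Q u G₀ w)) := by
    filter_upwards [hl] with w hw
    exact tendsto_multiset_sum _ fun t ht =>
      (hw t (Polynomial.isRoot_of_mem_roots ht)).const_mul _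
  have hint := integrable_indicator_shadow u hK (Q.totalDegree * (C' * C))
  refine ⟨tendsto_integral_filter_of_dominated_convergence _
    (eventually_nhdsWithin_of_forall hm) (eventually_nhdsWithin_of_forall fun δ hδ =>
      Eventually.of_forall (norm_nuInt_le Q hC0 (hb δ hδ) hC')) hint hlim, ?_⟩
  have hseq : Tendsto (fun k : ℕ => 1 / ((k : ℝ) + 1)) atTop (𝓝[>] 0) :=
    tendsto_nhdsWithin_iff.mpr ⟨tendsto_one_div_add_atTop_nhds_zero_nat,
      Eventually.of_forall fun k => Set.mem_Ioi.mpr Nat.one_div_pos_of_nat⟩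
  refine hint.mono' (aestronglyMeasurable_of_tendsto_ae atTop
    (fun k : ℕ => hm (1 / ((k : ℝ) + 1)) Nat.one_div_pos_of_nat)
    (hlim.mono fun w hw => hw.comp hseq)) ?_
  filter_upwards [hlim] with w hw
  exact le_of_tendsto hw.norm (eventually_nhdsWithin_of_forall fun δ hδ =>
    norm_nuInt_le Q hC0 (hb δ hδ) hC' w)

/-! ### A radial cutoff -/

/-- A tent supported in `[1, 4]`. -/
def tent (x : ℝ) : ℝ := max 0 (min (x - 1) (4 - x))

lemma continuous_tent : Continuous tent := by unfold tent; fun_prop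

lemma tent_nonneg (x : ℝ) : 0 ≤ tent x := le_max_left _ _

lemma tent_of_le {x : ℝ} (hx : x ≤ 1) : tent x = 0 :=
  max_eq_left ((min_le_left _ _).trans (by linarith))

lemma tent_of_ge {x : ℝ} (hx : 4 ≤ x) : tent x = 0 :=
  max_eq_left ((min_le_right _ _).trans (by linarith))

lemma hasCompactSupport_tent_norm : HasCompactSupport fun c : ℂ => tent (‖c‖ ^ 2) := by
  refine HasCompactSupport.intro (isCompact_closedBall (0 : ℂ) 2) fun c hc => tent_of_ge ?_
  have : 2 < ‖c‖ := by simpa using hc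
  nlinarith

lemma integral_tent_pos : 0 < ∫ c : ℂ, tent (‖c‖ ^ 2) := by
  refine Continuous.integral_pos_of_hasCompactSupport_nonneg_nonzero (x := ((2 : ℝ).sqrt : ℂ))
    (continuous_tent.comp (by fun_prop)) hasCompactSupport_tent_norm (fun c => tent_nonneg _) ?_
  have : ‖((2 : ℝ).sqrt : ℂ)‖ ^ 2 = 2 := by
    rw [Complex.norm_real, Real.norm_of_nonneg (Real.sqrt_nonneg _), Real.sq_sqrt (by norm_num)]
  rw [this, tent]
  norm_num

/-- A radial cutoff function on `ℂ^{n+2}`, normalized on each complex line through the origin. -/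
def eta {n : ℕ} (w : Coord n) : ℝ := nsq w * tent (nsq w) / ∫ c : ℂ, tent (‖c‖ ^ 2)

lemma continuous_eta {n : ℕ} : Continuous (eta (n := n)) := by
  have := continuous_nsq (n := n)
  have := continuous_tent
  unfold eta
  fun_prop

lemma norm_le_of_nsq {n : ℕ} (w : Coord n) : ‖w‖ ^ 2 ≤ nsq w := by
  have h : ∀ i, ‖w i‖ ≤ Real.sqrt (nsq w) := fun i => by
    refine Real.le_sqrt_of_sq_le ?_
    exact Finset.single_le_sum (f := fun i => ‖w i‖ ^ 2) (fun _ _ => by positivity)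
      (Finset.mem_univ i)
  have h2 : ‖w‖ ≤ Real.sqrt (nsq w) := (pi_norm_le_iff_of_nonneg (Real.sqrt_nonneg _)).mpr h
  have h3 : 0 ≤ nsq w := Finset.sum_nonneg fun _ _ => by positivity
  calc ‖w‖ ^ 2 ≤ Real.sqrt (nsq w) ^ 2 := by gcongr
    _ = nsq w := Real.sq_sqrt h3

lemma eta_eq_zero_of_lt {n : ℕ} {w : Coord n} (hw : nsq w ≤ 1) : eta w = 0 := by
  simp [eta, tent_of_le hw]

lemma eta_eq_zero_of_notMem {n : ℕ} {w : Coord n} (hw : w ∉ Metric.closedBall (0 : Coord n) 2) :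
    eta w = 0 := by
  have h1 : 2 < ‖w‖ := by simpa using hw
  have h2 := norm_le_of_nsq w
  simp [eta, tent_of_ge (x := nsq w) (by nlinarith)]

lemma continuous_eta_mul {n : ℕ} {f : Coord n → ℂ} (hf : ContinuousOn f {0}ᶜ) :
    Continuous fun w => (eta w : ℂ) * f w := by
  rw [continuous_iff_continuousAt]
  intro w
  by_cases hw : w = 0
  · have h0 : {w : Coord n | nsq w < 1} ∈ 𝓝 w :=
      (isOpen_lt continuous_nsq continuous_const).mem_nhds (by simp [hw, nsq])
    refine (continuousAt_const (y := (0 : ℂ))).congr ?_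
    filter_upwards [h0] with w' hw'
    rw [eta_eq_zero_of_lt (le_of_lt hw')]
    simp
  · have h1 : ContinuousAt f w := hf.continuousAt (isOpen_compl_singleton.mem_nhds hw)
    exact (Complex.continuous_ofReal.comp continuous_eta).continuousAt.mul h1

lemma hasCompactSupport_eta_mul {n : ℕ} (f : Coord n → ℂ) :
    HasCompactSupport fun w => (eta w : ℂ) * f w :=
  HasCompactSupport.intro (isCompact_closedBall (0 : Coord n) 2) fun w hw => by
    simp [eta_eq_zero_of_notMem hw]

lemma eta_smul {n : ℕ} (c : ℂ) (w : Coord n) :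
    eta (c • w) = ‖c‖ ^ 2 * (nsq w * tent (‖Real.sqrt (nsq w) • c‖ ^ 2) /
      ∫ c : ℂ, tent (‖c‖ ^ 2)) := by
  have h3 : 0 ≤ nsq w := Finset.sum_nonneg fun _ _ => by positivity
  rw [eta, nsq_smul, norm_smul, mul_pow, Real.norm_of_nonneg (Real.sqrt_nonneg _),
    Real.sq_sqrt h3, mul_comm (nsq w) (‖c‖ ^ 2)]
  ring

/-- Rescaling `c` by `|w|` makes the integral independent of `w`; the factor `nsq w` in `eta`
cancels the area factor of this substitution. The weight `|c|⁻²` is what remains of the cone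
Jacobian after the scaling of `polCoeff` and `fsDensity`. -/
lemma integral_eta_smul {n : ℕ} {w : Coord n} (hw : w ≠ 0) :
    ∫ c : ℂ, (‖c‖ ^ 2)⁻¹ * eta (c • w) = 1 := by
  have h1 : ∀ᵐ c : ℂ, (‖c‖ ^ 2)⁻¹ * eta (c • w) =
      (nsq w / ∫ c : ℂ, tent (‖c‖ ^ 2)) * tent (‖Real.sqrt (nsq w) • c‖ ^ 2) := by
    have : ∀ᵐ c : ℂ, c ≠ 0 := by
      simp [ae_iff, measure_singleton]
    filter_upwards [this] with c hc
    rw [eta_smul]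
    have : ‖c‖ ≠ 0 := by simpa using hc
    field_simp
  have hN := nsq_pos hw
  rw [integral_congr_ae h1, integral_const_mul,
    Measure.integral_comp_smul volume (fun c : ℂ => tent (‖c‖ ^ 2)), Complex.finrank_real_complex,
    Real.sq_sqrt hN.le, abs_of_pos (by positivity), smul_eq_mul]
  have := integral_tent_pos.ne'
  field_simp

/-! ### The gradient and the weight -/

/-- The denominator of `weight`. -/
def weightDen {n : ℕ} (Q : MvPolynomial (Fin (n + 2)) ℂ) (w : Coord n) : ℝ :=
  ∑ a : Fin (n + 2), ∑ b : Fin (n + 1), ‖w a‖ ^ 2 * ‖partialAt Q (a.succAbove b) w‖ ^ 2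

lemma continuous_partialAt {n : ℕ} (Q : MvPolynomial (Fin (n + 2)) ℂ) (i : Fin (n + 2)) :
    Continuous (partialAt Q i) := MvPolynomial.continuous_eval _

lemma continuous_weightDen {n : ℕ} (Q : MvPolynomial (Fin (n + 2)) ℂ) :
    Continuous (weightDen Q) := by
  have := continuous_partialAt Q
  unfold weightDen
  fun_prop

lemma weightDen_nonneg {n : ℕ} (Q : MvPolynomial (Fin (n + 2)) ℂ) (w : Coord n) :
    0 ≤ weightDen Q w :=
  Finset.sum_nonneg fun _ _ => Finset.sum_nonneg fun _ _ => by positivity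

/-- `|dQ|²`. -/
def gradSq {n : ℕ} (Q : MvPolynomial (Fin (n + 2)) ℂ) (w : Coord n) : ℝ :=
  ∑ i, ‖partialAt Q i w‖ ^ 2

/-- Let `w_a` be the coordinate of largest modulus. On `{Q = 0}` Euler's identity expresses `w_a ∂_a
Q` through the other partial derivatives, so these alone control `dQ`; they occur in `weightDen`
with the factor `|w_a|²`, which is comparable to `|w|²`. -/
lemma nsq_mul_gradSq_le {n d : ℕ} {Q : MvPolynomial (Fin (n + 2)) ℂ} (hQ : Q.IsHomogeneous d)
    {w : Coord n} (hw : MvPolynomial.eval w Q = 0) :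
    nsq w * gradSq Q w ≤ (n + 2) ^ 2 * weightDen Q w := by
  obtain ⟨a, -, ha⟩ := Finset.exists_max_image Finset.univ (fun i => ‖w i‖) ⟨0, Finset.mem_univ _⟩
  set S := ∑ b : Fin (n + 1), ‖partialAt Q (a.succAbove b) w‖ ^ 2 with hS
  have hS0 : 0 ≤ S := Finset.sum_nonneg fun _ _ => by positivity
  have h1 : ‖w a‖ ^ 2 * S ≤ weightDen Q w := by
    rw [hS, Finset.mul_sum, weightDen]
    exact Finset.single_le_sum (f := fun a : Fin (n + 2) => ∑ b : Fin (n + 1),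
      ‖w a‖ ^ 2 * ‖partialAt Q (a.succAbove b) w‖ ^ 2)
      (fun _ _ => Finset.sum_nonneg fun _ _ => by positivity) (Finset.mem_univ a)
  have h2 : nsq w ≤ (n + 2) * ‖w a‖ ^ 2 := by
    have : nsq w ≤ ∑ _i : Fin (n + 2), ‖w a‖ ^ 2 := Finset.sum_le_sum fun i _ => by
      have := ha i (Finset.mem_univ i)
      gcongr
    simpa using this
  by_cases hwa : w a = 0
  · have : nsq w ≤ 0 := by simpa [hwa] using h2
    have h0 : 0 ≤ gradSq Q w := Finset.sum_nonneg fun _ _ => by positivity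
    have := weightDen_nonneg Q w
    calc nsq w * gradSq Q w ≤ 0 := mul_nonpos_of_nonpos_of_nonneg ‹_› h0
      _ ≤ _ := by positivity
  have h3 : ‖partialAt Q a w‖ ^ 2 ≤ (n + 1) * S := by
    have he := grad_self hQ w
    rw [hw, mul_zero, grad_apply, Fin.sum_univ_succAbove _ a] at he
    have h4 : ‖partialAt Q a w‖ * ‖w a‖ ≤
        (∑ b : Fin (n + 1), ‖partialAt Q (a.succAbove b) w‖) * ‖w a‖ := by
      rw [← norm_mul, eq_neg_of_add_eq_zero_left he, norm_neg, Finset.sum_mul]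
      refine norm_sum_le_of_le _ fun b _ => ?_
      rw [norm_mul]
      have := ha (a.succAbove b) (Finset.mem_univ _)
      gcongr
    have h5 := le_of_mul_le_mul_right h4 (norm_pos_iff.mpr hwa)
    have h6 := sq_sum_le_card_mul_sum_sq (s := Finset.univ)
      (f := fun b : Fin (n + 1) => ‖partialAt Q (a.succAbove b) w‖)
    simp only [Finset.card_univ, Fintype.card_fin] at h6
    push_cast at h6
    exact (pow_le_pow_left₀ (norm_nonneg _) h5 2).trans h6
  have h7 : gradSq Q w ≤ (n + 2) * S := by
    rw [gradSq, Fin.sum_univ_succAbove _ a]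
    linarith
  have h8 : 0 ≤ ‖w a‖ ^ 2 := by positivity
  calc nsq w * gradSq Q w ≤ ((n + 2) * ‖w a‖ ^ 2) * ((n + 2) * S) := by
        have : 0 ≤ gradSq Q w := Finset.sum_nonneg fun _ _ => by positivity
        gcongr
    _ = (n + 2) ^ 2 * (‖w a‖ ^ 2 * S) := by ring
    _ ≤ _ := by gcongr

lemma norm_grad_sq_le {n : ℕ} (Q : MvPolynomial (Fin (n + 2)) ℂ) (w u : Coord n) :
    ‖grad Q w u‖ ^ 2 ≤ gradSq Q w * nsq u := by
  rw [grad_apply]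
  have h1 : ‖∑ i, partialAt Q i w * u i‖ ≤ ∑ i, ‖partialAt Q i w‖ * ‖u i‖ :=
    norm_sum_le_of_le _ fun i _ => (norm_mul _ _).le
  calc _ ≤ (∑ i, ‖partialAt Q i w‖ * ‖u i‖) ^ 2 := by gcongr
    _ ≤ _ := Finset.sum_mul_sq_le_sq_mul_sq _ _ _

/-- The cut-off coefficient functions of a form. -/
def formCoeff {n : ℕ} (φ : ContForm n n) (r : PolIdx n) (w : Coord n) : ℂ :=
  eta w * polCoeff (φ.at w) w r

lemma continuous_formCoeff {n : ℕ} (φ : ContForm n n) (r : PolIdx n) :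
    Continuous (formCoeff φ r) := continuous_eta_mul (continuousOn_polCoeff φ r)

lemma hasCompactSupport_formCoeff {n : ℕ} (φ : ContForm n n) (r : PolIdx n) :
    HasCompactSupport (formCoeff φ r) := hasCompactSupport_eta_mul _

lemma formCoeff_eq_zero {n : ℕ} (φ : ContForm n n) (r : PolIdx n) {w : Coord n}
    (hw : w ∉ Metric.closedBall (0 : Coord n) 2) : formCoeff φ r w = 0 := by
  simp [formCoeff, eta_eq_zero_of_notMem hw]

/-- The cut-off density of `(i/2) dQ ∧ dQ̄ ∧ φ`. -/
def gradDensity {n : ℕ} (φ : ContForm n n) (Q : MvPolynomial (Fin (n + 2)) ℂ) (w : Coord n) : ℂ :=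
  ∑ r, (‖grad Q w (polDir r)‖ ^ 2 : ℝ) * formCoeff φ r w

lemma continuous_gradDensity {n : ℕ} (φ : ContForm n n) (Q : MvPolynomial (Fin (n + 2)) ℂ) :
    Continuous (gradDensity φ Q) := by
  have h1 := continuous_formCoeff φ
  have h2 := fun r : PolIdx n => continuous_grad Q (polDir r)
  unfold gradDensity
  fun_prop

lemma gradDensity_eq_zero {n : ℕ} (φ : ContForm n n) (Q : MvPolynomial (Fin (n + 2)) ℂ)
    {w : Coord n} (hw : w ∉ Metric.closedBall (0 : Coord n) 2) : gradDensity φ Q w = 0 := by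
  simp [gradDensity, formCoeff_eq_zero φ _ hw]

lemma gradDensity_eq_eta_mul {n : ℕ} (φ : ContForm n n) (Q : MvPolynomial (Fin (n + 2)) ℂ)
    (w : Coord n) :
    gradDensity φ Q w = eta w * topDensity (rankOneForm (grad Q w)) (φ.at w) w := by
  rw [topDensity_eq_sum _ (fun u => ((‖grad Q w u‖ ^ 2 : ℝ) : ℂ))
    (rankOneForm_polarization (grad Q w)), gradDensity, Finset.mul_sum]
  exact Finset.sum_congr rfl fun r _ => by rw [formCoeff]; ring

lemma exists_formCoeff_bound {n : ℕ} (φ : ContForm n n) :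
    ∃ B, 0 ≤ B ∧ (∀ r w, ‖formCoeff φ r w‖ ≤ B) ∧
      ∀ Q w, ‖gradDensity φ Q w‖ ≤ gradSq Q w * B := by
  choose M hM using fun r => (hasCompactSupport_formCoeff φ r).exists_bound_of_continuous
    (continuous_formCoeff φ r)
  have hM0 : ∀ r, 0 ≤ M r := fun r => (norm_nonneg _).trans (hM r 0)
  have hn0 : ∀ u : Coord n, 0 ≤ nsq u := fun u => Finset.sum_nonneg fun _ _ => by positivity
  refine ⟨∑ r, M r + ∑ r, nsq (polDir r) * M r, ?_, ?_, ?_⟩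
  · exact add_nonneg (Finset.sum_nonneg fun r _ => hM0 r)
      (Finset.sum_nonneg fun r _ => mul_nonneg (hn0 _) (hM0 r))
  · intro r w
    refine (hM r w).trans ?_
    have h1 := Finset.single_le_sum (f := M) (fun r _ => hM0 r) (Finset.mem_univ r)
    have h2 := Finset.sum_nonneg fun r (_ : r ∈ Finset.univ) =>
      mul_nonneg (hn0 (polDir r : Coord n)) (hM0 r)
    linarith
  · intro Q w
    have hg : 0 ≤ gradSq Q w := Finset.sum_nonneg fun _ _ => by positivity
    have h1 : ‖gradDensity φ Q w‖ ≤ ∑ r, gradSq Q w * (nsq (polDir r) * M r) := by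
      refine norm_sum_le_of_le _ fun r _ => ?_
      rw [norm_mul, Complex.norm_real, Real.norm_of_nonneg (by positivity), ← mul_assoc]
      exact mul_le_mul (norm_grad_sq_le Q w _) (hM r w) (norm_nonneg _)
        (mul_nonneg hg (hn0 _))
    rw [← Finset.mul_sum] at h1
    refine h1.trans (mul_le_mul_of_nonneg_left ?_ hg)
    have := Finset.sum_nonneg fun r (_ : r ∈ Finset.univ) => hM0 r
    linarith

lemma sq_le_nsq {n : ℕ} (w : Coord n) (j : Fin (n + 2)) : ‖w j‖ ^ 2 ≤ nsq w :=
  Finset.single_le_sum (f := fun i => ‖w i‖ ^ 2) (fun _ _ => by positivity) (Finset.mem_univ j)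

/-- This keeps the quotients by `weightDen` bounded on `{Q = 0}`. At singular points, where
`weightDen` vanishes, the numerator vanishes as well. -/
lemma norm_sq_mul_gradDensity_le {n d : ℕ} (φ : ContForm n n) {Q : MvPolynomial (Fin (n + 2)) ℂ}
    (hQ : Q.IsHomogeneous d) {B : ℝ} (hB0 : 0 ≤ B)
    (hB : ∀ w, ‖gradDensity φ Q w‖ ≤ gradSq Q w * B) (j : Fin (n + 2)) {w : Coord n}
    (hw : MvPolynomial.eval w Q = 0) :
    ‖(‖w j‖ ^ 2 : ℝ) * gradDensity φ Q w‖ ≤ weightDen Q w * ((n + 2) ^ 2 * B) := by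
  have hg : 0 ≤ gradSq Q w := Finset.sum_nonneg fun _ _ => by positivity
  rw [norm_mul, Complex.norm_real, Real.norm_of_nonneg (by positivity)]
  calc ‖w j‖ ^ 2 * ‖gradDensity φ Q w‖ ≤ nsq w * (gradSq Q w * B) := by
        refine mul_le_mul (sq_le_nsq w j) (hB w) (norm_nonneg _) ?_
        exact Finset.sum_nonneg fun _ _ => by positivity
    _ = (nsq w * gradSq Q w) * B := by ring
    _ ≤ ((n + 2) ^ 2 * weightDen Q w) * B := by
        have := nsq_mul_gradSq_le hQ hw
        gcongr
    _ = _ := by ring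

lemma tubeAvg_finset_sum {n : ℕ} {ι : Type*} (Q : MvPolynomial (Fin (n + 2)) ℂ) (s : Finset ι)
    {g : ι → Coord n → ℂ} (hg : ∀ i ∈ s, Integrable (g i)) (ε : ℝ) :
    tubeAvg Q (fun w => ∑ i ∈ s, g i w) ε = ∑ i ∈ s, tubeAvg Q (g i) ε := by
  simp only [tubeAvg]
  rw [integral_finsetSum _ fun i hi => (hg i hi).integrableOn, Finset.mul_sum]

/-- Change of slicing directions, with a regularized weight. -/
lemma sum_nu_regularized {n : ℕ} (φ : ContForm n n) {Q : MvPolynomial (Fin (n + 2)) ℂ}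
    (hs : ∀ r : PolIdx n, SimpleAlong Q (polDir r))
    (hs' : ∀ i : Fin (n + 2), SimpleAlong Q (Pi.single i 1)) {δ : ℝ} (hδ : 0 < δ) :
    ∑ j : Fin (n + 2), ∑ k : Fin (n + 1), nu Q (Pi.single (j.succAbove k) 1)
        (fun w => (‖w j‖ ^ 2 : ℝ) * gradDensity φ Q w / (weightDen Q w + δ : ℝ)) =
      ∑ r, nu Q (polDir r)
        (fun w => formCoeff φ r w * (weightDen Q w / (weightDen Q w + δ) : ℝ)) := by
  have hD := continuous_weightDen Q
  have hpos : ∀ w, weightDen Q w + δ ≠ 0 := fun w => by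
    have := weightDen_nonneg Q w; positivity
  have hposC : ∀ w, ((weightDen Q w + δ : ℝ) : ℂ) ≠ 0 := fun w => by exact_mod_cast hpos w
  have hH := continuous_gradDensity φ Q
  have hF := continuous_formCoeff φ
  have hc1 : ∀ j : Fin (n + 2), Continuous
      (fun w : Coord n => (‖w j‖ ^ 2 : ℝ) * gradDensity φ Q w / (weightDen Q w + δ : ℝ)) := fun j =>
    Continuous.div (by fun_prop) (by fun_prop) hposC
  have hs1 : ∀ j : Fin (n + 2), HasCompactSupport
      (fun w : Coord n => (‖w j‖ ^ 2 : ℝ) * gradDensity φ Q w / (weightDen Q w + δ : ℝ)) := fun j =>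
    HasCompactSupport.intro (isCompact_closedBall (0 : Coord n) 2) fun w hw => by
      simp [gradDensity_eq_zero φ Q hw]
  have hc2 : ∀ r : PolIdx n, Continuous
      (fun w => formCoeff φ r w * (weightDen Q w / (weightDen Q w + δ) : ℝ)) := fun r =>
    (hF r).mul (Complex.continuous_ofReal.comp (hD.div (by fun_prop) hpos))
  have hs2 : ∀ r : PolIdx n, HasCompactSupport
      (fun w => formCoeff φ r w * (weightDen Q w / (weightDen Q w + δ) : ℝ)) := fun r =>
    (hasCompactSupport_formCoeff φ r).mul_right
  have hint : ∀ (G : Coord n → ℂ) (u : Coord n), Continuous G → HasCompactSupport G →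
      Integrable fun w => G w * (‖grad Q w u‖ ^ 2 : ℝ) := fun G u hG hGc => by
    have := continuous_grad Q u
    exact Continuous.integrable_of_hasCompactSupport (by fun_prop) hGc.mul_right
  have L1 : Tendsto (fun ε => ∑ j : Fin (n + 2), ∑ k : Fin (n + 1), tubeAvg Q
      (fun w => ((‖w j‖ ^ 2 : ℝ) * gradDensity φ Q w / (weightDen Q w + δ : ℝ)) *
        (‖grad Q w (Pi.single (j.succAbove k) 1)‖ ^ 2 : ℝ)) ε) (𝓝[>] 0) _ :=
    tendsto_finsetSum _ fun j _ => tendsto_finsetSum _ fun k _ =>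
      tendsto_tubeAvg (hs' _) (hc1 j) (hs1 j)
  have L2 : Tendsto (fun ε => ∑ r, tubeAvg Q
      (fun w => (formCoeff φ r w * (weightDen Q w / (weightDen Q w + δ) : ℝ)) *
        (‖grad Q w (polDir r)‖ ^ 2 : ℝ)) ε) (𝓝[>] 0) _ :=
    tendsto_finsetSum _ fun r _ => tendsto_tubeAvg (hs r) (hc2 r) (hs2 r)
  -- Both sides are limits of the same tube average: `∑_{j,k} |w_j|² |∂_k Q|²` is `weightDen`, and
  -- `∑_r |dQ(polDir r)|² formCoeff` is `gradDensity`. Adding `δ` to the denominator makes the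
  -- slicing functions continuous, as `tendsto_tubeAvg` requires.
  refine tendsto_nhds_unique L1 (L2.congr fun ε => ?_)
  rw [← tubeAvg_finset_sum Q _ fun r _ => hint _ _ (hc2 r) (hs2 r)]
  simp_rw [← fun j => tubeAvg_finset_sum Q Finset.univ (g := fun (k : Fin (n + 1)) w =>
    ((‖w j‖ ^ 2 : ℝ) * gradDensity φ Q w / (weightDen Q w + δ : ℝ)) *
        (‖grad Q w (Pi.single (j.succAbove k) 1)‖ ^ 2 : ℝ))
    (fun k _ => hint _ _ (hc1 j) (hs1 j)) ε]
  rw [← tubeAvg_finset_sum Q _ fun j _ => integrable_finsetSum _ fun k _ =>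
    hint _ _ (hc1 j) (hs1 j)]
  congr 1
  ext w
  have e1 : ∑ r, (formCoeff φ r w * (weightDen Q w / (weightDen Q w + δ) : ℝ)) *
      (‖grad Q w (polDir r)‖ ^ 2 : ℝ) =
      gradDensity φ Q w * (weightDen Q w / (weightDen Q w + δ) : ℝ) := by
    rw [gradDensity, Finset.sum_mul]
    exact Finset.sum_congr rfl fun r _ => by ring
  rw [e1]
  simp_rw [grad_single]
  nth_rewrite 1 [weightDen]
  push_cast
  rw [Finset.sum_div, Finset.mul_sum]
  refine Finset.sum_congr rfl fun j _ => ?_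
  rw [Finset.sum_div, Finset.mul_sum]
  exact Finset.sum_congr rfl fun k _ => by ring

lemma weightDen_pos {n d : ℕ} {Q : MvPolynomial (Fin (n + 2)) ℂ} (hQ : Q.IsHomogeneous d)
    {w u : Coord n} (hw : MvPolynomial.eval w Q = 0) (hw0 : w ≠ 0) (hu : grad Q w u ≠ 0) :
    0 < weightDen Q w := by
  have h1 := nsq_mul_gradSq_le hQ hw
  have h2 := norm_grad_sq_le Q w u
  have h3 : 0 < ‖grad Q w u‖ ^ 2 := by positivity
  have h4 : 0 < gradSq Q w := by
    by_contra! h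
    have : 0 ≤ nsq u := Finset.sum_nonneg fun _ _ => by positivity
    nlinarith
  have h5 := mul_pos (nsq_pos hw0) h4
  by_contra! h
  nlinarith [sq_nonneg ((n : ℝ) + 2)]

/-- Change of slicing directions. -/
lemma sum_nu_eq {n d : ℕ} (φ : ContForm n n) {Q : MvPolynomial (Fin (n + 2)) ℂ}
    (hQ : Q.IsHomogeneous d) (hs : ∀ r : PolIdx n, SimpleAlong Q (polDir r))
    (hs' : ∀ i : Fin (n + 2), SimpleAlong Q (Pi.single i 1)) :
    (∀ j k, Integrable (nuInt Q (Pi.single (j.succAbove k) 1)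
      (fun w : Coord n => (‖w j‖ ^ 2 : ℝ) * gradDensity φ Q w / (weightDen Q w : ℝ)))) ∧
    ∑ j : Fin (n + 2), ∑ k : Fin (n + 1), nu Q (Pi.single (j.succAbove k) 1)
        (fun w => (‖w j‖ ^ 2 : ℝ) * gradDensity φ Q w / (weightDen Q w : ℝ)) =
      ∑ r, nu Q (polDir r) (formCoeff φ r) := by
  obtain ⟨B, hB0, hB1, hB2⟩ := exists_formCoeff_bound φ
  have hD := continuous_weightDen Q
  have hH := continuous_gradDensity φ Q
  have hF := continuous_formCoeff φ
  have hK := isCompact_closedBall (0 : Coord n) 2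
  have hposC : ∀ δ > 0, ∀ w, ((weightDen Q w + δ : ℝ) : ℂ) ≠ 0 := fun δ hδ w => by
    have := weightDen_nonneg Q w
    exact_mod_cast (by positivity : weightDen Q w + δ ≠ 0)
  have hpos : ∀ δ > 0, ∀ w, weightDen Q w + δ ≠ 0 := fun δ hδ w => by
    have := weightDen_nonneg Q w; positivity
  have hδ0 : Tendsto (fun δ : ℝ => δ) (𝓝[>] 0) (𝓝 0) := nhdsWithin_le_nhds
  -- Let `δ → 0` in the coordinate directions. The bound is uniform in `δ`, and where `weightDen` is
  -- zero both the regularized and the limiting values are zero.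
  have A : ∀ (j : Fin (n + 2)) (k : Fin (n + 1)), _ ∧ _ := fun j k =>
    tendsto_nu_of_dominated (Q := Q) (u := Pi.single (j.succAbove k) 1)
      (G := fun δ w => (‖w j‖ ^ 2 : ℝ) * gradDensity φ Q w / (weightDen Q w + δ : ℝ))
      (G₀ := fun w => (‖w j‖ ^ 2 : ℝ) * gradDensity φ Q w / (weightDen Q w : ℝ)) hK
      (C := (n + 2) ^ 2 * B)
      (fun δ hδ => by
        refine aestronglyMeasurable_nuInt (hs' _) (Continuous.div (by fun_prop) (by fun_prop)
          (hposC δ hδ)) (HasCompactSupport.intro hK fun w hw => ?_)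
        simp [gradDensity_eq_zero φ Q hw])
      (by positivity)
      (fun δ hδ w hw => by
        by_cases hwK : w ∈ Metric.closedBall (0 : Coord n) 2
        · rw [Set.indicator_of_mem hwK, norm_div, Complex.norm_real]
          have h0 := weightDen_nonneg Q w
          rw [Real.norm_of_nonneg (by positivity), div_le_iff₀ (by positivity)]
          refine (norm_sq_mul_gradDensity_le φ hQ hB0 (hB2 Q) j hw).trans ?_
          rw [mul_comm]
          gcongr
          linarith
        · simp [gradDensity_eq_zero φ Q hwK, hwK])
      (Eventually.of_forall fun w t ht => by
        rw [eval_line] at ht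
        generalize w + t • (Pi.single (j.succAbove k) 1 : Coord n) = x at ht
        by_cases hx : weightDen Q x = 0
        · have := norm_sq_mul_gradDensity_le φ hQ hB0 (hB2 Q) j ht
          rw [hx, zero_mul, norm_le_zero_iff] at this
          simp only [this, zero_div]
          exact tendsto_const_nhds
        · refine Tendsto.div tendsto_const_nhds ?_ (by exact_mod_cast hx)
          refine (Complex.continuous_ofReal.tendsto _).comp ?_
          simpa using hδ0.const_add (weightDen Q x))
  -- In the directions `polDir r` the factor `weightDen / (weightDen + δ)` tends to `1` at every
  -- root on almost every line: roots are simple, so `dQ ≠ 0` there and `weightDen_pos` applies. The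
  -- origin is excluded by the cutoff.
  have B' : ∀ r : PolIdx n, _ ∧ _ := fun r =>
    tendsto_nu_of_dominated (Q := Q) (u := polDir r)
      (G := fun δ w => formCoeff φ r w * (weightDen Q w / (weightDen Q w + δ) : ℝ))
      (G₀ := formCoeff φ r) hK (C := B)
      (fun δ hδ => aestronglyMeasurable_nuInt (hs r) ((hF r).mul
        (Complex.continuous_ofReal.comp (hD.div (by fun_prop) (hpos δ hδ))))
          (hasCompactSupport_formCoeff φ r).mul_right) hB0
      (fun δ hδ w hw => by
        by_cases hwK : w ∈ Metric.closedBall (0 : Coord n) 2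
        · rw [Set.indicator_of_mem hwK, norm_mul, Complex.norm_real]
          have h0 := weightDen_nonneg Q w
          have h1 : ‖weightDen Q w / (weightDen Q w + δ)‖ ≤ 1 := by
            rw [Real.norm_of_nonneg (by positivity), div_le_one (by positivity)]
            linarith
          exact (mul_le_of_le_one_right (norm_nonneg _) h1).trans (hB1 r w)
        · simp [formCoeff_eq_zero φ r hwK, hwK])
      (by
        filter_upwards [hs r] with w hw t ht
        have h2 := hw.2 t ht
        rw [eval_derivative_line] at h2
        rw [eval_line] at ht
        generalize w + t • polDir r = x at ht h2
        by_cases hx : x = 0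
        · have : formCoeff φ r x = 0 := by
            simp [formCoeff, eta_eq_zero_of_lt (w := x) (by simp [hx, nsq])]
          simp [this]
        · have h3 := weightDen_pos hQ ht hx h2
          have h4 : Tendsto (fun δ => weightDen Q x / (weightDen Q x + δ)) (𝓝[>] 0) (𝓝 1) := by
            have : Tendsto (fun δ => weightDen Q x / (weightDen Q x + δ)) (𝓝[>] 0)
                (𝓝 (weightDen Q x / (weightDen Q x + 0))) :=
              Tendsto.div tendsto_const_nhds (hδ0.const_add _) (by simpa using h3.ne')
            simpa [h3.ne'] using this
          simpa using ((Complex.continuous_ofReal.tendsto _).comp h4).const_mul (formCoeff φ r x))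
  refine ⟨fun j k => (A j k).2, ?_⟩
  have L1 := tendsto_finsetSum Finset.univ fun j _ => tendsto_finsetSum Finset.univ
    fun k _ => (A j k).1
  have L2 := tendsto_finsetSum Finset.univ fun r _ => (B' r).1
  refine tendsto_nhds_unique_of_eventuallyEq L1 L2 ?_
  filter_upwards [self_mem_nhdsWithin] with δ hδ
  exact sum_nu_regularized φ hs hs' hδ

/-! ### Polar coordinates on the cone over a chart -/

lemma map_complex_smul {E : Type*} [NormedAddCommGroup E] [NormedSpace ℝ E] [NormedSpace ℂ E]
    [IsScalarTower ℝ ℂ E] [FiniteDimensional ℝ E] [FiniteDimensional ℂ E] [MeasurableSpace E]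
    [BorelSpace E] (μ : Measure E) [μ.IsAddHaarMeasure] {c : ℂ} (hc : c ≠ 0) :
    μ.map (fun x => c • x) = ENNReal.ofReal ((‖c‖ ^ (2 * Module.finrank ℂ E))⁻¹) • μ := by
  have hdet : LinearMap.det ((c • (LinearMap.id : E →ₗ[ℂ] E)).restrictScalars ℝ) =
      ‖c‖ ^ (2 * Module.finrank ℂ E) := by
    rw [LinearMap.det_restrictScalars, LinearMap.det_smul, LinearMap.det_id, mul_one,
      Algebra.norm_complex_apply, Complex.normSq_eq_norm_sq, norm_pow, ← pow_mul, mul_comm]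
  have hpos : 0 < ‖c‖ ^ (2 * Module.finrank ℂ E) := by positivity
  have h := Measure.map_linearMap_addHaar_eq_smul_addHaar μ
    (f := (c • (LinearMap.id : E →ₗ[ℂ] E)).restrictScalars ℝ) (by rw [hdet]; exact hpos.ne')
  rw [hdet, abs_of_pos (by positivity)] at h
  exact h

lemma lintegral_complex_smul {E : Type*} [NormedAddCommGroup E] [NormedSpace ℝ E]
    [NormedSpace ℂ E] [IsScalarTower ℝ ℂ E] [FiniteDimensional ℝ E] [FiniteDimensional ℂ E]
    [MeasurableSpace E] [BorelSpace E] (μ : Measure E) [μ.IsAddHaarMeasure] {c : ℂ} (hc : c ≠ 0)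
    (f : E → ENNReal) (hf : Measurable f) :
    ENNReal.ofReal (‖c‖ ^ (2 * Module.finrank ℂ E)) * ∫⁻ x, f (c • x) ∂μ = ∫⁻ x, f x ∂μ := by
  have hpos : 0 < ‖c‖ ^ (2 * Module.finrank ℂ E) := by positivity
  rw [← lintegral_map hf (measurable_const_smul c), map_complex_smul μ hc,
    lintegral_smul_measure, smul_eq_mul, ← mul_assoc, ← ENNReal.ofReal_mul hpos.le,
    mul_inv_cancel₀ hpos.ne', ENNReal.ofReal_one, one_mul]

lemma integral_complex_smul {f : ℂ → ℝ} {c : ℂ} (hc : c ≠ 0) :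
    ∫ x : ℂ, f (c * x) = (‖c‖ ^ 2)⁻¹ * ∫ x, f x := by
  have h := map_complex_smul (volume : Measure ℂ) hc
  have he : MeasurableEmbedding fun x : ℂ => c • x :=
    (Homeomorph.smulOfNeZero c hc).measurableEmbedding
  have h2 := he.integral_map (μ := volume) f
  rw [h, integral_smul_measure] at h2
  simp only [smul_eq_mul] at h2
  rw [← h2, ENNReal.toReal_ofReal (by positivity)]
  simp

lemma ae_ne_zero_complex : ∀ᵐ c : ℂ, c ≠ 0 := by simp [ae_iff, measure_singleton]

/-- The map `(c, x) ↦ (c, c x)` has Jacobian `|c|^{2m}`. -/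
lemma measurePreserving_dilation (m : ℕ) :
    MeasurePreserving (fun p : ℂ × (Fin m → ℂ) => (p.1, p.1 • p.2))
      ((volume : Measure (ℂ × (Fin m → ℂ))).withDensity
        fun p => ENNReal.ofReal (‖p.1‖ ^ (2 * m))) volume := by
  have hm : Measurable (fun p : ℂ × (Fin m → ℂ) => (p.1, p.1 • p.2)) := by fun_prop
  refine ⟨hm, Measure.ext_of_lintegral _ fun f hf => ?_⟩
  have hd : Measurable fun p : ℂ × (Fin m → ℂ) => ENNReal.ofReal (‖p.1‖ ^ (2 * m)) := by fun_prop
  rw [lintegral_map hf hm]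
  refine (lintegral_withDensity_eq_lintegral_mul volume hd (hf.comp hm)).trans ?_
  change ∫⁻ p, _ ∂(volume.prod volume) = ∫⁻ p, _ ∂(volume.prod volume)
  rw [lintegral_prod _ (hd.mul (hf.comp hm)).aemeasurable, lintegral_prod _ hf.aemeasurable]
  refine lintegral_congr_ae ?_
  filter_upwards [ae_ne_zero_complex] with c hc
  have h1 : Measurable fun x : Fin m → ℂ => f (c, x) := hf.comp measurable_prodMk_left
  rw [← lintegral_complex_smul (volume : Measure (Fin m → ℂ)) hc (fun x => f (c, x)) h1]
  simp only [Pi.mul_apply, Function.comp]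
  rw [Module.finrank_fin_fun]
  exact lintegral_const_mul _ (h1.comp (measurable_const_smul c))

/-- The point of the cone with parameter `c` over the point `x` of the chart `w_j = 1`. -/
def conePoint {n : ℕ} (j : Fin (n + 2)) (p : ℂ × (Fin (n + 1) → ℂ)) : Coord n :=
  p.1 • (j.insertNth (α := fun _ => ℂ) 1 p.2)

lemma conePoint_eq {n : ℕ} (j : Fin (n + 2)) (p : ℂ × (Fin (n + 1) → ℂ)) :
    conePoint j p = j.insertNth (α := fun _ => ℂ) p.1 (p.1 • p.2) := by
  ext i
  rcases eq_or_ne i j with rfl | hi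
  · simp [conePoint]
  · obtain ⟨k, rfl⟩ := Fin.exists_succAbove_eq hi
    simp [conePoint]

lemma measurePreserving_conePoint {n : ℕ} (j : Fin (n + 2)) :
    MeasurePreserving (conePoint j)
      ((volume : Measure (ℂ × (Fin (n + 1) → ℂ))).withDensity
        fun p => ENNReal.ofReal (‖p.1‖ ^ (2 * (n + 1)))) volume := by
  have h1 := (volume_preserving_piFinSuccAbove (fun _ : Fin (n + 2) => ℂ) j).symm
  have h2 := h1.comp (measurePreserving_dilation (n + 1))
  have e : conePoint j = (MeasurableEquiv.piFinSuccAbove (fun _ : Fin (n + 2) => ℂ) j).symm ∘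
      fun p : ℂ × (Fin (n + 1) → ℂ) => (p.1, p.1 • p.2) := by
    funext p
    rw [conePoint_eq]
    rfl
  rw [e]
  exact h2

lemma ae_conePoint {n : ℕ} (j : Fin (n + 2)) {p : Coord n → Prop} (hp : ∀ᵐ w, p w) :
    ∀ᵐ q : ℂ × (Fin (n + 1) → ℂ), p (conePoint j q) := by
  have h1 := (measurePreserving_conePoint j).quasiMeasurePreserving.ae hp
  rw [ae_withDensity_iff (by fun_prop)] at h1
  have h2 : ∀ᵐ q : ℂ × (Fin (n + 1) → ℂ), q.1 ≠ 0 :=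
    Measure.quasiMeasurePreserving_fst.ae ae_ne_zero_complex
  filter_upwards [h1, h2] with q hq hq'
  refine hq ?_
  rw [Ne, ENNReal.ofReal_eq_zero, not_le]
  positivity

/-- Integration in polar coordinates on the cone over a chart. -/
lemma integral_cone {n : ℕ} (j : Fin (n + 2)) {g : Coord n → ℂ} (hg : Integrable g) :
    Integrable (fun p : ℂ × (Fin (n + 1) → ℂ) =>
      ((‖p.1‖ ^ (2 * (n + 1)) : ℝ) : ℂ) * g (conePoint j p)) ∧
    ∫ w, g w = ∫ p : ℂ × (Fin (n + 1) → ℂ),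
      ((‖p.1‖ ^ (2 * (n + 1)) : ℝ) : ℂ) * g (conePoint j p) := by
  have hmp := measurePreserving_conePoint j
  have hd : Measurable fun p : ℂ × (Fin (n + 1) → ℂ) =>
    ENNReal.ofReal (‖p.1‖ ^ (2 * (n + 1))) := by fun_prop
  have h1 := hmp.integrable_comp_of_integrable hg
  have h0 : ∀ p : ℂ × (Fin (n + 1) → ℂ),
      (ENNReal.ofReal (‖p.1‖ ^ (2 * (n + 1)))).toReal = ‖p.1‖ ^ (2 * (n + 1)) :=
    fun p => ENNReal.toReal_ofReal (by positivity)
  constructor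
  · rw [integrable_withDensity_iff_integrable_smul' hd (by simp)] at h1
    simpa [h0] using h1
  · have h2 : ∫ w, g w = ∫ w, g w ∂(Measure.map (conePoint j)
        ((volume : Measure (ℂ × (Fin (n + 1) → ℂ))).withDensity
        fun p => ENNReal.ofReal (‖p.1‖ ^ (2 * (n + 1))))) := by rw [hmp.map_eq]
    rw [h2, integral_map hmp.aemeasurable (by rw [hmp.map_eq]; exact hg.aestronglyMeasurable),
      integral_withDensity_eq_integral_toReal_smul hd (by simp)]
    simp

/-! ### Slicing integrals in the affine charts -/

lemma weight_eq_div {n : ℕ} (Q : MvPolynomial (Fin (n + 2)) ℂ) (j : Fin (n + 2)) (k : Fin (n + 1))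
    (w : Coord n) : weight Q j k w =
      (‖w j‖ ^ 2 * ‖partialAt Q (j.succAbove k) w‖ ^ 2) / weightDen Q w := rfl

lemma weight_smul {n d : ℕ} {Q : MvPolynomial (Fin (n + 2)) ℂ} (hQ : Q.IsHomogeneous d)
    (j : Fin (n + 2)) (k : Fin (n + 1)) {c : ℂ} (hc : c ≠ 0) (w : Coord n) :
    weight Q j k (c • w) = weight Q j k w := by
  have h1 : ∀ (a : Fin (n + 2)) (b : Fin (n + 1)),
      ‖(c • w) a‖ ^ 2 * ‖partialAt Q (a.succAbove b) (c • w)‖ ^ 2 =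
      (‖c‖ ^ 2 * ‖c ^ (d - 1)‖ ^ 2) * (‖w a‖ ^ 2 * ‖partialAt Q (a.succAbove b) w‖ ^ 2) := by
    intro a b
    rw [partialAt_smul hQ, Pi.smul_apply, smul_eq_mul, norm_mul, norm_mul]
    ring
  have h2 : ‖c‖ ^ 2 * ‖c ^ (d - 1)‖ ^ 2 ≠ 0 := by rw [norm_pow]; positivity
  rw [weight, weight]
  simp only [h1, ← Finset.mul_sum]
  rw [mul_div_mul_left _ _ h2]

lemma graphTangent_smul {n d : ℕ} {Q : MvPolynomial (Fin (n + 2)) ℂ} (hQ : Q.IsHomogeneous d)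
    (j : Fin (n + 2)) (k : Fin (n + 1)) {c : ℂ} (hc : c ≠ 0) (w : Coord n) :
    graphTangent Q j k (c • w) = graphTangent Q j k w := by
  ext1 i
  rw [graphTangent, graphTangent, partialAt_smul hQ, partialAt_smul hQ,
    mul_div_mul_left _ _ (pow_ne_zero _ hc)]

/-- The integrand of `hypersurfaceIntegral`. -/
def chartDensity {n : ℕ} (φ : ContForm n n) (Q : MvPolynomial (Fin (n + 2)) ℂ) (j : Fin (n + 2))
    (k : Fin (n + 1)) (w : Coord n) : ℂ :=
  weight Q j k w * φ.toFun w (realFrame (graphTangent Q j k w))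

/-- At a zero, Euler's identity makes `dQ` kill `p`, so `awedge_chartFrame` applies to `(i/2) dQ ∧
dQ̄ ∧ φ`. By `awedge_rankOneForm_chartFrame` the value on the chart frame is `|∂_k Q|²` times `φ` on
the graph tangents, and this factor supplies the missing part of `weight`. -/
lemma gradDensity_div_weightDen {n d : ℕ} (φ : ContForm n n) {Q : MvPolynomial (Fin (n + 2)) ℂ}
    (hQ : Q.IsHomogeneous d) (j : Fin (n + 2)) (k : Fin (n + 1)) {p : Coord n}
    (hpj : p j ≠ 0) (hp : MvPolynomial.eval p Q = 0)
    (hk : partialAt Q (j.succAbove k) p ≠ 0) :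
    (‖p j‖ ^ 2 : ℝ) * gradDensity φ Q p / (weightDen Q p : ℝ) =
      eta p * ((‖p j‖ ^ 2 : ℝ)⁻¹ * chartDensity φ Q j k p) := by
  have hp0 : p ≠ 0 := by rintro rfl; simp at hpj
  have h1 := awedge_chartFrame (rankOneForm (grad Q p)) (φ.at p) p hp0
    (fun c x ⟨q, hq⟩ => rankOneForm_eq_zero _ _ ⟨q, by rw [hq, map_smul, grad_self hQ, hp]; simp⟩)
    (fun c x ⟨q, hq⟩ => φ.horizontal p hp0 x ⟨q, c, hq⟩) j k
  rw [awedge_rankOneForm_chartFrame _ _ _ _ (by rwa [grad_single])] at h1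
  simp only [grad_single] at h1
  rw [gradDensity_eq_eta_mul, chartDensity, weight_eq_div]
  have h2 : ((‖p j‖ ^ 2 : ℝ) : ℂ) * (eta p * topDensity (rankOneForm (grad Q p)) (φ.at p) p) =
      eta p * ((‖p j‖ : ℂ) ^ 2 * topDensity (rankOneForm (grad Q p)) (φ.at p) p) := by
    push_cast; ring
  have h3 : ((‖p j‖ : ℝ) : ℂ) ≠ 0 := by simpa using hpj
  rw [h2, ← h1]
  push_cast
  field_simp
  rfl

lemma chartDensity_smul {n d : ℕ} (φ : ContForm n n) {Q : MvPolynomial (Fin (n + 2)) ℂ}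
    (hQ : Q.IsHomogeneous d) (j : Fin (n + 2)) (k : Fin (n + 1)) {c : ℂ} (hc : c ≠ 0)
    {p : Coord n} (hp : p ≠ 0) :
    chartDensity φ Q j k (c • p) = ((‖c‖ ^ (2 * n))⁻¹ : ℝ) * chartDensity φ Q j k p := by
  rw [chartDensity, weight_smul hQ _ _ hc, graphTangent_smul hQ _ _ hc, φ.toFun_smul hp hc,
    chartDensity]
  ring

lemma chartPoint_apply_self {n : ℕ} (j : Fin (n + 2)) (k : Fin (n + 1)) (y : Fin n → ℂ) (t : ℂ) :
    chartPoint j k y t j = 1 := by simp [chartPoint]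

lemma chartPoint_ne_zero {n : ℕ} (j : Fin (n + 2)) (k : Fin (n + 1)) (y : Fin n → ℂ) (t : ℂ) :
    chartPoint j k y t ≠ 0 := fun h => by
  have := chartPoint_apply_self j k y t
  rw [h] at this
  simp at this

lemma chartPoint_add {n : ℕ} (j : Fin (n + 2)) (k : Fin (n + 1)) (y : Fin n → ℂ) (s t : ℂ) :
    chartPoint j k y s + t • (Pi.single (j.succAbove k) 1 : Coord n) = chartPoint j k y (s + t) := by
  ext i
  rcases eq_or_ne i j with rfl | hi
  · simp [chartPoint]
  · obtain ⟨l, rfl⟩ := Fin.exists_succAbove_eq hi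
    rcases eq_or_ne l k with rfl | hl
    · simp [chartPoint]
    · obtain ⟨l', rfl⟩ := Fin.exists_succAbove_eq hl
      simp [chartPoint]

lemma smul_chartPoint_add {n : ℕ} (j : Fin (n + 2)) (k : Fin (n + 1)) (y : Fin n → ℂ) (c s τ : ℂ) :
    c • chartPoint j k y s + (c * (τ - s)) • (Pi.single (j.succAbove k) 1 : Coord n) =
      c • chartPoint j k y τ := by
  rw [mul_smul, ← smul_add, chartPoint_add]
  congr 2
  ring

/-- The simple zeros of `Q` on the coordinate line over `y`. -/
def branches {n : ℕ} (Q : MvPolynomial (Fin (n + 2)) ℂ) (j : Fin (n + 2)) (k : Fin (n + 1))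
    (y : Fin n → ℂ) : Set ℂ :=
  {t : ℂ | MvPolynomial.eval (chartPoint j k y t) Q = 0 ∧
          partialAt Q (j.succAbove k) (chartPoint j k y t) ≠ 0}

/-- The line through `c p` in the direction `e_k` is `c` times the coordinate line over `y`, and the
root with parameter `t = c (τ - s)` corresponds to the branch `τ`. The powers of `|c|` are `2(n+1)`
from the Jacobian, `-2` from `|w_j|⁻²` and `-2n` from `chartDensity`; they cancel. -/
lemma nuInt_chart {n d : ℕ} (φ : ContForm n n) {Q : MvPolynomial (Fin (n + 2)) ℂ}
    (hQ : Q.IsHomogeneous d) (j : Fin (n + 2)) (k : Fin (n + 1)) (y : Fin n → ℂ) {c s : ℂ}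
    (hc : c ≠ 0) (h0 : line Q (c • chartPoint j k y s) (Pi.single (j.succAbove k) 1) ≠ 0)
    (h1 : ∀ t, (line Q (c • chartPoint j k y s) (Pi.single (j.succAbove k) 1)).eval t = 0 →
      (line Q (c • chartPoint j k y s) (Pi.single (j.succAbove k) 1)).derivative.eval t ≠ 0) :
    (branches Q j k y).Finite ∧
    ((‖c‖ ^ (2 * (n + 1)) : ℝ) : ℂ) * nuInt Q (Pi.single (j.succAbove k) 1)
      (fun w => (‖w j‖ ^ 2 : ℝ) * gradDensity φ Q w / (weightDen Q w : ℝ))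
      (c • chartPoint j k y s) =
    ∑ᶠ τ ∈ branches Q j k y, ((kappa (c * (τ - s)) * eta (c • chartPoint j k y τ) : ℝ) : ℂ) *
      chartDensity φ Q j k (chartPoint j k y τ) := by
  set e : Coord n := Pi.single (j.succAbove k) 1 with he
  set w := c • chartPoint j k y s with hw
  have hev : ∀ τ, (line Q w e).eval (c * (τ - s)) =
      c ^ d * MvPolynomial.eval (chartPoint j k y τ) Q := fun τ => by
    rw [eval_line, hw, smul_chartPoint_add, eval_smul_of_isHomogeneous hQ]
  have hder : ∀ τ, (line Q w e).derivative.eval (c * (τ - s)) =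
      c ^ (d - 1) * partialAt Q (j.succAbove k) (chartPoint j k y τ) := fun τ => by
    rw [eval_derivative_line, hw, smul_chartPoint_add, he, grad_single, partialAt_smul hQ]
  have hcd : ∀ m : ℕ, c ^ m ≠ 0 := fun m => pow_ne_zero _ hc
  have hbij : Set.BijOn (fun τ => c * (τ - s)) (branches Q j k y)
      ((line Q w e).roots.toFinset : Set ℂ) := by
    refine ⟨fun τ hτ => ?_, fun τ _ τ' _ h => ?_, fun t ht => ?_⟩
    · rw [Finset.mem_coe, Multiset.mem_toFinset, Polynomial.mem_roots h0, Polynomial.IsRoot, hev,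
        hτ.1, mul_zero]
    · simpa [hc] using h
    · rw [Finset.mem_coe, Multiset.mem_toFinset, Polynomial.mem_roots h0, Polynomial.IsRoot] at ht
      have e1 : c * (t / c + s - s) = t := by field_simp; ring
      refine ⟨t / c + s, ⟨?_, ?_⟩, e1⟩
      · have := hev (t / c + s)
        rw [e1, ht] at this
        simpa [hcd] using this.symm
      · have := hder (t / c + s)
        rw [e1] at this
        intro h
        exact h1 t ht (by rw [this, h, mul_zero])
  have hfin : (branches Q j k y).Finite :=
    Set.Finite.of_finite_image (hbij.image_eq ▸ Finset.finite_toSet _) hbij.injOn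
  refine ⟨hfin, ?_⟩
  rw [nuInt, rootSum_eq_sum_toFinset h0 h1, ← finsum_mem_coe_finset,
    ← finsum_mem_eq_of_bijOn (f := fun τ => (kappa (c * (τ - s)) : ℂ) *
      (fun w : Coord n => (‖w j‖ ^ 2 : ℝ) * gradDensity φ Q w / (weightDen Q w : ℝ))
        (w + (c * (τ - s)) • e)) _ hbij (fun τ _ => rfl), ← smul_eq_mul, smul_finsum_mem]
  · refine finsum_mem_congr rfl fun τ hτ => ?_
    have hp := chartPoint_ne_zero j k y τ
    have hj : (c • chartPoint j k y τ) j = c := by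
      rw [Pi.smul_apply, chartPoint_apply_self, smul_eq_mul, mul_one]
    simp only [smul_eq_mul]
    rw [hw, he, smul_chartPoint_add, gradDensity_div_weightDen φ hQ j k (by rwa [hj])
      (by rw [eval_smul_of_isHomogeneous hQ, hτ.1, mul_zero])
      (by rw [partialAt_smul hQ]; exact mul_ne_zero (hcd _) hτ.2), hj, chartDensity_smul φ hQ j k hc hp]
    have hcc : ((‖c‖ : ℝ) : ℂ) ≠ 0 := by simpa using hc
    push_cast
    field_simp
    ring
  · exact hfin

lemma norm_lt_of_kappa_ne_zero {t : ℂ} (h : kappa t ≠ 0) : ‖t‖ < 2 := by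
  have h1 : t ∈ Function.support kappa := h
  rw [kappa, ContDiffBump.support_normed_eq] at h1
  -- The default bump function has outer radius `2`.
  have h2 : (default : ContDiffBump (0 : ℂ)).rOut = 2 := rfl
  simpa [h2] using h1

/-- The integral over `s` contributes `|c|⁻²` because `kappa` has mass one; the integral over `c` is
then `integral_eta_smul`. The support is bounded also in `s`, since `eta` keeps `c` away from `0`.
-/
lemma integral_kappa_mul_eta {n : ℕ} {j : Fin (n + 2)} {p : Coord n} (hp : p j = 1) (τ : ℂ) :
    Integrable (fun x : ℂ × ℂ => ((kappa (x.1 * (τ - x.2)) * eta (x.1 • p) : ℝ) : ℂ)) ∧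
    ∫ x : ℂ × ℂ, ((kappa (x.1 * (τ - x.2)) * eta (x.1 • p) : ℝ) : ℂ) = 1 := by
  have hp0 : p ≠ 0 := by rintro rfl; simp at hp
  have hpos := nsq_pos hp0
  have hcont : Continuous (fun x : ℂ × ℂ => kappa (x.1 * (τ - x.2)) * eta (x.1 • p)) := by
    have h1 := continuous_kappa
    have h2 := continuous_eta (n := n)
    fun_prop
  have hsupp : HasCompactSupport (fun x : ℂ × ℂ => kappa (x.1 * (τ - x.2)) * eta (x.1 • p)) := by
    refine HasCompactSupport.intro ((isCompact_closedBall (0 : ℂ) 2).prod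
      (isCompact_closedBall τ (2 * √(nsq p)))) fun x hx => ?_
    by_contra h
    refine hx ⟨?_, ?_⟩
    · have h1 : x.1 • p ∈ Metric.closedBall (0 : Coord n) 2 := by
        by_contra h1; exact h (by rw [eta_eq_zero_of_notMem h1, mul_zero])
      rw [mem_closedBall_zero_iff] at h1 ⊢
      have := (norm_le_pi_norm (x.1 • p) j).trans h1
      simpa [hp] using this
    · have h1 : 1 < nsq (x.1 • p) := by
        by_contra! h1; exact h (by rw [eta_eq_zero_of_lt h1, mul_zero])
      have h2 := norm_lt_of_kappa_ne_zero (left_ne_zero_of_mul h)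
      rw [nsq_smul] at h1
      rw [norm_mul] at h2
      rw [mem_closedBall_iff_norm, norm_sub_rev]
      have h3 : 1 < ‖x.1‖ * √(nsq p) := by
        have : ‖x.1‖ * √(nsq p) = √(‖x.1‖ ^ 2 * nsq p) := by
          rw [Real.sqrt_mul (by positivity), Real.sqrt_sq (norm_nonneg _)]
        rw [this]
        exact Real.lt_sqrt_of_sq_lt (by linarith)
      have h4 : 0 ≤ √(nsq p) := Real.sqrt_nonneg _
      nlinarith [norm_nonneg (τ - x.2)]
  have hint := hcont.integrable_of_hasCompactSupport hsupp (μ := volume)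
  refine ⟨hint.ofReal, ?_⟩
  rw [integral_complex_ofReal]
  norm_cast
  change ∫ x, _ ∂(volume.prod volume) = _
  rw [integral_prod _ hint, ← integral_eta_smul hp0]
  refine integral_congr_ae ?_
  filter_upwards [ae_ne_zero_complex] with c hc
  rw [integral_mul_const, integral_sub_left_eq_self (fun s => kappa (c * s)) volume τ,
    integral_complex_smul hc, integral_kappa, mul_one]

/-- The parametrization `(y, (c, s)) ↦ (c, x)` with `x_k = s`, the other coordinates being `y`. -/
def chartSplit {n : ℕ} (k : Fin (n + 1)) :
    (Fin n → ℂ) × (ℂ × ℂ) ≃ᵐ ℂ × (Fin (n + 1) → ℂ) :=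
  (MeasurableEquiv.prodComm.trans MeasurableEquiv.prodAssoc).trans
    ((MeasurableEquiv.refl ℂ).prodCongr (MeasurableEquiv.piFinSuccAbove (fun _ => ℂ) k).symm)

lemma measurePreserving_chartSplit {n : ℕ} (k : Fin (n + 1)) :
    MeasurePreserving (chartSplit k) := by
  have h1 : MeasurePreserving (Prod.swap : (Fin n → ℂ) × (ℂ × ℂ) → _) :=
    Measure.measurePreserving_swap
  have h2 := measurePreserving_prodAssoc (volume : Measure ℂ) (volume : Measure ℂ)
    (volume : Measure (Fin n → ℂ))
  have h3 := (MeasurePreserving.id (volume : Measure ℂ)).prod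
    (volume_preserving_piFinSuccAbove (fun _ : Fin (n + 1) => ℂ) k).symm
  exact h3.comp (h2.comp h1)

/-- Integrate over `(c, s)` for fixed `y`: the branches over `y` and their chart densities do not
depend on `(c, s)`, and the remaining factor has integral one. -/
lemma nu_chart {n d : ℕ} (φ : ContForm n n) {Q : MvPolynomial (Fin (n + 2)) ℂ}
    (hQ : Q.IsHomogeneous d) (j : Fin (n + 2)) (k : Fin (n + 1))
    (hs : SimpleAlong Q (Pi.single (j.succAbove k) 1))
    (hi : Integrable (nuInt Q (Pi.single (j.succAbove k) 1)
      (fun w : Coord n => (‖w j‖ ^ 2 : ℝ) * gradDensity φ Q w / (weightDen Q w : ℝ)))) :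
    nu Q (Pi.single (j.succAbove k) 1)
      (fun w : Coord n => (‖w j‖ ^ 2 : ℝ) * gradDensity φ Q w / (weightDen Q w : ℝ)) =
    ∫ y : Fin n → ℂ, ∑ᶠ t ∈ branches Q j k y, chartDensity φ Q j k (chartPoint j k y t) := by
  obtain ⟨h1, h2⟩ := integral_cone j hi
  have hmp := measurePreserving_chartSplit k
  have hi' := (hmp.integrable_comp_emb (chartSplit k).measurableEmbedding).mpr h1
  rw [nu, h2, ← hmp.integral_comp (chartSplit k).measurableEmbedding]
  change ∫ x, _ ∂(volume.prod volume) = _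
  refine (integral_prod _ hi').trans ?_
  have hae := hmp.quasiMeasurePreserving.ae (ae_conePoint j hs)
  have hae2 := Measure.ae_ae_of_ae_prod hae
  have hc0 : ∀ᵐ x : ℂ × ℂ, x.1 ≠ 0 := Measure.quasiMeasurePreserving_fst.ae ae_ne_zero_complex
  refine integral_congr_ae ?_
  filter_upwards [hae2] with y hy
  have hgood := hy.and hc0
  -- A single good pair `(c, s)` already shows that there are finitely many branches over `y`.
  obtain ⟨⟨c₀, s₀⟩, hx₀, hx₀'⟩ := hgood.exists
  have hfin := (nuInt_chart φ hQ j k y hx₀' hx₀.1 hx₀.2).1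
  have e1 : ∀ᵐ x : ℂ × ℂ, ((‖(chartSplit k (y, x)).1‖ ^ (2 * (n + 1)) : ℝ) : ℂ) *
      nuInt Q (Pi.single (j.succAbove k) 1)
      (fun w => (‖w j‖ ^ 2 : ℝ) * gradDensity φ Q w / (weightDen Q w : ℝ))
      (conePoint j (chartSplit k (y, x))) =
      ∑ τ ∈ hfin.toFinset,
        ((kappa (x.1 * (τ - x.2)) * eta (x.1 • chartPoint j k y τ) : ℝ) : ℂ) *
        chartDensity φ Q j k (chartPoint j k y τ) := by
    filter_upwards [hgood] with x hx
    rw [← finsum_mem_eq_finite_toFinset_sum]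
    exact (nuInt_chart φ hQ j k y hx.2 hx.1.1 hx.1.2).2
  refine (integral_congr_ae e1).trans ?_
  rw [integral_finsetSum, finsum_mem_eq_finite_toFinset_sum _ hfin]
  · refine Finset.sum_congr rfl fun τ _ => ?_
    rw [integral_mul_const, (integral_kappa_mul_eta (chartPoint_apply_self j k y τ) τ).2, one_mul]
  · exact fun τ _ => (integral_kappa_mul_eta (chartPoint_apply_self j k y τ) τ).1.mul_const _

/-- Integration over a hypersurface is a combination of slicing integrals. -/
lemma hypersurfaceIntegral_eq {n d : ℕ} (φ : ContForm n n) {Q : MvPolynomial (Fin (n + 2)) ℂ}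
    (hQ : Q.IsHomogeneous d) (hs : ∀ r : PolIdx n, SimpleAlong Q (polDir r))
    (hs' : ∀ i : Fin (n + 2), SimpleAlong Q (Pi.single i 1)) :
    hypersurfaceIntegral Q φ = ∑ r, nu Q (polDir r) (formCoeff φ r) := by
  obtain ⟨h1, h2⟩ := sum_nu_eq φ hQ hs hs'
  rw [← h2, hypersurfaceIntegral]
  exact Finset.sum_congr rfl fun j _ => Finset.sum_congr rfl fun k _ =>
    (nu_chart φ hQ j k (hs' _) (h1 j k)).symm

/-! ### Zero divisors -/

lemma SimpleAlong.of_dvd {n : ℕ} {P Q : MvPolynomial (Fin (n + 2)) ℂ} {u : Coord n}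
    (hP : SimpleAlong P u) (h : Q ∣ P) : SimpleAlong Q u := by
  obtain ⟨R, rfl⟩ := h
  filter_upwards [hP] with w ⟨h0, h1⟩
  rw [line_mul] at h0 h1
  refine ⟨left_ne_zero_of_mul h0, fun t ht ht' => h1 t (by simp [ht]) ?_⟩
  simp [Polynomial.derivative_mul, ht, ht']

lemma rootSum_mul {p q : Polynomial ℂ} (h : p * q ≠ 0) (f : ℂ → ℂ) :
    rootSum (p * q) f = rootSum p f + rootSum q f := by
  rw [rootSum, Polynomial.roots_mul h, Multiset.map_add, Multiset.sum_add, rootSum, rootSum]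

lemma nu_mul {n : ℕ} {P Q : MvPolynomial (Fin (n + 2)) ℂ} {u : Coord n}
    (h : SimpleAlong (P * Q) u) {G : Coord n → ℂ} (hG : Continuous G) (hGc : HasCompactSupport G) :
    nu (P * Q) u G = nu P u G + nu Q u G := by
  have h1 := h.of_dvd (dvd_mul_right P Q)
  have h2 := h.of_dvd (dvd_mul_left Q P)
  rw [nu, nu, nu, ← integral_add (integrable_nuInt h1 hG hGc) (integrable_nuInt h2 hG hGc)]
  refine integral_congr_ae ?_
  filter_upwards [h] with w hw
  rw [line_mul] at hw
  rw [nuInt, line_mul, rootSum_mul hw.1]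
  rfl

lemma nu_of_isUnit {n : ℕ} {P : MvPolynomial (Fin (n + 2)) ℂ} (hP : IsUnit P) (u : Coord n)
    (G : Coord n → ℂ) : nu P u G = 0 := by
  obtain ⟨R, hR⟩ := hP.exists_right_inv
  rw [nu, ← integral_zero (Coord n) ℂ (μ := volume)]
  congr 1
  ext w
  have h1 : IsUnit (line P w u) := by
    refine IsUnit.of_mul_eq_one (line R w u) ?_
    rw [← line_mul, hR, line, map_one]
  obtain ⟨a, -, ha⟩ := Polynomial.isUnit_iff.mp h1
  rw [nuInt, rootSum, ← ha, Polynomial.roots_C]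
  simp

lemma nu_multiset_prod {n : ℕ} (s : Multiset (MvPolynomial (Fin (n + 2)) ℂ)) {u : Coord n}
    (h : SimpleAlong s.prod u) {G : Coord n → ℂ} (hG : Continuous G) (hGc : HasCompactSupport G) :
    nu s.prod u G = (s.map fun Q => nu Q u G).sum := by
  induction s using Multiset.induction with
  | empty => simpa using nu_of_isUnit isUnit_one u G
  | cons Q s ih =>
    rw [Multiset.prod_cons] at h ⊢
    rw [nu_mul h hG hGc, ih (h.of_dvd (dvd_mul_left _ _)), Multiset.map_cons, Multiset.sum_cons]

lemma sum_map_finset_sum {α ι M : Type*} [AddCommMonoid M] (s : Multiset α) (t : Finset ι)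
    (f : α → ι → M) : (s.map fun a => ∑ i ∈ t, f a i).sum = ∑ i ∈ t, (s.map fun a => f a i).sum := by
  induction s using Multiset.induction with
  | empty => simp
  | cons a s ih => simp [ih, Finset.sum_add_distrib]

/-- The current of integration over a zero divisor is a combination of slicing integrals. -/
lemma zeroCurrent_eq {n N : ℕ} (φ : ContForm n n) {P : MvPolynomial (Fin (n + 2)) ℂ}
    (hP : P.IsHomogeneous N) (hP0 : P ≠ 0) (hs : ∀ r : PolIdx n, SimpleAlong P (polDir r))
    (hs' : ∀ i : Fin (n + 2), SimpleAlong P (Pi.single i 1)) :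
    zeroCurrent P φ = ∑ r, nu P (polDir r) (formCoeff φ r) := by
  have hf : ∀ Q ∈ UniqueFactorizationMonoid.factors P, Q ∣ P := fun Q hQ =>
    UniqueFactorizationMonoid.dvd_of_mem_factors hQ
  have h1 : zeroCurrent P φ = ((UniqueFactorizationMonoid.factors P).map fun Q =>
      ∑ r, nu Q (polDir r) (formCoeff φ r)).sum := by
    rw [zeroCurrent]
    congr 1
    refine Multiset.map_congr rfl fun Q hQ => ?_
    obtain ⟨d, hd⟩ := isHomogeneous_of_dvd hP hP0 (hf Q hQ)
    exact hypersurfaceIntegral_eq φ hd (fun r => (hs r).of_dvd (hf Q hQ))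
      (fun i => (hs' i).of_dvd (hf Q hQ))
  rw [h1, sum_map_finset_sum]
  refine Finset.sum_congr rfl fun r _ => ?_
  -- The product of the factors is `P` up to a unit, and a unit has no zeros.
  obtain ⟨v, hv⟩ := UniqueFactorizationMonoid.factors_prod hP0
  have hF := continuous_formCoeff φ r
  have hFc := hasCompactSupport_formCoeff φ r
  have h2 := hs r
  rw [← hv] at h2
  rw [← nu_multiset_prod _ (h2.of_dvd (dvd_mul_right _ _)) hF hFc]
  conv_rhs => rw [← hv]
  rw [nu_mul h2 hF hFc, nu_of_isUnit v.isUnit, add_zero]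

/-! ### The Fubini-Study pairing -/

lemma continuous_herm {n : ℕ} (u : Coord n) : Continuous fun w : Coord n => herm w u := by
  unfold herm
  fun_prop

lemma continuousOn_fsDensity {n : ℕ} (u : Coord n) :
    ContinuousOn (fun w : Coord n => fsDensity w u) {0}ᶜ := by
  unfold fsDensity
  have h1 := continuous_herm u
  have h2 := continuous_nsq (n := n)
  refine continuousOn_const.mul (ContinuousOn.div (by fun_prop) (by fun_prop) fun w hw => ?_)
  exact pow_ne_zero _ (nsq_pos hw).ne'

lemma fsDensity_smul {n : ℕ} (w u : Coord n) {c : ℂ} (hc : c ≠ 0) :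
    fsDensity (c • w) u = (‖c‖ ^ 2)⁻¹ * fsDensity w u := by
  have h0 : ‖c‖ ≠ 0 := by simpa using hc
  simp only [fsDensity, nsq_smul, herm_smul_left, norm_mul, RCLike.norm_conj]
  rcases eq_or_ne (nsq w) 0 with h | h
  · simp [h]
  · field_simp

lemma continuous_formCoeff_mul_fsDensity {n : ℕ} (φ : ContForm n n) (r : PolIdx n) (u : Coord n) :
    Continuous fun w => formCoeff φ r w * fsDensity w u := by
  have h := continuous_eta_mul ((continuousOn_polCoeff φ r).mul
    (Complex.continuous_ofReal.comp_continuousOn (continuousOn_fsDensity u)))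
  refine h.congr fun w => ?_
  rw [formCoeff, mul_assoc]
  rfl

lemma integrable_formCoeff_mul_fsDensity {n : ℕ} (φ : ContForm n n) (r : PolIdx n) (u : Coord n) :
    Integrable fun w => formCoeff φ r w * fsDensity w u :=
  (continuous_formCoeff_mul_fsDensity φ r u).integrable_of_hasCompactSupport
    (hasCompactSupport_formCoeff φ r).mul_right

/-- Expand `ω_FS ∧ φ` by polarization at each point of the chart `w_0 = 1`, and insert the radial
integral `∫ |c|⁻² eta(c p) = 1`. Polar coordinates on the cone turn the result into integrals over
`ℂ^{n+2}`. -/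
lemma fsPairing_eq {n : ℕ} (φ : ContForm n n) :
    fsPairing φ = ∑ r, ∫ w, formCoeff φ r w * fsDensity w (polDir r) := by
  rw [← integral_finsetSum _ fun r _ => integrable_formCoeff_mul_fsDensity φ r (polDir r)]
  have hg := integrable_finsetSum Finset.univ
    fun r (_ : r ∈ Finset.univ) => integrable_formCoeff_mul_fsDensity φ r (polDir r)
  obtain ⟨h1, h2⟩ := integral_cone 0 hg
  rw [h2, fsPairing]
  change _ = ∫ p, _ ∂(volume.prod volume)
  rw [integral_prod_symm _ h1]
  congr 1
  ext x
  set p : Coord n := Fin.cons 1 x with hp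
  have hp0 : p ≠ 0 := fun h => by
    have : p 0 = 1 := rfl
    rw [h] at this
    simp at this
  have e1 := awedge_chartFrame (omegaFS p).toAlternatingMap (φ.at p) p hp0
    (fun c x ⟨q, hq⟩ => omegaFS_eq_zero hp0 c x ⟨q, hq⟩)
    (fun c x ⟨q, hq⟩ => φ.horizontal p hp0 x ⟨q, c, hq⟩) 0 0
  have e2 := topDensity_eq_sum (omegaFS p).toAlternatingMap (fun u => (fsDensity p u : ℂ))
    (fun x y => omegaFS_polarization hp0 x y) (φ.at p) p
  have e3 : ‖p 0‖ = 1 := by simp [hp]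
  refine e1.trans ?_
  rw [e3, e2]
  have e4 : ∀ᵐ c : ℂ, ((‖c‖ ^ (2 * (n + 1)) : ℝ) : ℂ) *
      ∑ r, formCoeff φ r (conePoint 0 (c, x)) * fsDensity (conePoint 0 (c, x)) (polDir r) =
      (((‖c‖ ^ 2)⁻¹ * eta (c • p) : ℝ) : ℂ) *
        ∑ r, (fsDensity p (polDir r) : ℂ) * polCoeff (φ.at p) p r := by
    filter_upwards [ae_ne_zero_complex] with c hc
    have hcp : conePoint 0 (c, x) = c • p := by
      rw [conePoint, hp, Fin.insertNth_zero]
      rfl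
    rw [hcp, Finset.mul_sum, Finset.mul_sum]
    refine Finset.sum_congr rfl fun r _ => ?_
    rw [formCoeff, polCoeff_smul φ r hp0 hc, fsDensity_smul _ _ hc]
    have : ((‖c‖ : ℝ) : ℂ) ≠ 0 := by simpa using hc
    push_cast
    field_simp
    ring
  rw [integral_congr_ae e4, integral_mul_const, integral_complex_ofReal, integral_eta_smul hp0]
  simp

/-! ### Circle averages of logarithms of polynomials -/

/-- The difference of the circle averages of radii `2 r` and `r` of the function `log |· - s|`. -/
def logKernel (r : ℝ) (s : ℂ) : ℝ :=
  Real.log 2 + Real.posLog ((2 * r)⁻¹ * ‖s‖) - Real.posLog (r⁻¹ * ‖s‖)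

lemma continuous_logKernel (r : ℝ) : Continuous (logKernel r) := by
  unfold logKernel
  have := Real.continuous_posLog
  fun_prop

lemma logKernel_scale {r : ℝ} (hr : 0 < r) (s : ℂ) :
    logKernel r s = logKernel 1 ((r⁻¹ : ℂ) * s) := by
  simp only [logKernel, norm_mul, norm_inv, Complex.norm_real, Real.norm_of_nonneg hr.le, mul_inv,
    inv_one, mul_one, one_mul, mul_assoc]

lemma posLog_of_le {x : ℝ} (h0 : 0 ≤ x) (h : x ≤ 1) : Real.posLog x = 0 :=
  (Real.posLog_eq_zero_iff x).mpr (by rwa [abs_of_nonneg h0])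

lemma posLog_of_ge {x : ℝ} (h : 1 ≤ x) : Real.posLog x = Real.log x :=
  Real.posLog_eq_log (by rwa [abs_of_nonneg (by linarith)])

lemma logKernel_one_of_le {s : ℂ} (h : ‖s‖ ≤ 1) : logKernel 1 s = Real.log 2 := by
  have h0 := norm_nonneg s
  rw [logKernel, posLog_of_le (by positivity) (by linarith),
    posLog_of_le (by positivity) (by linarith)]
  ring

lemma logKernel_one_of_mem {s : ℂ} (h : 1 ≤ ‖s‖) (h' : ‖s‖ ≤ 2) :
    logKernel 1 s = Real.log 2 - Real.log ‖s‖ := by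
  rw [logKernel, posLog_of_le (by positivity) (by linarith), posLog_of_ge (by linarith)]
  simp

lemma logKernel_one_of_ge {s : ℂ} (h : 2 ≤ ‖s‖) : logKernel 1 s = 0 := by
  rw [logKernel, posLog_of_ge (by linarith), posLog_of_ge (by linarith), mul_one,
    Real.log_mul (by norm_num) (by positivity), Real.log_inv]
  simp

lemma logKernel_one_mem (s : ℂ) : 0 ≤ logKernel 1 s ∧ logKernel 1 s ≤ Real.log 2 := by
  have h2 : 0 ≤ Real.log 2 := Real.log_nonneg (by norm_num)
  rcases le_total ‖s‖ 1 with h | h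
  · rw [logKernel_one_of_le h]; exact ⟨h2, le_rfl⟩
  rcases le_total ‖s‖ 2 with h' | h'
  · rw [logKernel_one_of_mem h h']
    have h3 := Real.log_nonneg h
    have h4 := Real.log_le_log (by linarith) h'
    constructor <;> linarith
  · rw [logKernel_one_of_ge h']; exact ⟨le_rfl, h2⟩

lemma logKernel_nonneg {r : ℝ} (hr : 0 < r) (s : ℂ) : 0 ≤ logKernel r s := by
  rw [logKernel_scale hr]; exact (logKernel_one_mem _).1

lemma logKernel_le {r : ℝ} (hr : 0 < r) (s : ℂ) : logKernel r s ≤ Real.log 2 := by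
  rw [logKernel_scale hr]; exact (logKernel_one_mem _).2

lemma logKernel_of_ge {r : ℝ} (hr : 0 < r) {s : ℂ} (h : 2 * r ≤ ‖s‖) : logKernel r s = 0 := by
  rw [logKernel_scale hr]
  refine logKernel_one_of_ge ?_
  rw [norm_mul, norm_inv, Complex.norm_real, Real.norm_of_nonneg hr.le]
  field_simp
  linarith

lemma hasCompactSupport_logKernel {r : ℝ} (hr : 0 < r) : HasCompactSupport (logKernel r) :=
  HasCompactSupport.intro (isCompact_closedBall (0 : ℂ) (2 * r)) fun s hs => by
    refine logKernel_of_ge hr ?_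
    rw [mem_closedBall_zero_iff, not_le] at hs
    exact hs.le

/-- The kernel is `log 2` on the unit disc, `log (2 / |s|)` for `1 ≤ |s| ≤ 2` and zero beyond. In
polar coordinates the logarithms cancel, leaving `2π · 3/4`. -/
lemma integral_logKernel_one : ∫ s, logKernel 1 s = 3 * Real.pi / 2 := by
  set f : ℝ → ℝ := fun x => Real.log 2 + Real.posLog (2⁻¹ * x) - Real.posLog x with hf
  have hfc : Continuous f := by
    have := Real.continuous_posLog
    fun_prop
  have h1 : ∀ s : ℂ, logKernel 1 s = f ‖s‖ := fun s => by simp [logKernel, hf]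
  simp_rw [h1]
  rw [integral_fun_norm_addHaar volume f]
  simp only [Complex.finrank_real_complex, Measure.real, Complex.volume_ball]
  have h2 : ∫ y in Set.Ioi (0 : ℝ), y ^ (2 - 1) • f y = ∫ y in (0 : ℝ)..2, y * f y := by
    rw [intervalIntegral.integral_of_le (by norm_num)]
    symm
    rw [← setIntegral_eq_of_subset_of_forall_sdiff_eq_zero (s := Set.Ioc 0 2) (t := Set.Ioi 0)
      measurableSet_Ioi (fun x hx => hx.1)]
    · simp
    · intro x hx
      have hx2 : 2 ≤ x := by
        by_contra! h; exact hx.2 ⟨hx.1, h.le⟩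
      have := logKernel_one_of_ge (s := (x : ℂ)) (by simpa using hx2.trans (le_abs_self x))
      rw [h1, Complex.norm_real, Real.norm_of_nonneg (by linarith)] at this
      simp [this]
  have hcont : Continuous fun y => y * f y := by fun_prop
  have h3 : ∫ y in (0 : ℝ)..1, y * f y = Real.log 2 / 2 := by
    have : ∫ y in (0 : ℝ)..1, y * f y = ∫ y in (0 : ℝ)..1, y * Real.log 2 := by
      refine intervalIntegral.integral_congr fun y hy => ?_
      rw [Set.uIcc_of_le (by norm_num)] at hy
      have := logKernel_one_of_le (s := (y : ℂ)) (by simpa [abs_of_nonneg hy.1] using hy.2)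
      rw [h1, Complex.norm_real, Real.norm_of_nonneg hy.1] at this
      simp [this]
    rw [this]
    simp
    ring
  have h4 : ∫ y in (1 : ℝ)..2, y * f y = 3 / 4 - Real.log 2 / 2 := by
    have : ∫ y in (1 : ℝ)..2, y * f y =
        (2 ^ 2 / 2 * (Real.log 2 - Real.log 2) + 2 ^ 2 / 4) -
        (1 ^ 2 / 2 * (Real.log 2 - Real.log 1) + 1 ^ 2 / 4) := by
      refine intervalIntegral.integral_eq_sub_of_hasDerivAt
        (f := fun y => y ^ 2 / 2 * (Real.log 2 - Real.log y) + y ^ 2 / 4) (fun y hy => ?_)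
        (hcont.intervalIntegrable _ _)
      rw [Set.uIcc_of_le (by norm_num)] at hy
      have hy0 : y ≠ 0 := by linarith [hy.1]
      have e1 := logKernel_one_of_mem (s := (y : ℂ))
        (by simpa using hy.1.trans (le_abs_self y))
        (by simpa [abs_of_nonneg (by linarith [hy.1] : 0 ≤ y)] using hy.2)
      rw [h1, Complex.norm_real, Real.norm_of_nonneg (by linarith [hy.1])] at e1
      rw [e1]
      have d1 : HasDerivAt (fun y : ℝ => y ^ 2) (2 * y) y := by simpa using hasDerivAt_pow 2 y
      refine (((d1.div_const 2).mul ((Real.hasDerivAt_log hy0).const_sub (Real.log 2))).add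
        (d1.div_const 4)).congr_deriv ?_
      field_simp
      ring
    rw [this]
    simp
    ring
  rw [h2, ← intervalIntegral.integral_add_adjacent_intervals (b := 1)
    (hcont.intervalIntegrable _ _) (hcont.intervalIntegrable _ _), h3, h4]
  simp
  ring

lemma integral_logKernel {r : ℝ} (hr : 0 < r) : ∫ s, logKernel r s = 3 * Real.pi / 2 * r ^ 2 := by
  simp_rw [logKernel_scale hr]
  rw [integral_complex_smul (by simpa using hr.ne'), integral_logKernel_one]
  simp
  ring

lemma circleIntegrable_log_norm_polynomial (p : Polynomial ℂ) (c : ℂ) (R : ℝ) :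
    CircleIntegrable (fun t => Real.log ‖p.eval t‖) c R :=
  MeromorphicOn.circleIntegrable_log_norm fun _ _ =>
    (p.differentiable.analyticAt _).meromorphicAt

/-- The logarithm is additive only away from the zeros, but at most finitely many of these lie on
the circle. -/
lemma circleAverage_log_norm_mul {p q : Polynomial ℂ} (h : p * q ≠ 0) (c : ℂ) {R : ℝ}
    (hR : R ≠ 0) :
    Real.circleAverage (fun t => Real.log ‖(p * q).eval t‖) c R =
      Real.circleAverage (fun t => Real.log ‖p.eval t‖) c R +
      Real.circleAverage (fun t => Real.log ‖q.eval t‖) c R := by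
  rw [← Real.circleAverage_fun_add (circleIntegrable_log_norm_polynomial p c R)
    (circleIntegrable_log_norm_polynomial q c R)]
  refine Real.circleAverage_congr_codiscreteWithin ?_ hR
  filter_upwards [compl_finite_mem_codiscreteWithin (s := Metric.sphere c |R|)
    (p * q).roots.toFinset.finite_toSet] with t ht
  have ht' : (p * q).eval t ≠ 0 := fun h0 => ht (by
    rw [Finset.mem_coe, Multiset.mem_toFinset, Polynomial.mem_roots h]; exact h0)
  rw [Polynomial.eval_mul] at ht' ⊢
  rw [norm_mul, Real.log_mul (norm_ne_zero_iff.mpr (left_ne_zero_of_mul ht'))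
    (norm_ne_zero_iff.mpr (right_ne_zero_of_mul ht'))]

lemma circleAverage_log_norm_prod (s : Multiset ℂ) (c : ℂ) {R : ℝ} (hR : R ≠ 0) :
    Real.circleAverage
      (fun t => Real.log ‖((s.map fun a => Polynomial.X - Polynomial.C a).prod).eval t‖) c R =
      (s.map fun a => Real.log R + Real.posLog (R⁻¹ * ‖c - a‖)).sum := by
  induction s using Multiset.induction with
  | empty => simp [Real.circleAverage_const]
  | cons a s ih =>
    have h : (Polynomial.X - Polynomial.C a) * (s.map fun a => Polynomial.X - Polynomial.C a).prod
        ≠ 0 := by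
      rw [← Multiset.prod_cons, ← Multiset.map_cons (fun a => Polynomial.X - Polynomial.C a)]
      exact (Polynomial.monic_multisetProd_X_sub_C _).ne_zero
    rw [Multiset.map_cons, Multiset.prod_cons, circleAverage_log_norm_mul h c hR, ih,
      Multiset.map_cons, Multiset.sum_cons]
    simp only [Polynomial.eval_sub, Polynomial.eval_X, Polynomial.eval_C]
    rw [circleAverage_log_norm_sub_const_eq_log_radius_add_posLog hR]

/-- Jensen's formula for polynomials. -/
lemma circleAverage_log_norm_polynomial {p : Polynomial ℂ} (hp : p ≠ 0) (c : ℂ) {R : ℝ}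
    (hR : R ≠ 0) :
    Real.circleAverage (fun t => Real.log ‖p.eval t‖) c R = Real.log ‖p.leadingCoeff‖ +
      (p.roots.map fun a => Real.log R + Real.posLog (R⁻¹ * ‖c - a‖)).sum := by
  have h1 := (IsAlgClosed.splits p).eq_prod_roots
  have h2 := hp
  rw [h1] at h2
  rw [← circleAverage_log_norm_prod p.roots c hR]
  conv_lhs => rw [h1]
  rw [circleAverage_log_norm_mul h2 c hR]
  simp [Real.circleAverage_const]

/-- The difference of the circle averages of `f` of radii `2 r` and `r`. -/
def averageDiff (f : ℂ → ℝ) (r : ℝ) (c : ℂ) : ℝ :=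
  Real.circleAverage f c (2 * r) - Real.circleAverage f c r

/-- Taking the difference of two radii in Jensen's formula removes the leading coefficient. What
remains of each root is a continuous kernel with values in `[0, log 2]` that vanishes at distance
`2r` and beyond. -/
lemma averageDiff_log_norm {p : Polynomial ℂ} (hp : p ≠ 0) {r : ℝ} (hr : 0 < r) (c : ℂ) :
    averageDiff (fun t => Real.log ‖p.eval t‖) r c =
      (p.roots.map fun a => logKernel r (c - a)).sum := by
  rw [averageDiff, circleAverage_log_norm_polynomial hp c (by positivity),
    circleAverage_log_norm_polynomial hp c hr.ne', add_sub_add_left_eq_sub,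
    ← Multiset.sum_map_sub]
  congr 1
  refine Multiset.map_congr rfl fun a _ => ?_
  rw [logKernel, Real.log_mul (by norm_num) hr.ne']
  ring

lemma averageDiff_log_norm_mem {p : Polynomial ℂ} (hp : p ≠ 0) {r : ℝ} (hr : 0 < r) (c : ℂ) :
    |averageDiff (fun t => Real.log ‖p.eval t‖) r c| ≤ p.natDegree * Real.log 2 := by
  rw [averageDiff_log_norm hp hr, abs_of_nonneg]
  · have h1 := Multiset.sum_le_card_nsmul (p.roots.map fun a => logKernel r (c - a)) (Real.log 2)
      (fun x hx => by
        obtain ⟨a, -, rfl⟩ := Multiset.mem_map.mp hx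
        exact logKernel_le hr _)
    rw [Multiset.card_map, nsmul_eq_mul] at h1
    refine h1.trans (mul_le_mul_of_nonneg_right ?_ (Real.log_nonneg (by norm_num)))
    exact_mod_cast Polynomial.card_roots' p
  · refine Multiset.sum_nonneg fun x hx => ?_
    obtain ⟨a, -, rfl⟩ := Multiset.mem_map.mp hx
    exact logKernel_nonneg hr _

lemma continuous_averageDiff_log_norm {p : Polynomial ℂ} (hp : p ≠ 0) {r : ℝ} (hr : 0 < r) :
    Continuous (averageDiff (fun t => Real.log ‖p.eval t‖) r) := by
  rw [funext (averageDiff_log_norm hp hr)]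
  have := continuous_logKernel r
  exact continuous_multiset_sum _ fun a _ => by fun_prop

/-- Smoothing by the logarithmic kernel. -/
def smoothed (g : ℂ → ℂ) (r : ℝ) (a : ℂ) : ℂ := ∫ c, g c * logKernel r (c - a)

lemma integrable_mul_logKernel {g : ℂ → ℂ} (hg : Continuous g) (hgc : HasCompactSupport g)
    (r : ℝ) (a : ℂ) : Integrable fun c => g c * logKernel r (c - a) := by
  have := continuous_logKernel r
  exact Continuous.integrable_of_hasCompactSupport (by fun_prop) hgc.mul_right

lemma integral_mul_averageDiff {g : ℂ → ℂ} (hg : Continuous g) (hgc : HasCompactSupport g)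
    {p : Polynomial ℂ} (hp : p ≠ 0) {r : ℝ} (hr : 0 < r) :
    ∫ c, g c * averageDiff (fun t => Real.log ‖p.eval t‖) r c = rootSum p (smoothed g r) := by
  simp_rw [averageDiff_log_norm hp hr, rootSum]
  have h : ∀ s : Multiset ℂ,
      Integrable (fun c => g c * ((s.map fun a => logKernel r (c - a)).sum : ℝ)) ∧
      ∫ c, g c * ((s.map fun a => logKernel r (c - a)).sum : ℝ) = (s.map (smoothed g r)).sum := by
    intro s
    induction s using Multiset.induction with
    | empty => simp
    | cons a s ih =>
      simp only [Multiset.map_cons, Multiset.sum_cons, Complex.ofReal_add, mul_add]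
      have h1 := integrable_mul_logKernel hg hgc r a
      refine ⟨h1.add ih.1, ?_⟩
      rw [integral_add h1 ih.1, ih.2, smoothed]
  exact (h _).2

/-- The kernel is nonnegative, of mass `(3π/2) r²`, and supported in the disc of radius `2r`: up to
normalization it is an approximate identity. -/
lemma norm_smoothed_sub_le {g : ℂ → ℂ} (hg : Continuous g) (hgc : HasCompactSupport g) {r ε : ℝ}
    (hr : 0 < r) (hε : ∀ x y, ‖x - y‖ ≤ 2 * r → ‖g x - g y‖ ≤ ε) (a : ℂ) :
    ‖smoothed g r a - (3 * Real.pi / 2 * r ^ 2 : ℝ) * g a‖ ≤ 3 * Real.pi / 2 * r ^ 2 * ε := by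
  have hk : Integrable (logKernel r) :=
    (continuous_logKernel r).integrable_of_hasCompactSupport (hasCompactSupport_logKernel hr)
  have hka : Integrable fun c => logKernel r (c - a) := hk.comp_sub_right a
  have h1 : (3 * Real.pi / 2 * r ^ 2 : ℝ) * g a = ∫ c, g a * logKernel r (c - a) := by
    rw [integral_const_mul, integral_complex_ofReal, integral_sub_right_eq_self (logKernel r) a,
      integral_logKernel hr, mul_comm]
  have h2 : 3 * Real.pi / 2 * r ^ 2 * ε = ∫ c, ε * logKernel r (c - a) := by
    rw [integral_const_mul, integral_sub_right_eq_self (logKernel r) a, integral_logKernel hr,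
      mul_comm]
  have h3 : Integrable fun c => g a * (logKernel r (c - a) : ℂ) := hka.ofReal.const_mul _
  rw [h1, h2, smoothed, ← integral_sub (integrable_mul_logKernel hg hgc r a) h3]
  refine norm_integral_le_of_norm_le (hka.const_mul ε) (Eventually.of_forall fun c => ?_)
  rw [← sub_mul, norm_mul, Complex.norm_real, Real.norm_of_nonneg (logKernel_nonneg hr _)]
  rcases le_total ‖c - a‖ (2 * r) with h | h
  · exact mul_le_mul_of_nonneg_right (hε c a h) (logKernel_nonneg hr _)
  · rw [logKernel_of_ge hr h, mul_zero, mul_zero]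

/-! ### Equidistribution of zeros on a line -/

/-- On the circle `f = log q + log (1 - x)` with `|x| ≤ M R ≤ 1/2`, and `log (1 - x) = -x - x²/2 +
O(|x|³)`. The linear trigonometric terms average to zero, `-x` gives `R² a / q`, and `-x²/2` gives
`-R² |b|² / q² - R⁴ a² / (2 q²)`. The error `2 M³ R³` comes from the Taylor remainder, and `M² R³`
from the last term. -/
lemma circleAverage_log_quadratic {f : ℂ → ℝ} {c b : ℂ} {q a M R : ℝ} (hq : 0 < q) (ha : 0 ≤ a)
    (hR : 0 < R) (hR1 : R ≤ 1) (hM : (2 * ‖b‖ + a) / q ≤ M) (hMR : M * R ≤ 1 / 2)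
    (hf : Continuous f)
    (hfe : ∀ s, f (c + s) = Real.log (q + 2 * (s * b).re + ‖s‖ ^ 2 * a)) :
    |Real.circleAverage f c R - Real.log q - R ^ 2 * (a / q - ‖b‖ ^ 2 / q ^ 2)| ≤
      (2 * M ^ 3 + M ^ 2) * R ^ 3 := by
  have hM0 : 0 ≤ M := le_trans (by positivity) hM
  have hMq : 2 * ‖b‖ + a ≤ M * q := by rwa [div_le_iff₀ hq] at hM
  set x : ℝ → ℝ := fun θ => -(2 * (R * (b.re * Real.cos θ - b.im * Real.sin θ)) + R ^ 2 * a) / q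
    with hx
  set P : ℝ → ℝ := fun θ => Real.log q - x θ - x θ ^ 2 / 2 with hP
  have hfx : ∀ θ, f (circleMap c R θ) = Real.log (q * (1 - x θ)) := fun θ => by
    rw [circleMap, hfe]
    congr 1
    have e1 : ‖(R : ℂ) * Complex.exp (θ * Complex.I)‖ = R := by
      rw [norm_mul, Complex.norm_exp_ofReal_mul_I, mul_one, Complex.norm_real,
        Real.norm_of_nonneg hR.le]
    have e2 : ((R : ℂ) * Complex.exp (θ * Complex.I) * b).re =
        R * (b.re * Real.cos θ - b.im * Real.sin θ) := by
      rw [mul_assoc, Complex.re_ofReal_mul, Complex.mul_re, Complex.exp_ofReal_mul_I_re,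
        Complex.exp_ofReal_mul_I_im]
      ring
    rw [e1, e2, hx]
    field_simp
    ring
  have hxb : ∀ θ, |x θ| ≤ M * R := fun θ => by
    rw [hx, abs_div, abs_neg, abs_of_pos hq, div_le_iff₀ hq]
    have e1 : |b.re * Real.cos θ - b.im * Real.sin θ| ≤ ‖b‖ := by
      have : b.re * Real.cos θ - b.im * Real.sin θ = (b * Complex.exp (θ * Complex.I)).re := by
        rw [Complex.mul_re, Complex.exp_ofReal_mul_I_re, Complex.exp_ofReal_mul_I_im]
      rw [this]
      refine (Complex.abs_re_le_norm _).trans ?_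
      rw [norm_mul, Complex.norm_exp_ofReal_mul_I, mul_one]
    calc _ ≤ |2 * (R * (b.re * Real.cos θ - b.im * Real.sin θ))| + |R ^ 2 * a| := abs_add_le _ _
      _ = 2 * R * |b.re * Real.cos θ - b.im * Real.sin θ| + R ^ 2 * a := by
          rw [abs_mul, abs_mul, abs_of_pos hR, abs_of_nonneg (by positivity : 0 ≤ R ^ 2 * a), abs_two]
          ring
      _ ≤ 2 * R * ‖b‖ + R * a := by
          gcongr
          nlinarith
      _ = R * (2 * ‖b‖ + a) := by ring
      _ ≤ R * (M * q) := by gcongr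
      _ = _ := by ring
  have hdiff : ∀ θ, ‖f (circleMap c R θ) - P θ‖ ≤ 2 * M ^ 3 * R ^ 3 := fun θ => by
    have h1 : |x θ| ≤ 1 / 2 := (hxb θ).trans hMR
    have h2 := Real.abs_log_sub_add_sum_range_le (x := x θ) (by linarith) 2
    have h3 : 0 < 1 - x θ := by linarith [le_abs_self (x θ)]
    rw [hfx, Real.log_mul hq.ne' h3.ne', hP, Real.norm_eq_abs]
    have e1 : Real.log q + Real.log (1 - x θ) - (Real.log q - x θ - x θ ^ 2 / 2) =
        (∑ i ∈ Finset.range 2, x θ ^ (i + 1) / (i + 1)) + Real.log (1 - x θ) := by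
      simp [Finset.sum_range_succ]
      ring
    simp only
    rw [e1]
    refine h2.trans ?_
    rw [div_le_iff₀ (by linarith)]
    have h4 : |x θ| ^ 3 ≤ (M * R) ^ 3 := by gcongr; exact hxb θ
    have h5 : 0 ≤ (M * R) ^ 3 := by positivity
    have h6 : |x θ| ^ (2 + 1) = |x θ| ^ 3 := rfl
    rw [h6]
    nlinarith
  have hPc : Continuous P := by
    have : Continuous x := by
      rw [hx]
      fun_prop
    fun_prop
  have hfc : Continuous fun θ => f (circleMap c R θ) := hf.comp (continuous_circleMap c R)
  have hPint : ∫ θ in (0 : ℝ)..2 * Real.pi, P θ = 2 * Real.pi *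
      (Real.log q + R ^ 2 * (a / q - ‖b‖ ^ 2 / q ^ 2) - R ^ 4 * a ^ 2 / (2 * q ^ 2)) := by
    have hb2 : ‖b‖ ^ 2 = b.re ^ 2 + b.im ^ 2 := by
      rw [← Complex.normSq_eq_norm_sq, Complex.normSq_apply]; ring
    have e1 : ∀ θ, P θ = (Real.log q + R ^ 2 * a / q - R ^ 4 * a ^ 2 / (2 * q ^ 2)) +
        (2 * R * b.re / q - 2 * R ^ 3 * a * b.re / q ^ 2) * Real.cos θ +
        (- (2 * R * b.im / q) + 2 * R ^ 3 * a * b.im / q ^ 2) * Real.sin θ +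
        (-(2 * R ^ 2 * b.re ^ 2 / q ^ 2)) * Real.cos θ ^ 2 +
        (-(2 * R ^ 2 * b.im ^ 2 / q ^ 2)) * Real.sin θ ^ 2 +
        (4 * R ^ 2 * b.re * b.im / q ^ 2) * (Real.sin θ * Real.cos θ) := fun θ => by
      rw [hP, hx]
      field_simp
      ring
    simp_rw [e1]
    have ii : ∀ g : ℝ → ℝ, Continuous g → IntervalIntegrable g volume 0 (2 * Real.pi) :=
      fun g hg => hg.intervalIntegrable _ _
    rw [intervalIntegral.integral_add (ii _ (by fun_prop)) (ii _ (by fun_prop)),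
      intervalIntegral.integral_add (ii _ (by fun_prop)) (ii _ (by fun_prop)),
      intervalIntegral.integral_add (ii _ (by fun_prop)) (ii _ (by fun_prop)),
      intervalIntegral.integral_add (ii _ (by fun_prop)) (ii _ (by fun_prop)),
      intervalIntegral.integral_add (ii _ (by fun_prop)) (ii _ (by fun_prop))]
    simp only [intervalIntegral.integral_const_mul, integral_cos, integral_sin, integral_cos_sq,
      integral_sin_sq, integral_sin_mul_cos₁, intervalIntegral.integral_const]
    simp
    rw [hb2]
    field_simp
    ring
  have hpi := Real.pi_pos
  have h1 : Real.circleAverage f c R - Real.log q - R ^ 2 * (a / q - ‖b‖ ^ 2 / q ^ 2) =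
      (2 * Real.pi)⁻¹ * (∫ θ in (0 : ℝ)..2 * Real.pi, f (circleMap c R θ) - P θ) -
        R ^ 4 * a ^ 2 / (2 * q ^ 2) := by
    rw [intervalIntegral.integral_sub (hfc.intervalIntegrable _ _) (hPc.intervalIntegrable _ _),
      hPint, Real.circleAverage_def, smul_eq_mul]
    field_simp
    ring
  have h2 : ‖∫ θ in (0 : ℝ)..2 * Real.pi, f (circleMap c R θ) - P θ‖ ≤
      2 * M ^ 3 * R ^ 3 * |2 * Real.pi - 0| :=
    intervalIntegral.norm_integral_le_of_norm_le_const fun θ _ => hdiff θ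
  rw [sub_zero, abs_of_pos (by positivity), Real.norm_eq_abs] at h2
  have h3 : R ^ 4 * a ^ 2 / (2 * q ^ 2) ≤ M ^ 2 * R ^ 3 := by
    have e1 : a ≤ M * q := by linarith [norm_nonneg b]
    have e2 : a ^ 2 ≤ (M * q) ^ 2 := by gcongr
    have e3 : R ^ 4 ≤ R ^ 3 := pow_le_pow_of_le_one hR.le hR1 (by norm_num)
    rw [div_le_iff₀ (by positivity)]
    calc R ^ 4 * a ^ 2 ≤ R ^ 3 * (M * q) ^ 2 := by gcongr
      _ ≤ M ^ 2 * R ^ 3 * (2 * q ^ 2) := by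
        have : 0 ≤ M ^ 2 * R ^ 3 * q ^ 2 := by positivity
        nlinarith
  rw [h1]
  refine (abs_sub _ _).trans ?_
  rw [abs_mul, abs_of_pos (by positivity : 0 < (2 * Real.pi)⁻¹),
    abs_of_nonneg (by positivity : 0 ≤ R ^ 4 * a ^ 2 / (2 * q ^ 2)), add_mul]
  refine add_le_add ?_ h3
  rw [inv_mul_le_iff₀ (by positivity)]
  linarith

/-- Half the logarithm of the squared norm along a line. -/
def halfLog {n : ℕ} (w u : Coord n) (t : ℂ) : ℝ := 1 / 2 * Real.log (nsq (w + t • u))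

lemma continuous_halfLog {n : ℕ} {w u : Coord n} (h : ∀ t : ℂ, w + t • u ≠ 0) :
    Continuous (halfLog w u) := by
  have h1 := continuous_nsq (n := n)
  exact continuous_const.mul (Continuous.log (by fun_prop) fun t => (nsq_pos (h t)).ne')

lemma continuous_fsDensity_line {n : ℕ} {w u : Coord n} (h : ∀ t : ℂ, w + t • u ≠ 0) :
    Continuous fun t : ℂ => fsDensity (w + t • u) u :=
  (continuousOn_fsDensity u).comp_continuous (by fun_prop) h

lemma circleAverage_halfLog {n : ℕ} {w u : Coord n} (h : ∀ t : ℂ, w + t • u ≠ 0) {K : Set ℂ}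
    (hK : IsCompact K) :
    ∃ C R₀ : ℝ, 0 ≤ C ∧ 0 < R₀ ∧ ∀ c ∈ K, ∀ R, 0 < R → R ≤ R₀ →
      |Real.circleAverage (halfLog w u) c R - halfLog w u c -
        Real.pi / 2 * R ^ 2 * fsDensity (w + c • u) u| ≤ C * R ^ 3 := by
  have hnsq := continuous_nsq (n := n)
  have hherm := continuous_herm u
  have hq : ∀ c : ℂ, 0 < nsq (w + c • u) := fun c => nsq_pos (h c)
  have ha : 0 ≤ nsq u := Finset.sum_nonneg fun _ _ => by positivity
  have hcont : Continuous fun c : ℂ => (2 * ‖herm (w + c • u) u‖ + nsq u) / nsq (w + c • u) :=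
    Continuous.div (by fun_prop) (by fun_prop) fun c => (hq c).ne'
  obtain ⟨M, hM⟩ := hK.exists_bound_of_continuousOn hcont.continuousOn
  set M' := max M 1
  have hM' : 1 ≤ M' := le_max_right _ _
  -- The radius bound ensures `M' R ≤ 1/2`, and `R ≤ 1` follows from `M' ≥ 1`. The constants are
  -- uniform in `c` because `M'` bounds the continuous quotient on the compact set `K`.
  refine ⟨2 * M' ^ 3 + M' ^ 2, 1 / (2 * M'), by positivity, by positivity, fun c hc R hR hR0 => ?_⟩
  have hMR : M' * R ≤ 1 / 2 := by
    rw [le_div_iff₀ (by positivity)] at hR0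
    linarith
  have hR1 : R ≤ 1 := by nlinarith
  have hlog : Continuous fun t : ℂ => Real.log (nsq (w + t • u)) :=
    Continuous.log (by fun_prop) fun t => (hq t).ne'
  have key := circleAverage_log_quadratic (f := fun t => Real.log (nsq (w + t • u))) (c := c)
    (b := herm (w + c • u) u) (M := M') (hq c) ha hR hR1
    (((le_abs_self _).trans (hM c hc)).trans (le_max_left _ _)) hMR hlog (fun s => by
      rw [add_smul, ← add_assoc, nsq_add, herm_smul_right, nsq_smul])
  have e1 : Real.circleAverage (halfLog w u) c R =
      1 / 2 * Real.circleAverage (fun t => Real.log (nsq (w + t • u))) c R := by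
    have := Real.circleAverage_fun_smul (a := (1 / 2 : ℝ)) (c := c) (R := R)
      (f := fun t : ℂ => Real.log (nsq (w + t • u)))
    exact this
  have e2 : Real.pi / 2 * R ^ 2 * fsDensity (w + c • u) u = 1 / 2 * (R ^ 2 *
      (nsq u / nsq (w + c • u) - ‖herm (w + c • u) u‖ ^ 2 / nsq (w + c • u) ^ 2)) := by
    rw [fsDensity]
    have := (hq c).ne'
    have := Real.pi_pos.ne'
    field_simp
  rw [e1, e2, halfLog, ← mul_sub, ← mul_sub, abs_mul, abs_of_pos (by norm_num : (0 : ℝ) < 1 / 2)]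
  have : 0 ≤ (2 * M' ^ 3 + M' ^ 2) * R ^ 3 := by positivity
  linarith

/-- The constant is `(π/2)((2r)² - r²)`, which equals the mass of `logKernel r`. The error constant
is `8C + C`. -/
lemma averageDiff_halfLog {n : ℕ} {w u : Coord n} (h : ∀ t : ℂ, w + t • u ≠ 0) {K : Set ℂ}
    (hK : IsCompact K) :
    ∃ C R₀ : ℝ, 0 ≤ C ∧ 0 < R₀ ∧ ∀ c ∈ K, ∀ r, 0 < r → r ≤ R₀ →
      |averageDiff (halfLog w u) r c - 3 * Real.pi / 2 * r ^ 2 * fsDensity (w + c • u) u| ≤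
        C * r ^ 3 := by
  obtain ⟨C, R₀, hC, hR₀, H⟩ := circleAverage_halfLog h hK
  refine ⟨9 * C, R₀ / 2, by positivity, by positivity, fun c hc r hr hr0 => ?_⟩
  have h1 := H c hc (2 * r) (by positivity) (by linarith)
  have h2 := H c hc r hr (by linarith)
  rw [averageDiff]
  rw [abs_le] at h1 h2 ⊢
  constructor <;> nlinarith

lemma rootSum_sub (p : Polynomial ℂ) (f g : ℂ → ℂ) :
    rootSum p (fun t => f t - g t) = rootSum p f - rootSum p g := by
  rw [rootSum, Multiset.sum_map_sub]; rfl

lemma rootSum_const_mul (p : Polynomial ℂ) (c : ℂ) (f : ℂ → ℂ) :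
    rootSum p (fun t => c * f t) = c * rootSum p f := by
  rw [rootSum, Multiset.sum_map_mul_left]; rfl

/-- Equidistribution of the zeros of polynomials from convergence of circle averages. -/
lemma tendsto_rootSum {n : ℕ} {w u : Coord n} (h : ∀ t : ℂ, w + t • u ≠ 0) {p : ℕ → Polynomial ℂ}
    (hp0 : ∀ N, 1 ≤ N → p N ≠ 0) (hpd : ∀ N, 1 ≤ N → (p N).natDegree ≤ N)
    (hconv : ∀ k : ℕ, ∀ᵐ c : ℂ, Tendsto (fun N : ℕ => 1 / (N : ℝ) *
      averageDiff (fun t => Real.log ‖(p N).eval t‖) (1 / ((k : ℝ) + 1)) c) atTop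
      (𝓝 (averageDiff (halfLog w u) (1 / ((k : ℝ) + 1)) c)))
    {g : ℂ → ℂ} (hg : Continuous g) (hgc : HasCompactSupport g) :
    Tendsto (fun N : ℕ => (1 / (N : ℂ)) * rootSum (p N) g) atTop
      (𝓝 (∫ t, g t * fsDensity (w + t • u) u)) := by
  obtain ⟨C, R₀, hC, hR₀, H⟩ := averageDiff_halfLog h hgc.isCompact
  have hfs := continuous_fsDensity_line h
  have hgi : Integrable g := hg.integrable_of_hasCompactSupport hgc
  have hgfs : Integrable fun t => g t * fsDensity (w + t • u) u :=
    Continuous.integrable_of_hasCompactSupport (by fun_prop) hgc.mul_right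
  have hlog2 : 0 ≤ Real.log 2 := Real.log_nonneg (by norm_num)
  have hpi := Real.pi_pos
  rw [Metric.tendsto_atTop]
  intro ε' hε'
  -- After division by `κ`, three errors of size `ε` occur: replacing `g` by its smoothing in the
  -- sum over roots, convergence in `N`, and the expansion of the limit.
  set ε := ε' / 4 with hεdef
  have hε : 0 < ε := by positivity
  obtain ⟨δ, hδ, hgδ⟩ := Metric.uniformContinuous_iff.mp (hgc.uniformContinuous_of_continuous hg) ε hε
  set B := ∫ t, ‖g t‖ with hB
  have hB0 : 0 ≤ B := integral_nonneg fun _ => norm_nonneg _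
  -- The scale `r` is small enough for the modulus of continuity of `g` at distance `2r`, for the
  -- expansion of `halfLog`, and for the cubic error `C B r³` to be at most `κ ε`.
  obtain ⟨k, hk⟩ := exists_nat_one_div_lt (K := ℝ) (ε := min (δ / 2) (min R₀ (ε / (C * B + 1))))
    (by positivity)
  set r : ℝ := 1 / ((k : ℝ) + 1) with hr
  have hr0 : 0 < r := by positivity
  rw [lt_min_iff, lt_min_iff] at hk
  set κ : ℝ := 3 * Real.pi / 2 * r ^ 2 with hκ
  have hκ0 : 0 < κ := by positivity
  have hF : ∀ N : ℕ, 1 ≤ N → ∀ c, ‖g c * ((1 / (N : ℝ) *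
      averageDiff (fun t => Real.log ‖(p N).eval t‖) r c : ℝ) : ℂ)‖ ≤ ‖g c‖ * Real.log 2 := by
    intro N hN c
    have hN' : (0 : ℝ) < N := by exact_mod_cast hN
    rw [norm_mul, Complex.norm_real, Real.norm_eq_abs, abs_mul, abs_of_pos (by positivity)]
    refine mul_le_mul_of_nonneg_left ?_ (norm_nonneg _)
    have h1 := averageDiff_log_norm_mem (hp0 N hN) hr0 c
    have h2 : ((p N).natDegree : ℝ) ≤ N := by exact_mod_cast hpd N hN
    have h3 : |averageDiff (fun t => Real.log ‖(p N).eval t‖) r c| ≤ N * Real.log 2 :=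
      h1.trans (mul_le_mul_of_nonneg_right h2 hlog2)
    rw [div_mul_eq_mul_div, one_mul, div_le_iff₀ hN']
    linarith
  have hmeas : ∀ N : ℕ, 1 ≤ N → AEStronglyMeasurable (fun c => g c * ((1 / (N : ℝ) *
      averageDiff (fun t => Real.log ‖(p N).eval t‖) r c : ℝ) : ℂ)) volume := by
    intro N hN
    have := continuous_averageDiff_log_norm (hp0 N hN) hr0
    exact Continuous.aestronglyMeasurable (by fun_prop)
  have hlim : ∀ᵐ c : ℂ, Tendsto (fun N : ℕ => g c * ((1 / (N : ℝ) *
      averageDiff (fun t => Real.log ‖(p N).eval t‖) r c : ℝ) : ℂ)) atTop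
      (𝓝 (g c * (averageDiff (halfLog w u) r c : ℝ))) := by
    filter_upwards [hconv k] with c hc
    exact ((Complex.continuous_ofReal.tendsto _).comp hc).const_mul (g c)
  have hev1 : ∀ᶠ N : ℕ in atTop, 1 ≤ N := eventually_ge_atTop 1
  have hbound : Integrable fun c => ‖g c‖ * Real.log 2 := hgi.norm.mul_const _
  -- With `r` fixed, let `N → ∞`. The degree bound makes the averages at most `log 2` after division
  -- by `N`, so `|g| log 2` dominates.
  have hS := tendsto_integral_filter_of_dominated_convergence _ (hev1.mono hmeas)
    (hev1.mono fun N hN => Eventually.of_forall (hF N hN)) hbound hlim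
  have hLint : Integrable fun c => g c * (averageDiff (halfLog w u) r c : ℂ) := by
    refine hbound.mono' ?_ ?_
    · refine aestronglyMeasurable_of_tendsto_ae atTop (f := fun (N : ℕ) c => g c *
        ((1 / ((N + 1 : ℕ) : ℝ) * averageDiff (fun t => Real.log ‖(p (N + 1)).eval t‖) r c : ℝ) : ℂ))
        (fun N => hmeas (N + 1) (by omega)) (hlim.mono fun c hc => hc.comp (tendsto_add_atTop_nat 1))
    · filter_upwards [hlim] with c hc
      exact le_of_tendsto hc.norm (hev1.mono fun N hN => hF N hN c)
  have hL : ‖(∫ c, g c * (averageDiff (halfLog w u) r c : ℂ)) -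
      κ * ∫ t, g t * fsDensity (w + t • u) u‖ ≤ κ * ε := by
    rw [← integral_const_mul, ← integral_sub hLint (hgfs.const_mul _)]
    have h1 : ∀ c, ‖g c * (averageDiff (halfLog w u) r c : ℂ) -
        κ * (g c * fsDensity (w + c • u) u)‖ ≤ ‖g c‖ * (C * r ^ 3) := by
      intro c
      have e1 : g c * (averageDiff (halfLog w u) r c : ℂ) - κ * (g c * fsDensity (w + c • u) u) =
          g c * ((averageDiff (halfLog w u) r c - κ * fsDensity (w + c • u) u : ℝ) : ℂ) := by
        push_cast; ring
      rw [e1, norm_mul, Complex.norm_real, Real.norm_eq_abs]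
      by_cases hc : c ∈ tsupport g
      · exact mul_le_mul_of_nonneg_left (H c hc r hr0 hk.2.1.le) (norm_nonneg _)
      · simp [image_eq_zero_of_notMem_tsupport hc]
    refine (norm_integral_le_of_norm_le (hgi.norm.mul_const _) (Eventually.of_forall h1)).trans ?_
    rw [integral_mul_const, ← hB]
    have h2 : r * (C * B + 1) ≤ ε := by
      have := hk.2.2.le
      rwa [le_div_iff₀ (by positivity)] at this
    have h3 : C * B * r ≤ ε := by nlinarith
    have h4 : (1 : ℝ) ≤ 3 * Real.pi / 2 := by nlinarith [Real.pi_gt_three]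
    calc B * (C * r ^ 3) = r ^ 2 * (C * B * r) := by ring
      _ ≤ r ^ 2 * ε := by gcongr
      _ ≤ κ * ε := by
        rw [hκ]
        have : 0 ≤ r ^ 2 * ε := by positivity
        nlinarith
  obtain ⟨N₀, hN₀⟩ := Metric.tendsto_atTop.mp hS (κ * ε) (by positivity)
  refine ⟨max N₀ 1, fun N hN => ?_⟩
  have hN1 : 1 ≤ N := (le_max_right _ _).trans hN
  have hNpos : (0 : ℝ) < N := by exact_mod_cast hN1
  have h1 := hN₀ N ((le_max_left _ _).trans hN)
  have h2 : ∫ c, g c * ((1 / (N : ℝ) *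
      averageDiff (fun t => Real.log ‖(p N).eval t‖) r c : ℝ) : ℂ) =
      (1 / (N : ℂ)) * rootSum (p N) (smoothed g r) := by
    rw [← integral_mul_averageDiff hg hgc (hp0 N hN1) hr0, ← integral_const_mul]
    congr 1
    ext c
    push_cast
    ring
  rw [h2, dist_eq_norm] at h1
  have h3 : ‖(1 / (N : ℂ)) * rootSum (p N) (smoothed g r) -
      κ * ((1 / (N : ℂ)) * rootSum (p N) g)‖ ≤ κ * ε := by
    have e1 : (1 / (N : ℂ)) * rootSum (p N) (smoothed g r) -
      κ * ((1 / (N : ℂ)) * rootSum (p N) g) =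
      (1 / (N : ℂ)) * rootSum (p N) (fun t => smoothed g r t - κ * g t) := by
      rw [rootSum_sub, rootSum_const_mul]; ring
    rw [e1, norm_mul]
    have h4 := norm_rootSum_le (p N) (fun t => smoothed g r t - κ * g t) (C := κ * ε)
      (by positivity) (fun t _ => norm_smoothed_sub_le hg hgc hr0 (fun x y hxy => by
        have := hgδ (a := x) (b := y) (by rw [dist_eq_norm]; linarith [hk.1])
        rw [dist_eq_norm] at this
        exact this.le) t)
    have h5 : ((p N).natDegree : ℝ) ≤ N := by exact_mod_cast hpd N hN1
    rw [norm_div, norm_one, Complex.norm_natCast, div_mul_eq_mul_div, one_mul, div_le_iff₀ hNpos]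
    refine h4.trans ?_
    rw [mul_comm]
    gcongr
  rw [dist_eq_norm]
  have h6 : ‖(κ : ℂ) * ((1 / (N : ℂ)) * rootSum (p N) g - ∫ t, g t * fsDensity (w + t • u) u)‖ ≤
      3 * (κ * ε) := by
    have e1 : (κ : ℂ) * ((1 / (N : ℂ)) * rootSum (p N) g - ∫ t, g t * fsDensity (w + t • u) u) =
      -((1 / (N : ℂ)) * rootSum (p N) (smoothed g r) - κ * ((1 / (N : ℂ)) * rootSum (p N) g)) +
      ((1 / (N : ℂ)) * rootSum (p N) (smoothed g r) -
        ∫ c, g c * (averageDiff (halfLog w u) r c : ℂ)) +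
      ((∫ c, g c * (averageDiff (halfLog w u) r c : ℂ)) -
        κ * ∫ t, g t * fsDensity (w + t • u) u) := by ring
    rw [e1]
    refine (norm_add₃_le).trans ?_
    rw [norm_neg]
    linarith
  rw [norm_mul, Complex.norm_real, Real.norm_of_nonneg hκ0.le] at h6
  have h7 : ‖(1 / (N : ℂ)) * rootSum (p N) g - ∫ t, g t * fsDensity (w + t • u) u‖ ≤ 3 * ε := by
    by_contra! hcon
    nlinarith
  linarith

/-! ### From potentials to zeros -/

/-- The exceptional `w` lie in the complex span of `u`, of dimension at most one in a space of
dimension `n + 2`, hence null. Nothing is assumed of `u`, which may be zero. -/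
lemma ae_line_ne_zero {n : ℕ} (u : Coord n) : ∀ᵐ w : Coord n, ∀ t : ℂ, w + t • u ≠ 0 := by
  set S : Submodule ℝ (Coord n) := (Submodule.span ℂ {u}).restrictScalars ℝ
  have hS : S ≠ ⊤ := by
    intro h
    have h1 : Submodule.span ℂ {u} = ⊤ := by
      rwa [Submodule.restrictScalars_eq_top_iff] at h
    have h2 := finrank_span_le_card (R := ℂ) ({u} : Set (Coord n))
    rw [h1, finrank_top, Module.finrank_fin_fun] at h2
    simp at h2
  have h0 : volume (S : Set (Coord n)) = 0 := Measure.addHaar_submodule volume S hS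
  have h1 : ∀ᵐ w : Coord n, w ∉ S := by
    rw [ae_iff]
    simpa using h0
  filter_upwards [h1] with w hw t ht
  refine hw ?_
  have : w = (-t) • u := by
    rw [neg_smul]; exact eq_neg_of_add_eq_zero_left ht
  change w ∈ Submodule.span ℂ {u}
  rw [this]
  exact Submodule.smul_mem _ _ (Submodule.mem_span_singleton_self u)

/-- The deviation of the normalized logarithm of `|P|` from the potential of the Fubini-Study
form. -/
def logDev {n : ℕ} (N : ℕ) (P : MvPolynomial (Fin (n + 2)) ℂ) (w : Coord n) : ℝ :=
  1 / (N : ℝ) * Real.log ‖MvPolynomial.eval w P‖ + Real.log (N.factorial) / (2 * N) -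
    1 / 2 * Real.log (nsq w)

lemma measurable_logDev {n : ℕ} (N : ℕ) (P : MvPolynomial (Fin (n + 2)) ℂ) :
    Measurable (logDev N P) := by
  have h1 := (continuous_nsq (n := n)).measurable
  have h2 := (MvPolynomial.continuous_eval P).measurable
  unfold logDev
  fun_prop

lemma setLIntegral_ball_add_le {n : ℕ} {f : Coord n → ENNReal} {v : Coord n} {R R' : ℝ}
    (h : R + ‖v‖ ≤ R') :
    ∫⁻ w in Metric.ball 0 R, f (w + v) ≤ ∫⁻ w in Metric.ball 0 R', f w := by
  rw [← lintegral_indicator measurableSet_ball, ← lintegral_indicator measurableSet_ball,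
    ← lintegral_add_right_eq_self ((Metric.ball 0 R').indicator _) v]
  refine lintegral_mono fun w => ?_
  by_cases hw : w ∈ Metric.ball (0 : Coord n) R
  · rw [Set.indicator_of_mem hw, Set.indicator_of_mem]
    rw [mem_ball_zero_iff] at hw ⊢
    linarith [norm_add_le w v]
  · rw [Set.indicator_of_notMem hw]
    exact zero_le

/-- By Tonelli, integrating the circle integrals over the ball of radius `R` costs at most `2π`
times the integral over a ball large enough to contain all translates. A sum with finite integral is
finite almost everywhere. -/
lemma ae_tsum_circle_ne_top {n : ℕ} {F : ℕ → Coord n → ENNReal} (hF : ∀ N, Measurable (F N))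
    (hX : ∀ R : ℕ, ∑' N, ∫⁻ w in Metric.ball 0 R, F N w ≠ ⊤) (u : Coord n) (ρ : ℝ) :
    ∀ᵐ w : Coord n, ∑' N, ∫⁻ θ in Set.Ioc 0 (2 * Real.pi), F N (w + circleMap 0 ρ θ • u) ≠ ⊤ := by
  have hm : ∀ N, Measurable fun p : Coord n × ℝ => F N (p.1 + circleMap 0 ρ p.2 • u) := fun N => by
    refine (hF N).comp ?_
    have := continuous_circleMap 0 ρ
    exact Continuous.measurable (by fun_prop)
  have key : ∀ R : ℕ, ∀ᵐ w : Coord n, w ∈ Metric.ball (0 : Coord n) R →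
      ∑' N, ∫⁻ θ in Set.Ioc 0 (2 * Real.pi), F N (w + circleMap 0 ρ θ • u) ≠ ⊤ := by
    intro R
    obtain ⟨R', hR'⟩ := exists_nat_ge (R + |ρ| * ‖u‖)
    have hmi : ∀ N, Measurable fun w : Coord n =>
        ∫⁻ θ in Set.Ioc 0 (2 * Real.pi), F N (w + circleMap 0 ρ θ • u) := fun N =>
      (hm N).lintegral_prod_right'
    rw [← ae_restrict_iff' measurableSet_ball]
    refine (ae_lt_top (Measurable.tsum hmi) ?_).mono fun w hw => hw.ne
    rw [lintegral_tsum fun N => (hmi N).aemeasurable]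
    refine ne_top_of_le_ne_top (ENNReal.mul_ne_top (ENNReal.ofReal_ne_top (r := 2 * Real.pi))
      (hX R')) ?_
    rw [← ENNReal.tsum_mul_left]
    refine ENNReal.tsum_le_tsum fun N => ?_
    rw [lintegral_lintegral_swap (hm N).aemeasurable]
    calc _ ≤ ∫⁻ θ in Set.Ioc 0 (2 * Real.pi), ∫⁻ w in Metric.ball 0 R', F N w := by
          refine lintegral_mono fun θ => setLIntegral_ball_add_le ?_
          rw [norm_smul, norm_circleMap_zero]
          exact hR'
      _ = _ := by
          rw [setLIntegral_const, Real.volume_Ioc, mul_comm, sub_zero]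
  have key' := ae_all_iff.mpr key
  filter_upwards [key'] with w hw
  obtain ⟨R, hR⟩ := exists_nat_gt ‖w‖
  exact hw R (by simpa using hR)

/-- Since `|x| ≤ 1/√N + √N x²`, the integral is bounded by a null sequence plus the general term of
a convergent series. This is why the weight `√N` is carried along. -/
lemma tendsto_integral_of_sq {f : ℕ → ℝ → ℝ} {ν : Measure ℝ} [IsFiniteMeasure ν]
    (hf : ∑' N : ℕ, ∫⁻ θ, ENNReal.ofReal (√N * f N θ ^ 2) ∂ν ≠ ⊤) :
    Tendsto (fun N => ∫ θ, f N θ ∂ν) atTop (𝓝 0) := by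
  have h1 := ENNReal.tendsto_atTop_zero_of_tsum_ne_top hf
  have h2 : Tendsto (fun N : ℕ => ENNReal.ofReal (1 / √N) * ν Set.univ) atTop (𝓝 0) := by
    have : Tendsto (fun N : ℕ => 1 / √(N : ℝ)) atTop (𝓝 0) :=
      tendsto_const_nhds.div_atTop (Real.tendsto_sqrt_atTop.comp tendsto_natCast_atTop_atTop)
    have h3 := ENNReal.Tendsto.mul_const (b := ν Set.univ) (ENNReal.tendsto_ofReal this)
      (Or.inr (measure_ne_top _ _))
    simpa using h3
  have h3 := h2.add h1
  rw [add_zero] at h3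
  have h4 : Tendsto (fun N => ‖∫ θ, f N θ ∂ν‖ₑ) atTop (𝓝 0) := by
    refine tendsto_of_tendsto_of_tendsto_of_le_of_le' tendsto_const_nhds h3
      (Eventually.of_forall fun N => zero_le) ?_
    filter_upwards [eventually_ge_atTop 1] with N hN
    have hN' : (0 : ℝ) < √N := Real.sqrt_pos.mpr (by exact_mod_cast hN)
    refine (enorm_integral_le_lintegral_enorm _).trans ?_
    rw [← lintegral_const, ← lintegral_add_left measurable_const]
    refine lintegral_mono fun θ => ?_
    rw [← ENNReal.ofReal_add (by positivity) (by positivity), Real.enorm_eq_ofReal_abs]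
    refine ENNReal.ofReal_le_ofReal ?_
    have h5 : 0 ≤ (√N * |f N θ| - 1) ^ 2 := sq_nonneg _
    rw [← sq_abs (f N θ), ← sub_nonneg]
    have h6 : 1 / √N + √N * |f N θ| ^ 2 - |f N θ| =
        ((√N * |f N θ| - 1) ^ 2 + √N * |f N θ|) / √N := by
      field_simp
      ring
    rw [h6]
    positivity
  rw [tendsto_zero_iff_norm_tendsto_zero]
  have := (ENNReal.tendsto_toReal (by simp)).comp h4
  simpa [Function.comp_def] using this

lemma tendsto_circleAverage {n : ℕ} {F : ℕ → Coord n → ℝ} (hF : ∀ N, Measurable (F N))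
    (hX : ∀ R : ℕ, ∑' N : ℕ, ∫⁻ w in Metric.ball 0 R, ENNReal.ofReal (√N * F N w ^ 2) ≠ ⊤)
    (u : Coord n) (ρ : ℝ) :
    ∀ᵐ w : Coord n,
      Tendsto (fun N => Real.circleAverage (fun t => F N (w + t • u)) 0 ρ) atTop (𝓝 0) := by
  have h1 := ae_tsum_circle_ne_top (F := fun N w => ENNReal.ofReal (√N * F N w ^ 2))
    (fun N => by have := hF N; fun_prop) hX u ρ
  filter_upwards [h1] with w hw
  have h2 := (tendsto_integral_of_sq hw).const_mul (2 * Real.pi)⁻¹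
  rw [mul_zero] at h2
  refine h2.congr fun N => ?_
  rw [Real.circleAverage_def, intervalIntegral.integral_of_le (by positivity), smul_eq_mul]

/-- The constant `log N! / (2N)` disappears in the difference of two averages. -/
lemma averageDiff_logDev {n N : ℕ} (P : MvPolynomial (Fin (n + 2)) ℂ) {w u : Coord n}
    (h : ∀ t : ℂ, w + t • u ≠ 0) (r : ℝ) (c : ℂ) :
    averageDiff (fun t => logDev N P (w + t • u)) r c =
      1 / (N : ℝ) * averageDiff (fun t => Real.log ‖(line P w u).eval t‖) r c -
        averageDiff (halfLog w u) r c := by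
  have key : ∀ R, Real.circleAverage (fun t => logDev N P (w + t • u)) c R =
      1 / (N : ℝ) * Real.circleAverage (fun t => Real.log ‖(line P w u).eval t‖) c R +
        Real.log (N.factorial) / (2 * N) - Real.circleAverage (halfLog w u) c R := by
    intro R
    have h1 := circleIntegrable_log_norm_polynomial (line P w u) c R
    have h2 : CircleIntegrable (halfLog w u) c R :=
      (continuous_halfLog h).continuousOn.circleIntegrable'
    have h3 : CircleIntegrable (fun t => 1 / (N : ℝ) * Real.log ‖(line P w u).eval t‖) c R :=
      IntervalIntegrable.const_mul h1 _
    have h4 : CircleIntegrable (fun t => 1 / (N : ℝ) * Real.log ‖(line P w u).eval t‖ +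
        Real.log (N.factorial) / (2 * N)) c R := h3.add (circleIntegrable_const _ _ _)
    have e1 : (fun t : ℂ => logDev N P (w + t • u)) = fun t =>
        (1 / (N : ℝ) * Real.log ‖(line P w u).eval t‖ + Real.log (N.factorial) / (2 * N)) -
          halfLog w u t := by
      funext t
      rw [logDev, eval_line, halfLog]
    rw [e1, Real.circleAverage_fun_sub h4 h2,
      Real.circleAverage_fun_add h3 (circleIntegrable_const _ _ _), Real.circleAverage_const]
    congr 2
    exact Real.circleAverage_fun_smul (a := 1 / (N : ℝ))
      (f := fun t => Real.log ‖(line P w u).eval t‖)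
  rw [averageDiff, key, key, averageDiff, averageDiff]
  ring

lemma averageDiff_shift {n : ℕ} (F : Coord n → ℝ) (w u : Coord n) (r : ℝ) (c : ℂ) :
    averageDiff (fun t => F (w + c • u + t • u)) r 0 = averageDiff (fun t => F (w + t • u)) r c := by
  have h : ∀ R, Real.circleAverage (fun t => F (w + c • u + t • u)) 0 R =
      Real.circleAverage (fun t => F (w + t • u)) c R := fun R => by
    rw [← Real.circleAverage_map_add_const (c := c)]
    congr 1
    funext t
    rw [add_smul, add_comm (t • u), add_assoc]
  rw [averageDiff, averageDiff, h, h]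

/-- A property of almost every point holds, on almost every line, for almost every parameter.
Together with `averageDiff_shift` it turns circles centred at the base point into circles about
almost every `c` on a fixed line. -/
lemma ae_ae_add_smul {n : ℕ} {q : Coord n → Prop} (hq : ∀ᵐ w, q w) (u : Coord n) :
    ∀ᵐ w : Coord n, ∀ᵐ c : ℂ, q (w + c • u) := by
  have h1 : ∀ᵐ p : ℂ × Coord n, q p.2 := Measure.quasiMeasurePreserving_snd.ae hq
  have h2 := (measurePreserving_shear u).quasiMeasurePreserving.ae h1
  have h3 : ∀ᵐ p : Coord n × ℂ, q (p.1 + p.2 • u) :=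
    (Measure.measurePreserving_swap (μ := (volume : Measure (Coord n)))
      (ν := (volume : Measure ℂ))).quasiMeasurePreserving.ae h2
  exact Measure.ae_ae_of_ae_prod h3

/-- Convergence of slicing integrals from convergence of potentials. -/
lemma tendsto_nu {n : ℕ} {P : ℕ → MvPolynomial (Fin (n + 2)) ℂ} {u : Coord n}
    (hd : ∀ N, 1 ≤ N → (P N).totalDegree ≤ N) (hs : ∀ N, 1 ≤ N → SimpleAlong (P N) u)
    (hX : ∀ R : ℕ, ∑' N : ℕ, ∫⁻ w in Metric.ball 0 R,
      ENNReal.ofReal (√N * logDev N (P N) w ^ 2) ≠ ⊤)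
    {f : Coord n → ℂ} (hf : Continuous f) (hfc : HasCompactSupport f)
    (hfs : Integrable fun w => f w * fsDensity w u) :
    Tendsto (fun N : ℕ => (1 / (N : ℂ)) * nu (P N) u f) atTop
      (𝓝 (∫ w, f w * fsDensity w u)) := by
  have h1 : ∀ᵐ w : Coord n, ∀ k : ℕ, Tendsto (fun N =>
      averageDiff (fun t => logDev N (P N) (w + t • u)) (1 / ((k : ℝ) + 1)) 0) atTop (𝓝 0) := by
    rw [ae_all_iff]
    intro k
    filter_upwards [tendsto_circleAverage (fun N => measurable_logDev N (P N)) hX u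
        (2 * (1 / ((k : ℝ) + 1))),
      tendsto_circleAverage (fun N => measurable_logDev N (P N)) hX u (1 / ((k : ℝ) + 1))]
      with w hw hw'
    simpa [averageDiff] using hw.sub hw'
  have hsall : ∀ᵐ w : Coord n, ∀ N : ℕ, 1 ≤ N → line (P N) w u ≠ 0 := by
    rw [ae_all_iff]
    intro N
    by_cases hN : 1 ≤ N
    · filter_upwards [hs N hN] with w hw _ using hw.1
    · exact Eventually.of_forall fun w h => absurd h hN
  have hkap := continuous_kappa
  have hlim : ∀ᵐ w : Coord n, Tendsto (fun N : ℕ => (1 / (N : ℂ)) * nuInt (P N) u f w) atTop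
      (𝓝 (∫ t : ℂ, kappa t * (f (w + t • u) * fsDensity (w + t • u) u))) := by
    filter_upwards [ae_line_ne_zero u, ae_ae_add_smul h1 u, hsall] with w hw0 hw hwp
    have := tendsto_rootSum hw0 (p := fun N => line (P N) w u) hwp
      (fun N hN => (natDegree_line_le _ _ _).trans (hd N hN)) (fun k => by
        filter_upwards [hw] with c hc
        have h2 := (hc k).add_const (averageDiff (halfLog w u) (1 / ((k : ℝ) + 1)) c)
        rw [zero_add] at h2
        refine h2.congr fun N => ?_
        rw [averageDiff_shift, averageDiff_logDev _ hw0]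
        ring)
      (g := fun t => kappa t * f (w + t • u)) (by fun_prop)
      ((hasCompactSupport_kappa.comp_left (g := fun x : ℝ => (x : ℂ)) (by simp)).mul_right)
    simp only [mul_assoc] at this
    exact this
  -- Averaging along `u` against `kappa`, of mass one, puts the limit in the form in which `nu` is
  -- defined.
  have hrhs : ∫ w, f w * fsDensity w u =
      ∫ w : Coord n, ∫ t : ℂ, kappa t * (f (w + t • u) * fsDensity (w + t • u) u) := by
    have := integral_shear integrable_kappa hfs u
    rw [integral_complex_ofReal, integral_kappa, Complex.ofReal_one, one_mul] at this
    exact this.symm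
  rw [hrhs]
  simp_rw [nu, ← integral_const_mul]
  obtain ⟨C, hC⟩ := hfc.exists_bound_of_continuous hf
  obtain ⟨C', hC'0, hC'⟩ := exists_norm_kappa_le
  have hC0 : 0 ≤ C := (norm_nonneg _).trans (hC 0)
  -- The factor `1 / N` cancels the degree in `norm_nuInt_le`, so the dominating function does not
  -- depend on `N`.
  refine tendsto_integral_filter_of_dominated_convergence
    ((shadow u (tsupport f)).indicator fun _ => C' * C) ?_ ?_
    (integrable_indicator_shadow u hfc.isCompact _) hlim
  · filter_upwards [eventually_ge_atTop 1] with N hN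
    exact (aestronglyMeasurable_nuInt (hs N hN) hf hfc).const_mul _
  · filter_upwards [eventually_ge_atTop 1] with N hN
    refine Eventually.of_forall fun w => ?_
    have hN' : (0 : ℝ) < N := by exact_mod_cast hN
    have h2 := norm_nuInt_le (P N) (u := u) hC0 (K := tsupport f) (G := f) (fun w _ => by
        by_cases hw : w ∈ tsupport f
        · rw [Set.indicator_of_mem hw]; exact hC w
        · rw [Set.indicator_of_notMem hw, image_eq_zero_of_notMem_tsupport hw, norm_zero]) hC' w
    rw [norm_mul, norm_div, norm_one, Complex.norm_natCast, div_mul_eq_mul_div, one_mul,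
      div_le_iff₀ hN']
    refine h2.trans ?_
    by_cases hw : w ∈ shadow u (tsupport f)
    · rw [Set.indicator_of_mem hw, Set.indicator_of_mem hw, mul_comm]
      have : ((P N).totalDegree : ℝ) ≤ N := by exact_mod_cast hd N hN
      gcongr
    · rw [Set.indicator_of_notMem hw, Set.indicator_of_notMem hw, zero_mul]

/-! ### The standard complex Gaussian law -/

lemma measurable_gaussianDensity :
    Measurable fun z : ℂ => ENNReal.ofReal (Real.pi⁻¹ * Real.exp (-‖z‖ ^ 2)) := by fun_prop

lemma integral_stdComplexGaussian (f : ℂ → ℂ) :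
    ∫ z, f z ∂stdComplexGaussian = ∫ z, ((Real.pi⁻¹ * Real.exp (-‖z‖ ^ 2) : ℝ) : ℂ) * f z := by
  rw [stdComplexGaussian, integral_withDensity_eq_integral_toReal_smul measurable_gaussianDensity
    (by simp)]
  congr 1
  ext z
  rw [ENNReal.toReal_ofReal (by positivity), Complex.real_smul]

lemma charFun_stdComplexGaussian (t : ℂ) :
    charFun stdComplexGaussian t = Complex.exp (-(‖t‖ ^ 2 / 4 : ℝ)) := by
  rw [charFun_apply, integral_stdComplexGaussian]
  have h := GaussianFourier.integral_cexp_neg_mul_sq_norm_add (V := ℂ) (b := 1) (by simp)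
    Complex.I t
  have hpi : (Real.pi : ℂ) ≠ 0 := by exact_mod_cast Real.pi_pos.ne'
  have e1 : ∀ z : ℂ, ((Real.pi⁻¹ * Real.exp (-‖z‖ ^ 2) : ℝ) : ℂ) *
      Complex.exp ((inner ℝ z t : ℝ) * Complex.I) =
      (Real.pi : ℂ)⁻¹ * Complex.exp (-1 * (‖z‖ : ℂ) ^ 2 + Complex.I * (inner ℝ t z : ℝ)) := by
    intro z
    rw [Complex.exp_add, real_inner_comm]
    push_cast
    rw [mul_assoc, neg_one_mul, mul_comm Complex.I]
  simp_rw [e1]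
  rw [integral_const_mul, h, Complex.finrank_real_complex]
  simp only [div_one, Nat.cast_ofNat, ne_eq, OfNat.ofNat_ne_zero, not_false_eq_true, div_self,
    Complex.cpow_one, Complex.I_sq]
  rw [← mul_assoc, inv_mul_cancel₀ hpi, one_mul]
  congr 1
  push_cast
  ring

instance isProbabilityMeasure_stdComplexGaussian : IsProbabilityMeasure stdComplexGaussian := by
  have h := charFun_zero stdComplexGaussian
  rw [charFun_stdComplexGaussian] at h
  simp only [norm_zero, ne_eq, OfNat.ofNat_ne_zero, not_false_eq_true, zero_pow, zero_div,
    Complex.ofReal_zero, neg_zero, Complex.exp_zero] at h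
  have h1 : stdComplexGaussian.real Set.univ = 1 := by exact_mod_cast h.symm
  exact ⟨by rwa [Measure.real, ENNReal.toReal_eq_one_iff] at h1⟩

lemma stdComplexGaussian_absolutelyContinuous : stdComplexGaussian ≪ volume :=
  withDensity_absolutelyContinuous _ _

lemma charFun_map_mul_stdComplexGaussian (c t : ℂ) :
    charFun (stdComplexGaussian.map fun z => c * z) t =
      Complex.exp (-(‖c‖ ^ 2 * ‖t‖ ^ 2 / 4 : ℝ)) := by
  rw [charFun_apply, integral_map (by fun_prop) (by fun_prop)]
  have h := charFun_stdComplexGaussian ((starRingEnd ℂ) c * t)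
  rw [charFun_apply] at h
  have e1 : ∀ z : ℂ, inner ℝ (c * z) t = inner ℝ z ((starRingEnd ℂ) c * t) := fun z => by
    simp only [Complex.inner, map_mul]
    congr 1
    ring
  simp_rw [e1]
  rw [h, norm_mul, RCLike.norm_conj, mul_pow]

/-- A unit combination of independent standard complex Gaussians is a standard complex Gaussian. -/
lemma map_sum_mul_pi_gaussian {ι : Type*} [Fintype ι] (m : ι → ℂ) (hm : ∑ i, ‖m i‖ ^ 2 = 1) :
    (Measure.pi fun _ : ι => stdComplexGaussian).map (fun x => ∑ i, m i * x i) =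
      stdComplexGaussian := by
  refine Measure.ext_of_charFun ?_
  have hind : iIndepFun (fun (i : ι) (x : ι → ℂ) => m i * x i)
      (Measure.pi fun _ : ι => stdComplexGaussian) :=
    iIndepFun_pi (X := fun i z => m i * z) (fun i => by fun_prop)
  have hmeas : ∀ i, AEMeasurable (fun x : ι → ℂ => m i * x i)
      (Measure.pi fun _ : ι => stdComplexGaussian) :=
    fun i => (measurable_const.mul (measurable_pi_apply i)).aemeasurable
  rw [hind.charFun_map_fun_sum_eq_prod hmeas]
  ext t
  rw [Finset.prod_apply, charFun_stdComplexGaussian]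
  have e1 : ∀ i, charFun ((Measure.pi fun _ : ι => stdComplexGaussian).map
      (fun x : ι → ℂ => m i * x i)) t = Complex.exp (-(‖m i‖ ^ 2 * ‖t‖ ^ 2 / 4 : ℝ)) := fun i => by
    have h1 := (measurePreserving_eval (fun _ : ι => stdComplexGaussian) i).map_eq
    have h2 := Measure.map_map (μ := Measure.pi fun _ : ι => stdComplexGaussian)
      (g := fun z => m i * z) (f := Function.eval i) (by fun_prop) (measurable_pi_apply i)
    rw [h1] at h2
    rw [← charFun_map_mul_stdComplexGaussian, h2]
    rfl
  simp_rw [e1]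
  rw [← Complex.exp_sum]
  congr 1
  rw [Finset.sum_neg_distrib, ← Complex.ofReal_sum, ← Finset.sum_div, ← Finset.sum_mul, hm, one_mul]

lemma log_sq_le {x : ℝ} (hx : 0 < x) : Real.log x ^ 2 ≤ 4 * (x ^ (1 : ℝ) + x ^ (-1 : ℝ)) := by
  have key : ∀ y : ℝ, 1 ≤ y → Real.log y ^ 2 ≤ 4 * y := fun y hy => by
    have h1 := Real.log_le_sub_one_of_pos (Real.sqrt_pos.mpr (by linarith : 0 < y))
    rw [Real.log_sqrt (by linarith)] at h1
    have h0 := Real.log_nonneg hy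
    have h2 : Real.log y ≤ 2 * √y := by linarith
    calc Real.log y ^ 2 ≤ (2 * √y) ^ 2 := by gcongr
      _ = 4 * y := by rw [mul_pow, Real.sq_sqrt (by linarith)]; ring
  rw [Real.rpow_one, Real.rpow_neg_one]
  rcases le_total 1 x with h | h
  · have := key x h
    have h2 : 0 < x⁻¹ := by positivity
    linarith
  · have := key x⁻¹ (one_le_inv₀ hx |>.mpr h)
    rw [Real.log_inv, neg_sq] at this
    linarith

lemma integrable_rpow_mul_gaussian {q : ℝ} (hq : -2 < q) :
    Integrable fun z : ℂ => ‖z‖ ^ q * Real.exp (-‖z‖ ^ (2 : ℝ)) := by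
  refine Integrable.of_integral_ne_zero ?_
  rw [Complex.integral_rpow_mul_exp_neg_rpow (by norm_num) hq]
  have := Real.Gamma_pos_of_pos (s := (q + 2) / 2) (by linarith)
  have := Real.pi_pos
  positivity

/-- The second moment of the logarithm of a standard complex Gaussian. -/
def logMoment : ENNReal := ∫⁻ z, ENNReal.ofReal (Real.log ‖z‖ ^ 2) ∂stdComplexGaussian

/-- By `log_sq_le` the integrand is bounded by a combination of `|z|` and `|z|⁻¹`; both are
integrable in the plane against the Gaussian density. -/
lemma logMoment_ne_top : logMoment ≠ ⊤ := by
  have h1 := ((integrable_rpow_mul_gaussian (q := 1) (by norm_num)).add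
    (integrable_rpow_mul_gaussian (q := -1) (by norm_num))).const_mul (4 * Real.pi⁻¹)
  rw [logMoment, stdComplexGaussian, lintegral_withDensity_eq_lintegral_mul _
    measurable_gaussianDensity (by fun_prop)]
  refine ne_top_of_le_ne_top h1.lintegral_lt_top.ne ?_
  refine lintegral_mono_ae ?_
  filter_upwards [ae_ne_zero_complex] with z hz
  simp only [Pi.mul_apply, Pi.add_apply]
  rw [← ENNReal.ofReal_mul (by positivity)]
  refine ENNReal.ofReal_le_ofReal ?_
  have h2 := log_sq_le (norm_pos_iff.mpr hz)
  have h3 : Real.exp (-‖z‖ ^ (2 : ℝ)) = Real.exp (-‖z‖ ^ 2) := by norm_num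
  rw [h3]
  calc Real.pi⁻¹ * Real.exp (-‖z‖ ^ 2) * Real.log ‖z‖ ^ 2
      ≤ Real.pi⁻¹ * Real.exp (-‖z‖ ^ 2) * (4 * (‖z‖ ^ (1 : ℝ) + ‖z‖ ^ (-1 : ℝ))) := by gcongr
    _ = _ := by ring

/-- The product of standard complex Gaussian laws has a density. -/
lemma pi_gaussian_absolutelyContinuous (ι : Type*) [Fintype ι] :
    (Measure.pi fun _ : ι => stdComplexGaussian) ≪ (volume : Measure (ι → ℂ)) := by
  set g : ℂ → ℝ := fun z => Real.pi⁻¹ * Real.exp (-‖z‖ ^ 2)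
  have hg : Integrable g := by
    have h := (integrable_rpow_mul_gaussian (q := 0) (by norm_num)).const_mul Real.pi⁻¹
    refine h.congr (Eventually.of_forall fun z => ?_)
    simp [g]
  have hg0 : ∀ z, 0 ≤ g z := fun z => by positivity
  suffices h : (Measure.pi fun _ : ι => stdComplexGaussian) =
      (volume : Measure (ι → ℂ)).withDensity fun x => ENNReal.ofReal (∏ i, g (x i)) by
    rw [h]; exact withDensity_absolutelyContinuous _ _
  refine Measure.pi_eq fun s hs => ?_
  have hbox : MeasurableSet (Set.univ.pi s) := MeasurableSet.univ_pi hs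
  rw [withDensity_apply _ hbox, ← lintegral_indicator hbox]
  have e1 : ∀ x : ι → ℂ, (Set.univ.pi s).indicator (fun x => ENNReal.ofReal (∏ i, g (x i))) x =
      ENNReal.ofReal (∏ i, (s i).indicator g (x i)) := by
    intro x
    by_cases hx : x ∈ Set.univ.pi s
    · rw [Set.indicator_of_mem hx]
      congr 1
      exact Finset.prod_congr rfl fun i _ => (Set.indicator_of_mem (hx i trivial) _).symm
    · rw [Set.indicator_of_notMem hx]
      simp only [Set.mem_univ_pi, not_forall] at hx
      obtain ⟨i, hi⟩ := hx
      rw [Finset.prod_eq_zero (Finset.mem_univ i) (Set.indicator_of_notMem hi _),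
        ENNReal.ofReal_zero]
  have hi : ∀ i, Integrable ((s i).indicator g) := fun i => hg.indicator (hs i)
  have hi0 : ∀ i z, 0 ≤ (s i).indicator g z := fun i z => Set.indicator_nonneg (fun _ _ => hg0 _) z
  simp_rw [e1]
  have hprod : Integrable fun x : ι → ℂ => ∏ i, (s i).indicator g (x i) :=
    Integrable.fintype_prod hi
  rw [← ofReal_integral_eq_lintegral_ofReal hprod
    (Eventually.of_forall fun x => Finset.prod_nonneg fun i _ => hi0 i _),
    integral_fintype_prod_volume_eq_prod (fun i => (s i).indicator g),
    ENNReal.ofReal_prod_of_nonneg fun i _ => integral_nonneg (hi0 i)]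
  refine Finset.prod_congr rfl fun i _ => ?_
  rw [ofReal_integral_eq_lintegral_ofReal (hi i) (Eventually.of_forall (hi0 i)),
    stdComplexGaussian, withDensity_apply _ (hs i), ← lintegral_indicator (hs i)]
  congr 1
  ext z
  by_cases hz : z ∈ s i
  · simp [hz, g]
  · simp [hz]

/-! ### Random polynomials as functions of their coefficients -/

/-- The exponents of degree `N`. -/
abbrev CoeffIdx (n N : ℕ) : Type :=
  ↥(Finset.finsuppAntidiag (Finset.univ : Finset (Fin (n + 2))) N)

/-- The polynomial with given coefficients. -/
def coeffPoly {n N : ℕ} (x : CoeffIdx n N → ℂ) : MvPolynomial (Fin (n + 2)) ℂ :=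
  ∑ J : CoeffIdx n N, MvPolynomial.monomial (J : Fin (n + 2) →₀ ℕ)
    (x J / (Real.sqrt (∏ i, (((J : Fin (n + 2) →₀ ℕ) i).factorial : ℝ)) : ℂ))

lemma suPoly_eq_coeffPoly {n : ℕ} (N : ℕ) (a : (Fin (n + 2) →₀ ℕ) → ℂ) :
    suPoly N a = coeffPoly fun J : CoeffIdx n N => a J :=
  (Finset.sum_coe_sort (Finset.finsuppAntidiag Finset.univ N) fun J =>
    MvPolynomial.monomial J (a J / (Real.sqrt (∏ i, ((J i).factorial : ℝ)) : ℂ))).symm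

/-- The normalized monomials. -/
def normMonomial {n N : ℕ} (J : CoeffIdx n N) (w : Coord n) : ℂ :=
  (∏ i, w i ^ (J : Fin (n + 2) →₀ ℕ) i) /
    (Real.sqrt (∏ i, (((J : Fin (n + 2) →₀ ℕ) i).factorial : ℝ)) : ℂ)

lemma continuous_normMonomial {n N : ℕ} (J : CoeffIdx n N) : Continuous (normMonomial J) := by
  unfold normMonomial
  fun_prop

lemma eval_coeffPoly {n N : ℕ} (x : CoeffIdx n N → ℂ) (w : Coord n) :
    MvPolynomial.eval w (coeffPoly x) = ∑ J, normMonomial J w * x J := by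
  rw [coeffPoly, map_sum]
  refine Finset.sum_congr rfl fun J _ => ?_
  rw [MvPolynomial.eval_monomial, normMonomial, Finsupp.prod_fintype _ _ (by simp)]
  ring

lemma sum_coeffIdx {n N : ℕ} (J : CoeffIdx n N) : ∑ i, (J : Fin (n + 2) →₀ ℕ) i = N :=
  (Finset.mem_finsuppAntidiag.mp J.2).1

lemma isHomogeneous_coeffPoly {n N : ℕ} (x : CoeffIdx n N → ℂ) :
    (coeffPoly x).IsHomogeneous N := by
  refine MvPolynomial.IsHomogeneous.sum _ _ _ fun J _ =>
    MvPolynomial.isHomogeneous_monomial _ ?_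
  rw [Finsupp.degree_eq_sum, sum_coeffIdx]

/-- The multinomial theorem. -/
lemma sum_pow_eq_sum_coeffIdx {n N : ℕ} (y : Fin (n + 2) → ℂ) :
    (∑ i, y i) ^ N = ∑ J : CoeffIdx n N, (N.factorial : ℂ) *
      ((∏ i, y i ^ (J : Fin (n + 2) →₀ ℕ) i) /
        ((∏ i, (((J : Fin (n + 2) →₀ ℕ) i).factorial : ℝ) : ℝ) : ℂ)) := by
  rw [Finset.sum_pow_eq_sum_piAntidiag]
  refine (Finset.sum_bij (fun (J : CoeffIdx n N) _ => (⇑(J : Fin (n + 2) →₀ ℕ)))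
    (fun J _ => ?_) (fun J _ J' _ h => Subtype.ext (DFunLike.coe_injective h))
    (fun k hk => ?_) (fun J _ => ?_)).symm
  · simp [Finset.mem_piAntidiag, sum_coeffIdx]
  · refine ⟨⟨Finsupp.equivFunOnFinite.symm k, ?_⟩, Finset.mem_univ _, ?_⟩
    · simpa [Finset.mem_piAntidiag] using hk
    · simp
  · have h := Nat.multinomial_spec Finset.univ (⇑(J : Fin (n + 2) →₀ ℕ))
    rw [sum_coeffIdx] at h
    have h0 : (∏ i, (((J : Fin (n + 2) →₀ ℕ) i).factorial : ℂ)) ≠ 0 :=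
      Finset.prod_ne_zero_iff.mpr fun i _ => by exact_mod_cast Nat.factorial_ne_zero _
    rw [← h]
    push_cast
    field_simp

lemma sqrt_prod_factorial_sq {n N : ℕ} (J : CoeffIdx n N) :
    ((Real.sqrt (∏ i, (((J : Fin (n + 2) →₀ ℕ) i).factorial : ℝ)) : ℂ)) ^ 2 =
      ((∏ i, (((J : Fin (n + 2) →₀ ℕ) i).factorial : ℝ) : ℝ) : ℂ) := by
  rw [← Complex.ofReal_pow, Real.sq_sqrt (by positivity)]

/-- This is the variance of the random polynomial at `w`. By the multinomial theorem, the
coefficients `1/√J!` make it depend on `|w|` only; its logarithm gives the Fubini-Study potential.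
-/
lemma sum_norm_normMonomial_sq {n N : ℕ} (w : Coord n) :
    ∑ J : CoeffIdx n N, ‖normMonomial J w‖ ^ 2 = nsq w ^ N / N.factorial := by
  have h := sum_pow_eq_sum_coeffIdx (N := N) fun i => ((‖w i‖ ^ 2 : ℝ) : ℂ)
  have hN : (N.factorial : ℝ) ≠ 0 := by exact_mod_cast Nat.factorial_ne_zero N
  rw [eq_div_iff hN, mul_comm, Finset.mul_sum]
  symm
  have e1 : ∀ J : CoeffIdx n N, ‖normMonomial J w‖ ^ 2 =
      (∏ i, (‖w i‖ ^ 2) ^ (J : Fin (n + 2) →₀ ℕ) i) /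
        ∏ i, (((J : Fin (n + 2) →₀ ℕ) i).factorial : ℝ) := fun J => by
    rw [normMonomial, norm_div, div_pow, norm_prod, Complex.norm_real,
      Real.norm_of_nonneg (Real.sqrt_nonneg _), Real.sq_sqrt (by positivity), ← Finset.prod_pow]
    congr 1
    refine Finset.prod_congr rfl fun i _ => ?_
    rw [norm_pow, ← pow_mul, ← pow_mul, mul_comm]
  simp_rw [e1]
  rw [nsq]
  exact_mod_cast h

/-- The coefficients of the `N`-th power of a linear form. -/
def powCoeff {n : ℕ} (N : ℕ) (l : Coord n) (J : CoeffIdx n N) : ℂ :=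
  (N.factorial : ℂ) * normMonomial J l

lemma eval_coeffPoly_powCoeff {n N : ℕ} (l w : Coord n) :
    MvPolynomial.eval w (coeffPoly (powCoeff N l)) = (∑ i, l i * w i) ^ N := by
  rw [eval_coeffPoly, sum_pow_eq_sum_coeffIdx]
  refine Finset.sum_congr rfl fun J _ => ?_
  rw [powCoeff, normMonomial, normMonomial, ← sqrt_prod_factorial_sq]
  simp_rw [mul_pow, Finset.prod_mul_distrib]
  ring

lemma coeffPoly_add_smul {n N : ℕ} (x e : CoeffIdx n N → ℂ) (s : ℂ) (w : Coord n) :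
    MvPolynomial.eval w (coeffPoly (x + s • e)) =
      MvPolynomial.eval w (coeffPoly x) + s * MvPolynomial.eval w (coeffPoly e) := by
  simp only [eval_coeffPoly, Pi.add_apply, Pi.smul_apply, smul_eq_mul, mul_add,
    Finset.sum_add_distrib, Finset.mul_sum]
  congr 1
  exact Finset.sum_congr rfl fun J _ => by ring

/-! ### Estimates for Gaussian coefficients -/

/-- The Gaussian law of the coefficients. -/
def coeffLaw (n N : ℕ) : Measure (CoeffIdx n N → ℂ) :=
  Measure.pi fun _ => stdComplexGaussian

instance isProbabilityMeasure_coeffLaw (n N : ℕ) : IsProbabilityMeasure (coeffLaw n N) := by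
  unfold coeffLaw; infer_instance

lemma measurable_logDev_coeffPoly (n N : ℕ) :
    Measurable fun p : (CoeffIdx n N → ℂ) × Coord n => logDev N (coeffPoly p.1) p.2 := by
  have h1 := (continuous_nsq (n := n)).measurable
  have h2 := fun J : CoeffIdx n N => (continuous_normMonomial J).measurable
  simp only [logDev, eval_coeffPoly]
  fun_prop

lemma lintegral_log_norm_sum_sq {ι : Type*} [Fintype ι] (m : ι → ℂ) (hm : ∑ i, ‖m i‖ ^ 2 = 1) :
    (∀ᵐ x ∂(Measure.pi fun _ : ι => stdComplexGaussian), ∑ i, m i * x i ≠ 0) ∧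
    ∫⁻ x, ENNReal.ofReal (Real.log ‖∑ i, m i * x i‖ ^ 2)
      ∂(Measure.pi fun _ : ι => stdComplexGaussian) = logMoment := by
  have hlaw := map_sum_mul_pi_gaussian m hm
  have hmeas : Measurable fun x : ι → ℂ => ∑ i, m i * x i := by fun_prop
  constructor
  · refine ae_of_ae_map hmeas.aemeasurable (p := fun z => z ≠ 0) ?_
    rw [hlaw]
    exact stdComplexGaussian_absolutelyContinuous.ae_le ae_ne_zero_complex
  · have h := lintegral_map (μ := Measure.pi fun _ : ι => stdComplexGaussian)
      (f := fun z => ENNReal.ofReal (Real.log ‖z‖ ^ 2)) (by fun_prop) hmeas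
    rw [hlaw] at h
    exact h.symm

/-- Write `P(w) = σ ξ` with `σ² = |w|^{2N} / N!` and `ξ` standard Gaussian. The term `(1/N) log σ`
cancels the deterministic part of `logDev` exactly, so `logDev = (1/N) log |ξ|`. -/
lemma lintegral_logDev_sq {n N : ℕ} (hN : 1 ≤ N) {w : Coord n} (hw : w ≠ 0) :
    ∫⁻ x, ENNReal.ofReal (√N * logDev N (coeffPoly x) w ^ 2) ∂(coeffLaw n N) =
      ENNReal.ofReal (√N / N ^ 2) * logMoment := by
  have hN0 : (0 : ℝ) < N := by exact_mod_cast hN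
  have hfac : (0 : ℝ) < N.factorial := by exact_mod_cast Nat.factorial_pos N
  have hq := nsq_pos hw
  obtain ⟨σ, hσ⟩ : ∃ σ : ℝ, σ = √(nsq w ^ N / N.factorial) := ⟨_, rfl⟩
  have hσ0 : 0 < σ := hσ ▸ Real.sqrt_pos.mpr (by positivity)
  have hσ2 : σ ^ 2 = nsq w ^ N / N.factorial := by rw [hσ, Real.sq_sqrt (by positivity)]
  have hσC : (σ : ℂ) ≠ 0 := by exact_mod_cast hσ0.ne'
  have hm1 : ∑ J : CoeffIdx n N, ‖normMonomial J w / σ‖ ^ 2 = 1 := by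
    simp only [norm_div, div_pow, Complex.norm_real, Real.norm_of_nonneg hσ0.le]
    rw [← Finset.sum_div, sum_norm_normMonomial_sq, hσ2]
    exact div_self (by positivity)
  obtain ⟨hne, hint⟩ := lintegral_log_norm_sum_sq _ hm1
  have h2 : Real.log σ = (N * Real.log (nsq w) - Real.log N.factorial) / 2 := by
    rw [hσ, Real.log_sqrt (by positivity), Real.log_div (by positivity) hfac.ne', Real.log_pow]
  have e1 : ∀ᵐ x ∂(coeffLaw n N), ENNReal.ofReal (√N * logDev N (coeffPoly x) w ^ 2) =
      ENNReal.ofReal (√N / N ^ 2) *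
        ENNReal.ofReal (Real.log ‖∑ J : CoeffIdx n N, normMonomial J w / σ * x J‖ ^ 2) := by
    filter_upwards [hne] with x hx
    rw [← ENNReal.ofReal_mul (by positivity)]
    congr 1
    have h1 : MvPolynomial.eval w (coeffPoly x) =
        σ * ∑ J : CoeffIdx n N, normMonomial J w / σ * x J := by
      rw [eval_coeffPoly, Finset.mul_sum]
      refine Finset.sum_congr rfl fun J _ => ?_
      field_simp
    rw [logDev, h1, norm_mul, Complex.norm_real, Real.norm_of_nonneg hσ0.le,
      Real.log_mul hσ0.ne' (norm_ne_zero_iff.mpr hx), h2]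
    field_simp
    ring
  rw [lintegral_congr_ae e1, lintegral_const_mul _ (by fun_prop)]
  congr 1

lemma lintegral_ball_logDev_sq_le (n N R : ℕ) :
    ∫⁻ x, (∫⁻ w in Metric.ball 0 R,
      ENNReal.ofReal (√N * logDev N (coeffPoly x) w ^ 2)) ∂(coeffLaw n N) ≤
      ENNReal.ofReal (√N / N ^ 2) * (logMoment * volume (Metric.ball (0 : Coord n) R)) := by
  rcases Nat.eq_zero_or_pos N with rfl | hN
  · simp
  have hm := measurable_logDev_coeffPoly n N
  have hm' : Measurable fun p : (CoeffIdx n N → ℂ) × Coord n =>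
      ENNReal.ofReal (√N * logDev N (coeffPoly p.1) p.2 ^ 2) := by fun_prop
  rw [lintegral_lintegral_swap hm'.aemeasurable, ← mul_assoc, ← setLIntegral_const]
  refine lintegral_mono_ae ?_
  filter_upwards [ae_restrict_of_ae (Measure.ae_ne (volume : Measure (Coord n)) 0)] with w hw
  rw [lintegral_logDev_sq hN hw]

lemma summable_sqrt_div_sq : Summable fun N : ℕ => √(N : ℝ) / (N : ℝ) ^ 2 := by
  have h : Summable fun N : ℕ => 1 / (N : ℝ) ^ (3 / 2 : ℝ) :=
    Real.summable_one_div_nat_rpow.mpr (by norm_num)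
  refine h.congr fun N => ?_
  rcases Nat.eq_zero_or_pos N with rfl | hN
  · simp
  · have hN0 : (0 : ℝ) < N := by exact_mod_cast hN
    rw [Real.sqrt_eq_rpow, ← Real.rpow_natCast (N : ℝ) 2, ← Real.rpow_sub hN0, one_div,
      ← Real.rpow_neg hN0.le]
    norm_num

/-- Almost surely, the potentials converge in a strong sense. -/
lemma ae_tsum_logDev_ne_top {Ω : Type*} [MeasurableSpace Ω] {μ : Measure Ω} {n : ℕ}
    {A : (N : ℕ) → Ω → CoeffIdx n N → ℂ} (hA : ∀ N, 1 ≤ N → AEMeasurable (A N) μ)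
    (hlaw : ∀ N, 1 ≤ N → μ.map (A N) = coeffLaw n N) :
    ∀ᵐ ω ∂μ, ∀ R : ℕ, ∑' N : ℕ, ∫⁻ w in Metric.ball 0 R,
      ENNReal.ofReal (√N * logDev N (coeffPoly (A N ω)) w ^ 2) ≠ ⊤ := by
  rw [ae_all_iff]
  intro R
  have hm : ∀ N, Measurable fun x : CoeffIdx n N → ℂ => ∫⁻ w in Metric.ball 0 R,
      ENNReal.ofReal (√N * logDev N (coeffPoly x) w ^ 2) := fun N => by
    have := measurable_logDev_coeffPoly n N
    exact Measurable.lintegral_prod_right' (f := fun p : (CoeffIdx n N → ℂ) × Coord n =>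
      ENNReal.ofReal (√N * logDev N (coeffPoly p.1) p.2 ^ 2)) (by fun_prop)
  have hmA : ∀ N : ℕ, AEMeasurable (fun ω => ∫⁻ w in Metric.ball 0 R,
      ENNReal.ofReal (√N * logDev N (coeffPoly (A N ω)) w ^ 2)) μ := fun N => by
    rcases Nat.eq_zero_or_pos N with rfl | hN
    · simp
    · exact (hm N).comp_aemeasurable (hA N hN)
  refine (ae_lt_top' (AEMeasurable.tsum hmA) ?_).mono fun ω h => h.ne
  rw [lintegral_tsum hmA]
  have hle : ∀ N : ℕ, ∫⁻ ω, (∫⁻ w in Metric.ball 0 R,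
      ENNReal.ofReal (√N * logDev N (coeffPoly (A N ω)) w ^ 2)) ∂μ ≤
      ENNReal.ofReal (√N / N ^ 2) * (logMoment * volume (Metric.ball (0 : Coord n) R)) := fun N => by
    rcases Nat.eq_zero_or_pos N with rfl | hN
    · simp
    · rw [← lintegral_map' (hm N).aemeasurable (hA N hN), hlaw N hN]
      exact lintegral_ball_logDev_sq_le n N R
  refine ne_top_of_le_ne_top ?_ (ENNReal.tsum_le_tsum hle)
  rw [ENNReal.tsum_mul_right]
  refine ENNReal.mul_ne_top ?_ (ENNReal.mul_ne_top logMoment_ne_top measure_ball_lt_top.ne)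
  rw [← ENNReal.ofReal_tsum_of_nonneg (fun N => by positivity) summable_sqrt_div_sq]
  exact ENNReal.ofReal_ne_top

/-! ### Simplicity of zeros on lines -/

/-- The coefficients and base points for which the polynomial has a multiple zero on a line. -/
def multipleSet (n N : ℕ) (u : Coord n) : Set ((CoeffIdx n N → ℂ) × Coord n) :=
  {p | ∃ t : ℂ, (line (coeffPoly p.1) p.2 u).eval t = 0 ∧
    (line (coeffPoly p.1) p.2 u).derivative.eval t = 0}

lemma partialAt_coeffPoly_continuous {n N : ℕ} (i : Fin (n + 2)) :
    Continuous fun p : (CoeffIdx n N → ℂ) × Coord n => partialAt (coeffPoly p.1) i p.2 := by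
  have e : ∀ p : (CoeffIdx n N → ℂ) × Coord n, partialAt (coeffPoly p.1) i p.2 =
      ∑ J : CoeffIdx n N, p.1 J * MvPolynomial.eval p.2 (MvPolynomial.pderiv i
        (MvPolynomial.monomial (J : Fin (n + 2) →₀ ℕ)
          (1 / (Real.sqrt (∏ i, (((J : Fin (n + 2) →₀ ℕ) i).factorial : ℝ)) : ℂ)))) := fun p => by
    rw [partialAt, coeffPoly, map_sum, map_sum]
    refine Finset.sum_congr rfl fun J _ => ?_
    rw [MvPolynomial.pderiv_monomial, MvPolynomial.pderiv_monomial, MvPolynomial.eval_monomial,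
      MvPolynomial.eval_monomial]
    ring
  simp_rw [e]
  have h2 := fun Q : MvPolynomial (Fin (n + 2)) ℂ => MvPolynomial.continuous_eval Q
  refine continuous_finsetSum _ fun J _ => Continuous.mul (by fun_prop) ?_
  exact (h2 _).comp continuous_snd

/-- The set is the projection of a closed set along the parameter `t`. Restricting `t` to closed
discs makes each projection closed, so the union over integer radii is measurable. -/
lemma measurableSet_multipleSet (n N : ℕ) (u : Coord n) : MeasurableSet (multipleSet n N u) := by
  set C : Set (((CoeffIdx n N → ℂ) × Coord n) × ℂ) :=
    {q | MvPolynomial.eval (q.1.2 + q.2 • u) (coeffPoly q.1.1) = 0 ∧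
      grad (coeffPoly q.1.1) (q.1.2 + q.2 • u) u = 0} with hC
  have hCc : IsClosed C := by
    refine IsClosed.inter (isClosed_eq ?_ continuous_const) (isClosed_eq ?_ continuous_const)
    · have h2 := fun J : CoeffIdx n N => continuous_normMonomial J
      simp only [eval_coeffPoly]
      fun_prop
    · simp only [grad_apply]
      refine continuous_finsetSum _ fun i _ => Continuous.mul ?_ continuous_const
      exact (partialAt_coeffPoly_continuous (n := n) (N := N) i).comp
        (g := fun p => partialAt (coeffPoly p.1) i p.2)
        (f := fun q : ((CoeffIdx n N → ℂ) × Coord n) × ℂ => (q.1.1, q.1.2 + q.2 • u))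
        (by fun_prop)
  have e : multipleSet n N u = ⋃ k : ℕ, Prod.fst '' (C ∩ (Set.univ ×ˢ Metric.closedBall 0 k)) := by
    ext p
    simp only [multipleSet, Set.mem_ofPred_eq, Set.mem_iUnion]
    constructor
    · rintro ⟨t, ht1, ht2⟩
      obtain ⟨k, hk⟩ := exists_nat_ge ‖t‖
      refine ⟨k, (p, t), ⟨⟨?_, ?_⟩, trivial, by simpa using hk⟩, rfl⟩
      · rwa [eval_line] at ht1
      · rwa [eval_derivative_line] at ht2
    · rintro ⟨k, ⟨p', t⟩, ⟨⟨h1, h2⟩, -⟩, rfl⟩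
      exact ⟨t, by rwa [eval_line], by rwa [eval_derivative_line]⟩
  rw [e]
  refine MeasurableSet.iUnion fun k => IsClosed.measurableSet ?_
  have hcl : IsClosed (Prod.fst '' ((fun q : ((CoeffIdx n N → ℂ) × Coord n) ×
      ↥(Metric.closedBall (0 : ℂ) k) => (q.1, (q.2 : ℂ))) ⁻¹' C)) := by
    have : CompactSpace ↥(Metric.closedBall (0 : ℂ) k) :=
      isCompact_iff_compactSpace.mp (isCompact_closedBall 0 (k : ℝ))
    exact isClosedMap_fst_of_compactSpace _ (hCc.preimage (by fun_prop))
  convert hcl using 1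
  ext p
  constructor
  · rintro ⟨⟨p', t⟩, ⟨h1, -, h2⟩, rfl⟩
    exact ⟨(p', ⟨t, h2⟩), h1, rfl⟩
  · rintro ⟨⟨p', t, ht⟩, h1, rfl⟩
    exact ⟨(p', t), ⟨h1, trivial, ht⟩, rfl⟩

/-- `p + s` has a multiple root only if `-s` is a critical value of `p`. For constant `p` the only
bad shift is the one that gives the zero polynomial. -/
lemma finite_critical_shifts (p : Polynomial ℂ) :
    {s : ℂ | ∃ t, (p + Polynomial.C s).eval t = 0 ∧
      (p + Polynomial.C s).derivative.eval t = 0}.Finite := by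
  by_cases hp : p.derivative = 0
  · obtain ⟨c, rfl⟩ : ∃ c, p = Polynomial.C c :=
      ⟨p.coeff 0, Polynomial.eq_C_of_derivative_eq_zero hp⟩
    refine (Set.finite_singleton (-c)).subset ?_
    rintro s ⟨t, ht, -⟩
    simp only [Polynomial.eval_add, Polynomial.eval_C] at ht
    exact eq_neg_of_add_eq_zero_right ht
  · refine (p.derivative.roots.toFinset.finite_toSet.image fun t => -p.eval t).subset ?_
    rintro s ⟨t, ht, ht'⟩
    simp only [Polynomial.eval_add, Polynomial.eval_C, Polynomial.derivative_add,
      Polynomial.derivative_C, add_zero] at ht ht'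
    refine ⟨t, ?_, (eq_neg_of_add_eq_zero_right ht).symm⟩
    rw [Finset.mem_coe, Multiset.mem_toFinset, Polynomial.mem_roots hp]
    exact ht'

/-- Fubini for `(x, s) ↦ x + s e`: the set of pairs landing in `S` is null, so some translate of `S`
is null. -/
lemma measure_eq_zero_of_countable_lines {ι : Type*} [Fintype ι] {S : Set (ι → ℂ)}
    (hS : MeasurableSet S) (e : ι → ℂ) (h : ∀ x, {s : ℂ | x + s • e ∈ S}.Countable) :
    volume S = 0 := by
  have hT : MeasurableSet {p : (ι → ℂ) × ℂ | p.1 + p.2 • e ∈ S} :=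
    hS.preimage (by fun_prop)
  have h1 : ∀ᵐ p : (ι → ℂ) × ℂ, p.1 + p.2 • e ∉ S := by
    rw [ae_iff]
    simp only [not_not]
    refine (Measure.measure_prod_null hT).mpr (Eventually.of_forall fun x => ?_)
    exact (h x).measure_zero volume
  have h2 : ∀ᵐ p : ℂ × (ι → ℂ), p.2 + p.1 • e ∉ S :=
    (Measure.measurePreserving_swap (μ := (volume : Measure ℂ))
      (ν := (volume : Measure (ι → ℂ)))).quasiMeasurePreserving.ae h1
  obtain ⟨s, hs⟩ := (Measure.ae_ae_of_ae_prod h2).exists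
  rw [ae_iff] at hs
  simp only [not_not] at hs
  rw [← measure_preimage_add_right volume (s • e) S]
  exact hs

lemma exists_linear_form {n : ℕ} {w u : Coord n} (h : ∀ t : ℂ, w + t • u ≠ 0) :
    ∃ l : Coord n, ∀ t : ℂ, ∑ i, l i * (w + t • u) i = 1 := by
  have hw : w ∉ Submodule.span ℂ {u} := fun hw => by
    obtain ⟨c, hc⟩ := Submodule.mem_span_singleton.mp hw
    exact h (-c) (by rw [neg_smul, hc, add_neg_cancel])
  obtain ⟨f, hfw, hfu⟩ := Submodule.exists_le_ker_of_notMem hw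
  have hu : f u = 0 := hfu (Submodule.mem_span_singleton_self u)
  refine ⟨fun i => f (Pi.single i 1) / f w, fun t => ?_⟩
  have h1 : ∀ v : Coord n, ∑ i, f (Pi.single i 1) / f w * v i = f v / f w := fun v => by
    conv_rhs => rw [pi_eq_sum_univ' v]
    rw [map_sum, Finset.sum_div]
    refine Finset.sum_congr rfl fun i _ => ?_
    rw [map_smul, smul_eq_mul]
    ring
  rw [h1, map_add, map_smul, hu, smul_zero, add_zero, div_self hfw]

/-- Choose a linear form `l` equal to `1` along the line. Adding `s l^N` to the polynomial then adds
the constant `s` to its restriction, and only finitely many `s` produce a multiple root. -/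
lemma volume_multipleSet_section {n N : ℕ} {w u : Coord n} (h : ∀ t : ℂ, w + t • u ≠ 0) :
    volume {x : CoeffIdx n N → ℂ | (x, w) ∈ multipleSet n N u} = 0 := by
  obtain ⟨l, hl⟩ := exists_linear_form h
  refine measure_eq_zero_of_countable_lines
    ((measurableSet_multipleSet n N u).preimage measurable_prodMk_right) (powCoeff N l) fun x => ?_
  refine ((finite_critical_shifts (line (coeffPoly x) w u)).subset ?_).countable
  intro s hs
  have e : line (coeffPoly (x + s • powCoeff N l)) w u =
      line (coeffPoly x) w u + Polynomial.C s := by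
    refine Polynomial.funext fun t => ?_
    rw [eval_line, coeffPoly_add_smul, eval_coeffPoly_powCoeff, hl, one_pow, mul_one,
      Polynomial.eval_add, Polynomial.eval_C, eval_line]
  simp only [multipleSet, Set.mem_ofPred_eq, e] at hs
  exact hs

/-- Almost all polynomials have simple zeros on almost all lines of a given direction. -/
lemma ae_simpleAlong (n N : ℕ) (u : Coord n) :
    ∀ᵐ x ∂(coeffLaw n N), SimpleAlong (coeffPoly x) u := by
  have h1 : ∀ᵐ p ∂((volume : Measure (Coord n)).prod (coeffLaw n N)),
      (p.2, p.1) ∉ multipleSet n N u := by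
    rw [ae_iff]
    simp only [not_not]
    refine (Measure.measure_prod_null
      ((measurableSet_multipleSet n N u).preimage measurable_swap)).mpr ?_
    filter_upwards [ae_line_ne_zero u] with w hw
    exact pi_gaussian_absolutelyContinuous _ (volume_multipleSet_section hw)
  have h2 : ∀ᵐ p ∂((coeffLaw n N).prod (volume : Measure (Coord n))), p ∉ multipleSet n N u :=
    Measure.measurePreserving_swap.quasiMeasurePreserving.ae h1
  filter_upwards [Measure.ae_ae_of_ae_prod h2] with x hx
  filter_upwards [hx] with w hw
  -- If the restriction were the zero polynomial, every parameter, for instance `t = 0`, would be a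
  -- multiple zero.
  refine ⟨fun h0 => hw ⟨0, by simp [h0], by simp [h0]⟩, fun t ht ht' => hw ⟨t, ht, ht'⟩⟩

/-! ### Convergence of zero divisors -/

lemma SimpleAlong.ne_zero {n : ℕ} {P : MvPolynomial (Fin (n + 2)) ℂ} {u : Coord n}
    (h : SimpleAlong P u) : P ≠ 0 := by
  rintro rfl
  obtain ⟨w, hw, -⟩ := Eventually.exists h
  exact hw (by simp [line])

/-- Convergence of zero divisors from convergence of potentials. -/
lemma tendsto_zeroCurrent {n : ℕ} {P : ℕ → MvPolynomial (Fin (n + 2)) ℂ}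
    (hP : ∀ N, 1 ≤ N → (P N).IsHomogeneous N)
    (hs : ∀ N, 1 ≤ N → ∀ r : PolIdx n, SimpleAlong (P N) (polDir r))
    (hs' : ∀ N, 1 ≤ N → ∀ i : Fin (n + 2), SimpleAlong (P N) (Pi.single i 1))
    (hX : ∀ R : ℕ, ∑' N : ℕ, ∫⁻ w in Metric.ball 0 R,
      ENNReal.ofReal (√N * logDev N (P N) w ^ 2) ≠ ⊤) (φ : ContForm n n) :
    Tendsto (fun N : ℕ => (1 / (N : ℂ)) * zeroCurrent (P N) φ) atTop (𝓝 (fsPairing φ)) := by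
  have h1 : Tendsto (fun N : ℕ => ∑ r : PolIdx n, (1 / (N : ℂ)) *
      nu (P N) (polDir r) (formCoeff φ r)) atTop (𝓝 (fsPairing φ)) := by
    rw [fsPairing_eq]
    exact tendsto_finsetSum _ fun r _ => tendsto_nu (fun N hN => (hP N hN).totalDegree_le)
      (fun N hN => hs N hN r) hX (continuous_formCoeff φ r) (hasCompactSupport_formCoeff φ r)
      (integrable_formCoeff_mul_fsDensity φ r _)
  refine h1.congr' ?_
  filter_upwards [eventually_ge_atTop 1] with N hN
  rw [zeroCurrent_eq φ (hP N hN) (hs' N hN 0).ne_zero (hs N hN) (hs' N hN), Finset.mul_sum]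

lemma degree_coeffIdx {n N : ℕ} (J : CoeffIdx n N) : (J : Fin (n + 2) →₀ ℕ).degree = N := by
  rw [Finsupp.degree_eq_sum, sum_coeffIdx]

/-- The law of the coefficients of degree `N`. -/
lemma map_coeff_eq_coeffLaw {Ω : Type*} [MeasurableSpace Ω] {μ : Measure Ω}
    [IsProbabilityMeasure μ] {n : ℕ} {a : ℕ → (Fin (n + 2) →₀ ℕ) → Ω → ℂ}
    (hindep : iIndepFun
      (fun p : {p : ℕ × (Fin (n + 2) →₀ ℕ) // 1 ≤ p.1 ∧ p.2.degree = p.1} => a p.1.1 p.1.2) μ)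
    (hlaw : ∀ N : ℕ, 1 ≤ N → ∀ J : Fin (n + 2) →₀ ℕ, J.degree = N →
      HasLaw (a N J) stdComplexGaussian μ) {N : ℕ} (hN : 1 ≤ N) :
    AEMeasurable (fun ω (J : CoeffIdx n N) => a N J ω) μ ∧
      μ.map (fun ω (J : CoeffIdx n N) => a N J ω) = coeffLaw n N := by
  have hl : ∀ J : CoeffIdx n N, HasLaw (a N J) stdComplexGaussian μ := fun J =>
    hlaw N hN J (degree_coeffIdx J)
  have hm : ∀ J : CoeffIdx n N, AEMeasurable (a N J) μ := fun J => (hl J).aemeasurable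
  refine ⟨aemeasurable_pi_lambda _ hm, ?_⟩
  have hinj : Function.Injective fun J : CoeffIdx n N =>
      (⟨(N, (J : Fin (n + 2) →₀ ℕ)), hN, degree_coeffIdx J⟩ :
        {p : ℕ × (Fin (n + 2) →₀ ℕ) // 1 ≤ p.1 ∧ p.2.degree = p.1}) := fun J J' h => by
    have := congrArg (fun p => p.1.2) h
    exact Subtype.ext this
  have h1 := hindep.precomp hinj
  have h2 := h1.map_fun_eq_pi_map hm
  refine h2.trans ?_
  rw [coeffLaw]
  congr 1
  funext J
  exact (hl J).map_eq

end SUPoly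

end

/-- Here `m = n + 1`, so that `m` ranges over the positive integers. -/
theorem proposition4p2 {Ω : Type*} [MeasurableSpace Ω] (μ : Measure Ω) [IsProbabilityMeasure μ]
    (n : ℕ) (a : ℕ → (Fin (n + 2) →₀ ℕ) → Ω → ℂ)
    (hindep : iIndepFun
      (fun p : {p : ℕ × (Fin (n + 2) →₀ ℕ) // 1 ≤ p.1 ∧ p.2.degree = p.1} => a p.1.1 p.1.2) μ)
    (hlaw : ∀ N : ℕ, 1 ≤ N → ∀ J : Fin (n + 2) →₀ ℕ, J.degree = N →
      HasLaw (a N J) SUPoly.stdComplexGaussian μ) :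
    ∀ᵐ ω ∂μ, ∀ φ : SUPoly.ContForm n n,
      Tendsto
        (fun N : ℕ => (1 / (N : ℂ)) * SUPoly.zeroCurrent (SUPoly.suPoly N (fun J => a N J ω)) φ)
        atTop (𝓝 (SUPoly.fsPairing φ)) := by
  have hA := fun (N : ℕ) (hN : 1 ≤ N) => SUPoly.map_coeff_eq_coeffLaw hindep hlaw hN
  have hs : ∀ u : SUPoly.Coord n, ∀ᵐ ω ∂μ, ∀ N : ℕ, 1 ≤ N →
      SUPoly.SimpleAlong (SUPoly.coeffPoly fun J : SUPoly.CoeffIdx n N => a N J ω) u := by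
    intro u
    rw [ae_all_iff]
    intro N
    by_cases hN : 1 ≤ N
    · have h := SUPoly.ae_simpleAlong n N u
      rw [← (hA N hN).2] at h
      filter_upwards [ae_of_ae_map (hA N hN).1 h] with ω hω _ using hω
    · exact Eventually.of_forall fun ω h => absurd h hN
  have hs1 := ae_all_iff.mpr fun r : SUPoly.PolIdx n => hs (SUPoly.polDir r)
  have hs2 := ae_all_iff.mpr fun i : Fin (n + 2) => hs (Pi.single i 1)
  have hX := SUPoly.ae_tsum_logDev_ne_top (fun N hN => (hA N hN).1) (fun N hN => (hA N hN).2)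
  -- The three events refer to finitely many directions, all `N` and all integer radii, but not to a
  -- form; `φ` is introduced only after `ω` is fixed.
  filter_upwards [hs1, hs2, hX] with ω h1 h2 h3 φ
  simp_rw [SUPoly.suPoly_eq_coeffPoly]
  exact SUPoly.tendsto_zeroCurrent (fun N _ => SUPoly.isHomogeneous_coeffPoly _)
    (fun N hN r => h1 r N hN) (fun N hN i => h2 i N hN) h3 φ
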